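/- Fix $0<q<1$ and $t\in\mathbb{R}$. Let $U_q(\mathfrak{su}_2)$ be the Hopf $*$-algebra generated by $E,F,K^{\pm1}$ with \[ KE=q^2EK,\quad KF=q^{-2}FK,\quad [E,F]=\frac{K-K^{-1}}{q-q^{-1}},\quad K^*=K,\quad E^*=FK, \] \[ \Delta(K)=K\otimes K,\quad \Delta(E)=E\otimes 1+K\otimes E,\quad \Delta(F)=F\otimes K^{-1}+1\otimes F. \] Let $\mathrm{Rep}_q(\mathfrak{su}_2)$ be the tensor C$^*$-category of its finite-dimensional $*$-representations on Hilbert spaces that are spanned by weight vectors ($Kx=q^mx$ with $m\in\mathbb{Z}$), with morphisms the intertwiners, and with the braiding $\beta_{U,W}=\Sigma\circ R_{U,W}$, where $\Sigma$ is the flip and \[ R_{U,W}(x\otimes y)=q^{-mn/2}\sum_{k\ge 0}\Big(\prod_{j<k}\frac{(q^{-1}-q)q^{-j}}{[j+1]_q}\Big)E^kx\otimes F^ky,\qquad Kx=q^mx,\ Ky=q^ny,\quad [n]_q=\frac{q^n-q^{-n}}{q-q^{-1}}. \] Let $V=\mathbb{C}^2$ be the fundamental representation \[ E\mapsto\begin{pmatrix}0&q^{1/2}\\0&0\end{pmatrix},\quad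 F\mapsto\begin{pmatrix}0&0\\q^{-1/2}&0\end{pmatrix},\quad K\mapsto\begin{pmatrix}q&0\\0&q^{-1}\end{pmatrix}. \] Let $U_q^t(\mathfrak{t}_\theta)\subset U_q(\mathfrak{su}_2)$ be the coideal $*$-subalgebra generated by $B_t=F-q^{-2}EK^{-1}+itK^{-1}$, and let $\varepsilon$ be the restriction of the counit to it. For a finite-dimensional $*$-representation $X$ of $U_q^t(\mathfrak{t}_\theta)$ and $U$ in $\mathrm{Rep}_q(\mathfrak{su}_2)$ let $X\odot U=(\pi_X\otimes\pi_U)\Delta$, with the canonical associators $\Psi_{X,U,W}\colon (X\odot U)\odot W\to X\odot(U\otimes W)$. Let $\mathcal{D}=\mathrm{Rep}_q^t(\mathfrak{t}_\theta;\varepsilon)$ be the smallest full subcategory of the finite-dimensional $*$-representations of $U_q^t(\mathfrak{t}_\theta)$ that contains $\varepsilon$ and is closed under isomorphisms, subobjects, finite direct sums and $-\odot U$ for all $U$ in $\mathrm{Rep}_q(\mathfrak{su}_2)$. A ribbon braid on $\mathcal{D}$ is a natural isomorphism $\eta_{X,U}\colon X\odot U\to X\odot U$ (not required to be unitary) such that,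 for all $X$ in $\mathcal{D}$ and $U,W$ in $\mathrm{Rep}_q(\mathfrak{su}_2)$ and up to the associators, \[ \eta_{X\odot U,W}=(1_X\odot\beta_{W,U})(\eta_{X,W}\odot 1_U)(1_X\odot\beta_{U,W}),\qquad \eta_{X,U\otimes W}=\eta_{X\odot U,W}(\eta_{X,U}\odot 1_W). \] Two ribbon braids $\eta,\eta'$ on $\mathcal{D}$ are called isomorphic if there is a unitary monoidal automorphism $F$ of the identity functor of $\mathrm{Rep}_q(\mathfrak{su}_2)$ such that $\eta'_{X,U}=\eta_{X,U}(1_X\odot F_U)$ for all $X,U$; then the identity functor of $\mathcal{D}$, together with $F$, is an equivalence of ribbon braided module C$^*$-categories $(\mathcal{D},\eta)\cong(\mathcal{D},\eta')$. Then there is a ribbon braid $\eta$ on $\mathcal{D}$ such that $C=\eta_{\varepsilon,V}$ is not a scalar multiple of the identity; any two such ribbon braids are isomorphic; and for every such $\eta$ the singular values of $C$ on the two-dimensional Hilbert space $\varepsilon\odot V$, counted with multiplicity, are $q^{\lambda-1/2}$ and $q^{-\lambda-1/2}$, where $\lambda=\lambda_t$ is the unique real number with \[ t=q^{-1/2}\,\frac{q^{-\lambda}-q^{\lambda}}{q^{-1}-q}.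 \] -/

import Mathlib

open scoped TensorProduct

noncomputable section

set_option linter.unusedSectionVars false

namespace QSU2

/-! ### The Hopf `*`-algebra `U_q(su_2)` for `0 < q < 1` -/

/-- The parameter `q ∈ (0,1)`, seen as a complex number. -/
def qc (q : Set.Ioo (0 : ℝ) 1) : ℂ := ((q : ℝ) : ℂ)

lemma qc_ne_zero (q : Set.Ioo (0 : ℝ) 1) : qc q ≠ 0 := by
  have := q.2.1
  simp only [qc, ne_eq, Complex.ofReal_eq_zero]
  exact this.ne'

lemma star_qc (q : Set.Ioo (0 : ℝ) 1) : star (qc q) = qc q := Complex.conj_ofReal _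

/-- The generators of `U_q(su_2)`; `Ki` stands for `K⁻¹`. -/
inductive Gen : Type
  | E | F | K | Ki

/-- The defining relations of `U_q(su_2)`. -/
inductive Rel (q : Set.Ioo (0 : ℝ) 1) : FreeAlgebra ℂ Gen → FreeAlgebra ℂ Gen → Prop
  | K_Ki : Rel q (FreeAlgebra.ι ℂ Gen.K * FreeAlgebra.ι ℂ Gen.Ki) 1
  | Ki_K : Rel q (FreeAlgebra.ι ℂ Gen.Ki * FreeAlgebra.ι ℂ Gen.K) 1
  | K_E : Rel q (FreeAlgebra.ι ℂ Gen.K * FreeAlgebra.ι ℂ Gen.E)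
      ((qc q ^ 2) • (FreeAlgebra.ι ℂ Gen.E * FreeAlgebra.ι ℂ Gen.K))
  | K_F : Rel q (FreeAlgebra.ι ℂ Gen.K * FreeAlgebra.ι ℂ Gen.F)
      ((qc q ^ 2)⁻¹ • (FreeAlgebra.ι ℂ Gen.F * FreeAlgebra.ι ℂ Gen.K))
  | E_F : Rel q (FreeAlgebra.ι ℂ Gen.E * FreeAlgebra.ι ℂ Gen.F
        - FreeAlgebra.ι ℂ Gen.F * FreeAlgebra.ι ℂ Gen.E)
      ((qc q - (qc q)⁻¹)⁻¹ • (FreeAlgebra.ι ℂ Gen.K - FreeAlgebra.ι ℂ Gen.Ki))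

/-- The algebra `U_q(su_2)`. -/
def Uq (q : Set.Ioo (0 : ℝ) 1) : Type := RingQuot (Rel q)

variable {q : Set.Ioo (0 : ℝ) 1}

instance : Ring (Uq q) := inferInstanceAs (Ring (RingQuot (Rel q)))
instance : Algebra ℂ (Uq q) := inferInstanceAs (Algebra ℂ (RingQuot (Rel q)))

/-- The quotient map from the free algebra. -/
def mk (q : Set.Ioo (0 : ℝ) 1) : FreeAlgebra ℂ Gen →ₐ[ℂ] Uq q := RingQuot.mkAlgHom ℂ (Rel q)

/-- The images of the generators in `U_q(su_2)`. -/
def gen (q : Set.Ioo (0 : ℝ) 1) (g : Gen) : Uq q := mk q (FreeAlgebra.ι ℂ g)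

lemma gK_gKi : gen q .K * gen q .Ki = 1 := by
  have := RingQuot.mkAlgHom_rel ℂ (Rel.K_Ki (q := q))
  rw [map_mul, map_one] at this
  exact this

lemma gKi_gK : gen q .Ki * gen q .K = 1 := by
  have := RingQuot.mkAlgHom_rel ℂ (Rel.Ki_K (q := q))
  rw [map_mul, map_one] at this
  exact this

lemma gK_gE : gen q .K * gen q .E = (qc q ^ 2) • (gen q .E * gen q .K) := by
  have := RingQuot.mkAlgHom_rel ℂ (Rel.K_E (q := q))
  rw [map_smul, map_mul, map_mul] at this
  exact this

lemma gK_gF : gen q .K * gen q .F = (qc q ^ 2)⁻¹ • (gen q .F * gen q .K) := by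
  have := RingQuot.mkAlgHom_rel ℂ (Rel.K_F (q := q))
  rw [map_smul, map_mul, map_mul] at this
  exact this

lemma gE_gF : gen q .E * gen q .F - gen q .F * gen q .E
    = (qc q - (qc q)⁻¹)⁻¹ • (gen q .K - gen q .Ki) := by
  have := RingQuot.mkAlgHom_rel ℂ (Rel.E_F (q := q))
  rw [map_smul, map_sub, map_sub, map_mul, map_mul] at this
  exact this

/-- The relations of `U_q(su_2)` for four elements of an algebra. -/
structure IsRel {A : Type*} [Ring A] [Algebra ℂ A] (q : Set.Ioo (0 : ℝ) 1) (a : Gen → A) :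
    Prop where
  K_Ki : a .K * a .Ki = 1
  Ki_K : a .Ki * a .K = 1
  K_E : a .K * a .E = (qc q ^ 2) • (a .E * a .K)
  K_F : a .K * a .F = (qc q ^ 2)⁻¹ • (a .F * a .K)
  E_F : a .E * a .F - a .F * a .E = (qc q - (qc q)⁻¹)⁻¹ • (a .K - a .Ki)

lemma isRel_gen : IsRel q (gen q) := ⟨gK_gKi, gKi_gK, gK_gE, gK_gF, gE_gF⟩

/-- The universal property of `U_q(su_2)`. -/
def lift {A : Type*} [Ring A] [Algebra ℂ A] (a : Gen → A) (h : IsRel q a) : Uq q →ₐ[ℂ] A :=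
  RingQuot.liftAlgHom ℂ (s := Rel q) ⟨FreeAlgebra.lift ℂ a, by
    intro x y hxy
    cases hxy
    · simpa using h.K_Ki
    · simpa using h.Ki_K
    · simpa using h.K_E
    · simpa using h.K_F
    · simpa using h.E_F⟩

@[simp] lemma lift_gen {A : Type*} [Ring A] [Algebra ℂ A] (a : Gen → A) (h : IsRel q a) (g : Gen) :
    lift a h (gen q g) = a g := by
  unfold lift gen
  erw [RingQuot.liftAlgHom_mkAlgHom_apply]
  simp

lemma algHom_ext {A : Type*} [Ring A] [Algebra ℂ A] {f g : Uq q →ₐ[ℂ] A}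
    (h : ∀ x, f (gen q x) = g (gen q x)) : f = g := by
  apply RingQuot.ringQuot_ext' ℂ
  apply FreeAlgebra.hom_ext
  funext x
  exact h x

section relations

variable {A : Type*} [Ring A] [Algebra ℂ A] {a : Gen → A}

lemma IsRel.E_K (h : IsRel q a) : a .E * a .K = (qc q ^ 2)⁻¹ • (a .K * a .E) := by
  rw [h.K_E, smul_smul, inv_mul_cancel₀ (pow_ne_zero 2 (qc_ne_zero q)), one_smul]

lemma IsRel.F_K (h : IsRel q a) : a .F * a .K = (qc q ^ 2) • (a .K * a .F) := by
  rw [h.K_F, smul_smul, mul_inv_cancel₀ (pow_ne_zero 2 (qc_ne_zero q)), one_smul]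

lemma IsRel.Ki_E (h : IsRel q a) : a .Ki * a .E = (qc q ^ 2)⁻¹ • (a .E * a .Ki) := by
  have : a .Ki * (a .E * a .K) * a .Ki = (qc q ^ 2)⁻¹ • (a .Ki * (a .K * a .E) * a .Ki) := by
    rw [h.E_K, mul_smul_comm, smul_mul_assoc]
  rwa [← mul_assoc, ← mul_assoc, mul_assoc _ (a .K), h.K_Ki, mul_one, h.Ki_K, one_mul] at this

lemma IsRel.E_Ki (h : IsRel q a) : a .E * a .Ki = (qc q ^ 2) • (a .Ki * a .E) := by
  rw [h.Ki_E, smul_smul, mul_inv_cancel₀ (pow_ne_zero 2 (qc_ne_zero q)), one_smul]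

lemma IsRel.Ki_F (h : IsRel q a) : a .Ki * a .F = (qc q ^ 2) • (a .F * a .Ki) := by
  have : a .Ki * (a .F * a .K) * a .Ki = (qc q ^ 2) • (a .Ki * (a .K * a .F) * a .Ki) := by
    rw [h.F_K, mul_smul_comm, smul_mul_assoc]
  rwa [← mul_assoc, ← mul_assoc, mul_assoc _ (a .K), h.K_Ki, mul_one, h.Ki_K, one_mul] at this

lemma IsRel.F_Ki (h : IsRel q a) : a .F * a .Ki = (qc q ^ 2)⁻¹ • (a .Ki * a .F) := by
  rw [h.Ki_F, smul_smul, inv_mul_cancel₀ (pow_ne_zero 2 (qc_ne_zero q)), one_smul]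

end relations

/-- The opposite algebra, with the complex conjugate scalar multiplication. -/
def ConjOp (A : Type) : Type := Aᵐᵒᵖ

instance {A : Type} [Ring A] : Ring (ConjOp A) := inferInstanceAs (Ring Aᵐᵒᵖ)

instance {A : Type} [Ring A] [Algebra ℂ A] : Algebra ℂ (ConjOp A) :=
  RingHom.toAlgebra' ((algebraMap ℂ Aᵐᵒᵖ).comp (starRingEnd ℂ)) fun c x =>
    Algebra.commutes (R := ℂ) (A := Aᵐᵒᵖ) (starRingEnd ℂ c) x

/-- The identity map of `A` to its conjugate opposite. -/
def toConjOp {A : Type} (a : A) : ConjOp A := MulOpposite.op a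

/-- The identity map to `A` from its conjugate opposite. -/
def ofConjOp {A : Type} (a : ConjOp A) : A := MulOpposite.unop a

lemma toConjOp_mul {A : Type} [Ring A] (a b : A) :
    toConjOp a * toConjOp b = toConjOp (b * a) := rfl
lemma toConjOp_sub {A : Type} [Ring A] (a b : A) :
    toConjOp a - toConjOp b = toConjOp (a - b) := rfl
lemma toConjOp_one {A : Type} [Ring A] : toConjOp (1 : A) = 1 := rfl
lemma toConjOp_smul {A : Type} [Ring A] [Algebra ℂ A] (c : ℂ) (a : A) :
    c • toConjOp a = toConjOp (star c • a) := by
  rw [Algebra.smul_def, Algebra.smul_def, Algebra.commutes (R := ℂ) (A := A)]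
  rfl
lemma ofConjOp_smul {A : Type} [Ring A] [Algebra ℂ A] (c : ℂ) (a : ConjOp A) :
    ofConjOp (c • a) = star c • ofConjOp a :=
  congrArg ofConjOp (toConjOp_smul c (ofConjOp a))

/-- The involution on generators: `K* = K`, `E* = FK` and `F* = K⁻¹E`. -/
def starGen (q : Set.Ioo (0 : ℝ) 1) : Gen → Uq q
  | .E => gen q .F * gen q .K
  | .F => gen q .Ki * gen q .E
  | .K => gen q .K
  | .Ki => gen q .Ki

lemma isRel_starGen : IsRel q (fun g => toConjOp (starGen q g)) where
  K_Ki := by simp only [starGen, toConjOp_mul, gKi_gK, toConjOp_one]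
  Ki_K := by simp only [starGen, toConjOp_mul, gK_gKi, toConjOp_one]
  K_E := by
    simp only [starGen, toConjOp_mul, toConjOp_smul, star_pow, star_qc]
    rw [← mul_assoc (gen q .K), ← smul_mul_assoc, ← isRel_gen.F_K]
  K_F := by
    simp only [starGen, toConjOp_mul, toConjOp_smul, star_pow, star_qc, star_inv₀]
    rw [mul_assoc, isRel_gen.E_K, mul_smul_comm, ← mul_assoc, ← mul_assoc]
    simp only [gKi_gK, gK_gKi]
  E_F := by
    simp only [starGen, toConjOp_mul, toConjOp_sub, toConjOp_smul, star_sub, star_qc, star_inv₀]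
    have h1 : gen q .Ki * gen q .E * (gen q .F * gen q .K) = gen q .E * gen q .F := by
      rw [isRel_gen.F_K, isRel_gen.Ki_E, mul_smul_comm, smul_mul_assoc, smul_smul,
        mul_inv_cancel₀ (pow_ne_zero 2 (qc_ne_zero q)), one_smul, mul_assoc,
        ← mul_assoc (gen q .Ki), gKi_gK, one_mul]
    have h2 : gen q .F * gen q .K * (gen q .Ki * gen q .E) = gen q .F * gen q .E := by
      rw [mul_assoc, ← mul_assoc (gen q .K), gK_gKi, one_mul]
    rw [h1, h2, gE_gF]

/-- The involution of `U_q(su_2)`, as a homomorphism to the conjugate opposite algebra. -/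
def starHom (q : Set.Ioo (0 : ℝ) 1) : Uq q →ₐ[ℂ] ConjOp (Uq q) := lift _ isRel_starGen

instance : Star (Uq q) := ⟨fun a => ofConjOp (starHom q a)⟩

lemma star_def (a : Uq q) : star a = ofConjOp (starHom q a) := rfl

lemma star_gen (g : Gen) : star (gen q g) = starGen q g := by
  rw [star_def, starHom, lift_gen]
  rfl

lemma uq_star_mul (a b : Uq q) : star (a * b) = star b * star a := by
  simp only [star_def, map_mul]
  rfl

lemma uq_star_add (a b : Uq q) : star (a + b) = star a + star b := by
  simp only [star_def, map_add]
  rfl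

lemma uq_star_smul (c : ℂ) (a : Uq q) : star (c • a) = star c • star a := by
  rw [star_def, map_smul, ofConjOp_smul]
  rfl

/-- The square of the involution. -/
def starStar (q : Set.Ioo (0 : ℝ) 1) : Uq q →ₐ[ℂ] Uq q :=
  AlgHom.ofLinearMap
    { toFun := fun a => star (star a)
      map_add' := fun a b => by rw [uq_star_add, uq_star_add]
      map_smul' := fun c a => by rw [uq_star_smul, uq_star_smul, star_star, RingHom.id_apply] }
    (by
      have : star (1 : Uq q) = 1 := by rw [star_def, map_one]; rfl
      change star (star (1 : Uq q)) = 1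
      rw [this, this])
    (fun a b => by
      change star (star (a * b)) = star (star a) * star (star b)
      rw [uq_star_mul, uq_star_mul])

lemma starStar_eq : starStar q = AlgHom.id ℂ (Uq q) := by
  apply algHom_ext
  intro x
  change star (star (gen q x)) = gen q x
  rw [star_gen]
  cases x
  · simp only [starGen, uq_star_mul, star_gen]
    rw [← mul_assoc, gK_gKi, one_mul]
  · simp only [starGen, uq_star_mul, star_gen]
    rw [mul_assoc, gK_gKi, mul_one]
  · simp only [starGen, star_gen]
  · simp only [starGen, star_gen]

instance : StarRing (Uq q) where
  star_involutive a := DFunLike.congr_fun (starStar_eq (q := q)) a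
  star_mul := uq_star_mul
  star_add := uq_star_add

instance : StarModule ℂ (Uq q) := ⟨uq_star_smul⟩

/-- The comultiplication on generators. -/
def comulGen (q : Set.Ioo (0 : ℝ) 1) : Gen → Uq q ⊗[ℂ] Uq q
  | .E => gen q .E ⊗ₜ 1 + gen q .K ⊗ₜ gen q .E
  | .F => gen q .F ⊗ₜ gen q .Ki + 1 ⊗ₜ gen q .F
  | .K => gen q .K ⊗ₜ gen q .K
  | .Ki => gen q .Ki ⊗ₜ gen q .Ki

lemma isRel_comulGen : IsRel q (comulGen q) where
  K_Ki := by simp [comulGen, gK_gKi, Algebra.TensorProduct.one_def]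
  Ki_K := by simp [comulGen, gKi_gK, Algebra.TensorProduct.one_def]
  K_E := by
    simp only [comulGen, mul_add, add_mul, Algebra.TensorProduct.tmul_mul_tmul, one_mul, mul_one,
      gK_gE, smul_add, TensorProduct.smul_tmul', TensorProduct.tmul_smul]
  K_F := by
    simp only [comulGen, mul_add, add_mul, Algebra.TensorProduct.tmul_mul_tmul, one_mul, mul_one,
      gK_gF, smul_add, TensorProduct.smul_tmul', TensorProduct.tmul_smul, gK_gKi, gKi_gK]
  E_F := by
    have h1 : (gen q .K * gen q .F) ⊗ₜ[ℂ] (gen q .E * gen q .Ki)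
        = (gen q .F * gen q .K) ⊗ₜ[ℂ] (gen q .Ki * gen q .E) := by
      rw [gK_gF, isRel_gen.E_Ki, TensorProduct.smul_tmul_smul,
        inv_mul_cancel₀ (pow_ne_zero 2 (qc_ne_zero q)), one_smul]
    have h2 : gen q .E * gen q .F = gen q .F * gen q .E
        + (qc q - (qc q)⁻¹)⁻¹ • (gen q .K - gen q .Ki) := by rw [← gE_gF]; abel
    simp only [comulGen, mul_add, add_mul, Algebra.TensorProduct.tmul_mul_tmul, one_mul, mul_one,
      h1, h2, TensorProduct.add_tmul, TensorProduct.tmul_add, TensorProduct.smul_tmul',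
      TensorProduct.tmul_smul, TensorProduct.sub_tmul, TensorProduct.tmul_sub, smul_sub]
    abel

/-- The counit on generators. -/
def counitGen : Gen → ℂ
  | .E => 0
  | .F => 0
  | .K => 1
  | .Ki => 1

lemma isRel_counitGen : IsRel q counitGen where
  K_Ki := by simp [counitGen]
  Ki_K := by simp [counitGen]
  K_E := by simp [counitGen]
  K_F := by simp [counitGen]
  E_F := by simp [counitGen]

instance : Bialgebra ℂ (Uq q) :=
  Bialgebra.ofAlgHom (lift _ (isRel_comulGen (q := q))) (lift _ isRel_counitGen)
    (by
      apply algHom_ext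
      intro x
      cases x <;>
      simp [comulGen, TensorProduct.add_tmul, TensorProduct.tmul_add, add_assoc,
        Algebra.TensorProduct.one_def])
    (by
      apply algHom_ext
      intro x
      cases x <;> simp [comulGen, counitGen])
    (by
      apply algHom_ext
      intro x
      cases x <;> simp [comulGen, counitGen])

lemma comul_gen (g : Gen) : Bialgebra.comulAlgHom ℂ (Uq q) (gen q g) = comulGen q g :=
  lift_gen _ isRel_comulGen g

lemma counit_gen (g : Gen) : Bialgebra.counitAlgHom ℂ (Uq q) (gen q g) = counitGen g :=
  lift_gen _ isRel_counitGen g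

/-- Compatibility of `*`-structures can be checked on generators. -/
lemma map_star_of_gen {A : Type*} [Ring A] [StarRing A] [Algebra ℂ A] [StarModule ℂ A]
    (f : Uq q →ₐ[ℂ] A) (h : ∀ g, f (starGen q g) = star (f (gen q g))) (a : Uq q) :
    f (star a) = star (f a) := by
  obtain ⟨b, rfl⟩ : ∃ b, mk q b = a := RingQuot.mkAlgHom_surjective ℂ (Rel q) a
  induction b using FreeAlgebra.induction with
  | grade0 c =>
    rw [AlgHom.commutes, Algebra.algebraMap_eq_smul_one, star_smul, star_one, map_smul, map_smul,
      map_one, star_smul, star_one]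
  | grade1 g =>
    change f (star (gen q g)) = star (f (gen q g))
    rw [star_gen, h]
  | mul x y hx hy => rw [map_mul, star_mul, map_mul, map_mul, star_mul, hx, hy]
  | add x y hx hy => rw [map_add, star_add, map_add, map_add, star_add, hx, hy]

/-! ### Finite-dimensional `*`-representations -/

open CategoryTheory MonoidalCategory

/-- A finite-dimensional `*`-representation of a `*`-algebra `A` on a Hilbert space. -/
structure StarRep (A : Type) [Ring A] [StarRing A] [Algebra ℂ A] where
  /-- the underlying Hilbert space -/
  carrier : Type
  [normed : NormedAddCommGroup carrier]
  [inner : InnerProductSpace ℂ carrier]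
  [finite : FiniteDimensional ℂ carrier]
  /-- the action; the involution of `End` is the adjoint -/
  π : A →⋆ₐ[ℂ] (carrier →ₗ[ℂ] carrier)

namespace StarRep

section basic

variable {A : Type} [Ring A] [StarRing A] [Algebra ℂ A]

instance (X : StarRep A) : NormedAddCommGroup X.carrier := X.normed
instance (X : StarRep A) : InnerProductSpace ℂ X.carrier := X.inner
instance (X : StarRep A) : FiniteDimensional ℂ X.carrier := X.finite

/-- Morphisms of representations: intertwining linear maps. -/
@[ext]
structure Hom (X Y : StarRep A) where
  /-- the underlying linear map -/
  lin : X.carrier →ₗ[ℂ] Y.carrier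
  comm : ∀ a, lin ∘ₗ X.π a = Y.π a ∘ₗ lin

instance : Category (StarRep A) where
  Hom := Hom
  id X := ⟨LinearMap.id, fun a => by rw [LinearMap.id_comp, LinearMap.comp_id]⟩
  comp f g := ⟨g.lin ∘ₗ f.lin, fun a => by
    rw [LinearMap.comp_assoc, f.comm, ← LinearMap.comp_assoc, g.comm, LinearMap.comp_assoc]⟩

@[ext]
lemma hom_ext {X Y : StarRep A} {f g : X ⟶ Y} (h : f.lin = g.lin) : f = g := Hom.ext h

@[simp] lemma id_lin (X : StarRep A) : Hom.lin (𝟙 X) = LinearMap.id := rfl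
@[simp] lemma comp_lin {X Y Z : StarRep A} (f : X ⟶ Y) (g : Y ⟶ Z) :
    Hom.lin (f ≫ g) = g.lin ∘ₗ f.lin := rfl

lemma comm_apply {X Y : StarRep A} (f : X ⟶ Y) (a : A) (x : X.carrier) :
    f.lin (X.π a x) = Y.π a (f.lin x) := LinearMap.congr_fun (f.comm a) x

/-- The intertwiners form a subspace of all linear maps. -/
def homSubmodule (X Y : StarRep A) : Submodule ℂ (X.carrier →ₗ[ℂ] Y.carrier) where
  carrier := {f | ∀ a, f ∘ₗ X.π a = Y.π a ∘ₗ f}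
  zero_mem' a := by rw [LinearMap.zero_comp, LinearMap.comp_zero]
  add_mem' {f g} hf hg a := by rw [LinearMap.add_comp, LinearMap.comp_add, hf a, hg a]
  smul_mem' c f hf a := by rw [LinearMap.smul_comp, LinearMap.comp_smul, hf a]

/-- Morphisms as elements of the subspace of intertwiners. -/
def homEquiv (X Y : StarRep A) : (X ⟶ Y) ≃ homSubmodule X Y where
  toFun f := ⟨f.lin, f.comm⟩
  invFun f := ⟨f.1, f.2⟩

instance (X Y : StarRep A) : AddCommGroup (X ⟶ Y) := (homEquiv X Y).addCommGroup
instance (X Y : StarRep A) : Module ℂ (X ⟶ Y) := (homEquiv X Y).module ℂ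

@[simp] lemma add_lin {X Y : StarRep A} (f g : X ⟶ Y) : (f + g).lin = f.lin + g.lin := rfl
@[simp] lemma smul_lin {X Y : StarRep A} (c : ℂ) (f : X ⟶ Y) : (c • f).lin = c • f.lin := rfl

instance : Preadditive (StarRep A) where
  add_comp _ _ _ f f' g := by ext1; simp [LinearMap.comp_add]
  comp_add _ _ _ f g g' := by ext1; simp [LinearMap.add_comp]

instance : Linear ℂ (StarRep A) where
  smul_comp _ _ _ c f g := by ext1; simp [LinearMap.comp_smul]
  comp_smul _ _ _ f c g := by ext1; simp [LinearMap.smul_comp]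

/-- Isomorphisms from invertible intertwiners. -/
def mkIso {X Y : StarRep A} (e : X.carrier ≃ₗ[ℂ] Y.carrier)
    (h : ∀ a, e.toLinearMap ∘ₗ X.π a = Y.π a ∘ₗ e.toLinearMap) : X ≅ Y where
  hom := ⟨e.toLinearMap, h⟩
  inv := ⟨e.symm.toLinearMap, fun a => by
    ext y
    obtain ⟨x, rfl⟩ := e.surjective y
    have := LinearMap.congr_fun (h a) x
    simp only [LinearMap.comp_apply, LinearEquiv.coe_coe] at this ⊢
    rw [← this, e.symm_apply_apply, e.symm_apply_apply]⟩
  hom_inv_id := by ext x; exact e.symm_apply_apply x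
  inv_hom_id := by ext x; exact e.apply_symm_apply x

@[simp] lemma mkIso_hom_lin {X Y : StarRep A} (e : X.carrier ≃ₗ[ℂ] Y.carrier)
    (h : ∀ a, e.toLinearMap ∘ₗ X.π a = Y.π a ∘ₗ e.toLinearMap) :
    (mkIso e h).hom.lin = e.toLinearMap := rfl

@[simp] lemma mkIso_inv_lin {X Y : StarRep A} (e : X.carrier ≃ₗ[ℂ] Y.carrier)
    (h : ∀ a, e.toLinearMap ∘ₗ X.π a = Y.π a ∘ₗ e.toLinearMap) :
    (mkIso e h).inv.lin = e.symm.toLinearMap := rfl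

variable [StarModule ℂ A]

/-- The one-dimensional representation given by a `*`-character. -/
def ofChar (χ : A →⋆ₐ[ℂ] ℂ) : StarRep A where
  carrier := ℂ
  π := { Algebra.ofId ℂ (ℂ →ₗ[ℂ] ℂ) |>.comp χ.toAlgHom with
    map_star' := fun a => by
      change Algebra.ofId ℂ (ℂ →ₗ[ℂ] ℂ) (χ (star a)) = star (Algebra.ofId ℂ (ℂ →ₗ[ℂ] ℂ) (χ a))
      rw [map_star, Algebra.ofId_apply, Algebra.ofId_apply, algebraMap_star_comm] }

lemma ofChar_π (χ : A →⋆ₐ[ℂ] ℂ) (a : A) (z : ℂ) : (ofChar χ).π a z = χ a * z := rfl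

end basic

section tensor

variable {B C : Type} [Ring B] [StarRing B] [Algebra ℂ B] [StarModule ℂ B]
  [Ring C] [StarRing C] [Algebra ℂ C] [StarModule ℂ C]

/-- `π_X ⊗ π_U` as an action of the algebra `B ⊗ C` on `X ⊗ U`. -/
def tensAlg (X : StarRep B) (U : StarRep C) :
    B ⊗[ℂ] C →ₐ[ℂ] (X.carrier ⊗[ℂ] U.carrier →ₗ[ℂ] X.carrier ⊗[ℂ] U.carrier) :=
  (Module.endTensorEndAlgHom (R := ℂ) (S := ℂ) (A := ℂ) (M := X.carrier) (N := U.carrier)).comp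
    (Algebra.TensorProduct.map X.π.toAlgHom U.π.toAlgHom)

lemma tensAlg_tmul (X : StarRep B) (U : StarRep C) (b : B) (c : C) :
    tensAlg X U (b ⊗ₜ c) = TensorProduct.map (X.π b) (U.π c) := rfl

lemma tensAlg_star (X : StarRep B) (U : StarRep C) (z : B ⊗[ℂ] C) :
    tensAlg X U (star z) = star (tensAlg X U z) := by
  induction z with
  | zero =>
    have h : tensAlg X U (star 0) = 0 := by rw [star_zero]; exact map_zero _
    have h' : tensAlg X U 0 = 0 := map_zero _
    exact h.trans ((congrArg star h').trans (star_zero _)).symm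
  | add x y hx hy =>
    have h : tensAlg X U (star (x + y)) = tensAlg X U (star x) + tensAlg X U (star y) := by
      rw [star_add]; exact map_add _ _ _
    have h' : tensAlg X U (x + y) = tensAlg X U x + tensAlg X U y := map_add _ _ _
    refine h.trans (((congrArg star h').trans (star_add _ _)).trans ?_).symm
    exact congrArg₂ (· + ·) hx.symm hy.symm
  | tmul b c =>
    rw [TensorProduct.star_tmul, tensAlg_tmul, tensAlg_tmul, map_star, map_star,
      LinearMap.star_eq_adjoint, LinearMap.star_eq_adjoint, LinearMap.star_eq_adjoint,
      TensorProduct.adjoint_map]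

/-- The `*`-representation `π_X ⊗ π_U` of `B ⊗ C` on the Hilbert space `X ⊗ U`. -/
def box (X : StarRep B) (U : StarRep C) : StarRep (B ⊗[ℂ] C) where
  carrier := X.carrier ⊗[ℂ] U.carrier
  π := { tensAlg X U with map_star' := tensAlg_star X U }

/-- The tensor product of linear maps, on the underlying spaces of `box`. -/
def boxMap {X X' : StarRep B} {U U' : StarRep C} (f : X.carrier →ₗ[ℂ] X'.carrier)
    (g : U.carrier →ₗ[ℂ] U'.carrier) : (box X U).carrier →ₗ[ℂ] (box X' U').carrier :=
  TensorProduct.map f g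

lemma box_π_tmul (X : StarRep B) (U : StarRep C) (b : B) (c : C) :
    (box X U).π (b ⊗ₜ c) = boxMap (X.π b) (U.π c) := rfl

lemma boxMap_comm {X X' : StarRep B} {U U' : StarRep C} (f : X ⟶ X') (g : U ⟶ U')
    (z : B ⊗[ℂ] C) :
    boxMap f.lin g.lin ∘ₗ (box X U).π z = (box X' U').π z ∘ₗ boxMap f.lin g.lin := by
  induction z with
  | zero => simp only [map_zero, LinearMap.comp_zero, LinearMap.zero_comp]
  | add x y hx hy => rw [map_add, map_add, LinearMap.comp_add, LinearMap.add_comp, hx, hy]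
  | tmul b c =>
    rw [box_π_tmul, box_π_tmul]
    refine TensorProduct.ext' fun x u => ?_
    change f.lin (X.π b x) ⊗ₜ g.lin (U.π c u) = X'.π b (f.lin x) ⊗ₜ U'.π c (g.lin u)
    rw [comm_apply, comm_apply]

/-- The associativity isomorphism of the underlying vector spaces. -/
def boxAssoc {D : Type} [Ring D] [StarRing D] [Algebra ℂ D] [StarModule ℂ D]
    (X : StarRep B) (U : StarRep C) (V : StarRep D) :
    (box (box X U) V).carrier ≃ₗ[ℂ] (box X (box U V)).carrier :=
  TensorProduct.assoc ℂ X.carrier U.carrier V.carrier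

lemma boxAssoc_comm {D : Type} [Ring D] [StarRing D] [Algebra ℂ D] [StarModule ℂ D]
    (X : StarRep B) (U : StarRep C) (V : StarRep D) (w : (B ⊗[ℂ] C) ⊗[ℂ] D) :
    (boxAssoc X U V).toLinearMap ∘ₗ (box (box X U) V).π w
      = ((box X (box U V)).π (Algebra.TensorProduct.assoc ℂ ℂ ℂ B C D w)) ∘ₗ
        (boxAssoc X U V).toLinearMap := by
  induction w with
  | zero => simp only [map_zero, LinearMap.comp_zero, LinearMap.zero_comp]
  | add x y hx hy => simp only [map_add, LinearMap.comp_add, LinearMap.add_comp, hx, hy]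
  | tmul z d =>
    induction z with
    | zero => simp only [TensorProduct.zero_tmul, map_zero, LinearMap.comp_zero,
        LinearMap.zero_comp]
    | add x y hx hy =>
      simp only [TensorProduct.add_tmul, map_add, LinearMap.comp_add, LinearMap.add_comp, hx, hy]
    | tmul b c => exact TensorProduct.ext_threefold fun x u v => rfl

/-- Restriction of a representation along a `*`-homomorphism. -/
def pull (f : B →⋆ₐ[ℂ] C) (X : StarRep C) : StarRep B where
  carrier := X.carrier
  π := X.π.comp f

end tensor

end StarRep

/-- A bialgebra with an involution that is compatible with comultiplication and counit. -/
class StarBialgebra (A : Type) [Ring A] [StarRing A] [Bialgebra ℂ A] : Prop extends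
    StarModule ℂ A where
  comul_star : ∀ a : A, Coalgebra.comul (R := ℂ) (star a) = star (Coalgebra.comul (R := ℂ) a)
  counit_star : ∀ a : A, Coalgebra.counit (R := ℂ) (star a) = star (Coalgebra.counit (R := ℂ) a)

/-- A (right) coaction of a `*`-bialgebra `A` on a `*`-algebra `B`. -/
class StarCoaction (B A : Type) [Ring B] [StarRing B] [Algebra ℂ B] [StarModule ℂ B]
    [Ring A] [StarRing A] [Bialgebra ℂ A] [StarBialgebra A] where
  /-- the coaction map -/
  coact : B →⋆ₐ[ℂ] B ⊗[ℂ] A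
  coassoc : ∀ b, Algebra.TensorProduct.assoc ℂ ℂ ℂ B A A
      (Algebra.TensorProduct.map coact.toAlgHom (AlgHom.id ℂ A) (coact b))
    = Algebra.TensorProduct.map (AlgHom.id ℂ B) (Bialgebra.comulAlgHom ℂ A) (coact b)
  counital : ∀ b, Algebra.TensorProduct.map (AlgHom.id ℂ B) (Bialgebra.counitAlgHom ℂ A) (coact b)
    = b ⊗ₜ 1

section starbialgebra

variable (A : Type) [Ring A] [StarRing A] [Bialgebra ℂ A] [StarBialgebra A]

/-- The comultiplication as a `*`-homomorphism. -/
def comulStar : A →⋆ₐ[ℂ] A ⊗[ℂ] A :=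
  { Bialgebra.comulAlgHom ℂ A with map_star' := StarBialgebra.comul_star }

/-- The counit as a `*`-character. -/
def counitStar : A →⋆ₐ[ℂ] ℂ :=
  { Bialgebra.counitAlgHom ℂ A with map_star' := StarBialgebra.counit_star }

/-- A `*`-bialgebra coacts on itself by the comultiplication. -/
instance selfCoaction : StarCoaction A A where
  coact := comulStar A
  coassoc := Coalgebra.coassoc_apply
  counital a := Coalgebra.lTensor_counit_comul (R := ℂ) a

end starbialgebra

namespace StarRep

section action

variable {B A : Type} [Ring B] [StarRing B] [Algebra ℂ B] [StarModule ℂ B]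
    [Ring A] [StarRing A] [Bialgebra ℂ A] [StarBialgebra A] [StarCoaction B A]

/-- The representation `X ⊙ U = (π_X ⊗ π_U) ∘ coact` on the Hilbert space `X ⊗ U`. -/
def tens (X : StarRep B) (U : StarRep A) : StarRep B := pull StarCoaction.coact (box X U)

lemma tens_π (X : StarRep B) (U : StarRep A) (b : B) :
    (tens X U).π b = (box X U).π (StarCoaction.coact b) := rfl

/-- The tensor product of two intertwiners. -/
def tensHom {X X' : StarRep B} {U U' : StarRep A} (f : X ⟶ X') (g : U ⟶ U') :
    tens X U ⟶ tens X' U' :=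
  ⟨boxMap f.lin g.lin, fun _ => boxMap_comm f g _⟩

lemma box_tens_left (X : StarRep B) (U V : StarRep A) (z : B ⊗[ℂ] A) :
    (box (tens X U) V).π z = (box (box X U) V).π
      (Algebra.TensorProduct.map (StarCoaction.coact (A := A)).toAlgHom (AlgHom.id ℂ A) z) := by
  induction z with
  | zero => rw [map_zero, map_zero, map_zero]; rfl
  | add x y hx hy => rw [map_add, map_add, map_add, hx, hy]; rfl
  | tmul b a => rfl

lemma box_tens_right (X : StarRep B) (U V : StarRep A) (z : B ⊗[ℂ] A) :
    (box X (tens U V)).π z = (box X (box U V)).π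
      (Algebra.TensorProduct.map (AlgHom.id ℂ B) (Bialgebra.comulAlgHom ℂ A) z) := by
  induction z with
  | zero => rw [map_zero, map_zero, map_zero]; rfl
  | add x y hx hy => rw [map_add, map_add, map_add, hx, hy]; rfl
  | tmul b a => rfl

/-- The associator `(X ⊙ U) ⊙ V ≅ X ⊙ (U ⊗ V)`. -/
def assocIso (X : StarRep B) (U V : StarRep A) : tens (tens X U) V ≅ tens X (tens U V) :=
  mkIso (boxAssoc X U V) fun b => by
    rw [tens_π, tens_π, box_tens_left, box_tens_right, ← StarCoaction.coassoc]
    exact boxAssoc_comm X U V _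

variable (A) in
/-- The unit object: the trivial representation on `ℂ`, given by the counit. -/
def unit : StarRep A := ofChar (counitStar A)

/-- The right unit isomorphism of the underlying vector spaces. -/
def boxRid (X : StarRep B) : (box X (unit A)).carrier ≃ₗ[ℂ] X.carrier :=
  TensorProduct.rid ℂ X.carrier

/-- The left unit isomorphism of the underlying vector spaces. -/
def boxLid (X : StarRep A) : (box (unit A) X).carrier ≃ₗ[ℂ] X.carrier :=
  TensorProduct.lid ℂ X.carrier

lemma rid_comm (X : StarRep B) (z : B ⊗[ℂ] A) :
    (boxRid X).toLinearMap ∘ₗ (box X (unit A)).π z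
      = (X.π (Algebra.TensorProduct.rid ℂ ℂ B
          (Algebra.TensorProduct.map (AlgHom.id ℂ B) (Bialgebra.counitAlgHom ℂ A) z))) ∘ₗ
        (boxRid X).toLinearMap := by
  induction z with
  | zero => simp only [map_zero, LinearMap.comp_zero, LinearMap.zero_comp]
  | add x y hx hy => simp only [map_add, LinearMap.comp_add, LinearMap.add_comp, hx, hy]
  | tmul b a =>
    rw [Algebra.TensorProduct.map_tmul, Algebra.TensorProduct.rid_tmul, map_smul]
    refine TensorProduct.ext' fun x c => ?_
    change (Bialgebra.counitAlgHom ℂ A a * (show ℂ from c)) • X.π b x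
      = Bialgebra.counitAlgHom ℂ A a • X.π b ((show ℂ from c) • x)
    rw [map_smul, smul_smul]

/-- The right unitor `X ⊙ 𝟙 ≅ X`. -/
def ridIso (X : StarRep B) : tens X (unit A) ≅ X :=
  mkIso (boxRid X) fun b => by
    rw [tens_π]
    refine (rid_comm X _).trans ?_
    rw [StarCoaction.counital, Algebra.TensorProduct.rid_tmul, one_smul]
    rfl

lemma lid_comm (X : StarRep A) (z : A ⊗[ℂ] A) :
    (boxLid X).toLinearMap ∘ₗ (box (unit A) X).π z
      = (X.π (Algebra.TensorProduct.lid ℂ A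
          (Algebra.TensorProduct.map (Bialgebra.counitAlgHom ℂ A) (AlgHom.id ℂ A) z))) ∘ₗ
        (boxLid X).toLinearMap := by
  induction z with
  | zero => simp only [map_zero, LinearMap.comp_zero, LinearMap.zero_comp]
  | add x y hx hy => simp only [map_add, LinearMap.comp_add, LinearMap.add_comp, hx, hy]
  | tmul b a =>
    rw [Algebra.TensorProduct.map_tmul, Algebra.TensorProduct.lid_tmul, map_smul]
    refine TensorProduct.ext' fun c x => ?_
    change (Bialgebra.counitAlgHom ℂ A b * (show ℂ from c)) • X.π a x
      = Bialgebra.counitAlgHom ℂ A b • X.π a ((show ℂ from c) • x)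
    rw [map_smul, smul_smul]

/-- The left unitor `𝟙 ⊗ X ≅ X`. -/
def lidIso (X : StarRep A) : tens (unit A) X ≅ X :=
  mkIso (boxLid X) fun a => by
    rw [tens_π]
    refine (lid_comm X _).trans ?_
    have : Algebra.TensorProduct.map (Bialgebra.counitAlgHom ℂ A) (AlgHom.id ℂ A)
      ((selfCoaction A).coact a) = 1 ⊗ₜ a :=
      Coalgebra.rTensor_counit_comul (R := ℂ) a
    rw [this, Algebra.TensorProduct.lid_tmul, one_smul]
    rfl

/-- The tensor category of finite-dimensional `*`-representations of a `*`-bialgebra. -/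
instance : MonoidalCategory (StarRep A) where
  tensorObj X Y := tens X Y
  whiskerLeft X _ _ f := tensHom (𝟙 X) f
  whiskerRight f X := tensHom f (𝟙 X)
  tensorHom f g := tensHom f g
  tensorUnit := unit A
  associator X Y Z := assocIso X Y Z
  leftUnitor X := lidIso X
  rightUnitor X := ridIso X
  tensorHom_def f g := by
    ext1; exact TensorProduct.ext' fun x y => rfl
  id_tensorHom_id X Y := by
    ext1; exact TensorProduct.ext' fun x y => rfl
  tensorHom_comp_tensorHom f g f' g' := by
    ext1; exact TensorProduct.ext' fun x y => rfl
  associator_naturality f g h := by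
    ext1; exact TensorProduct.ext_threefold fun x y z => rfl
  leftUnitor_naturality f := by
    ext1
    refine TensorProduct.ext' fun x y => ?_
    exact (f.lin.map_smul x y).symm
  rightUnitor_naturality f := by
    ext1
    refine TensorProduct.ext' fun x y => ?_
    exact (f.lin.map_smul y x).symm
  pentagon W X Y Z := by
    ext1; exact TensorProduct.ext_fourfold fun x y z w => rfl
  triangle X Y := by
    ext1
    refine TensorProduct.ext_threefold fun x c y => ?_
    exact (TensorProduct.smul_tmul (show ℂ from c) x y).symm
  whiskerLeft_id X Y := by
    ext1; exact TensorProduct.ext' fun x y => rfl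
  id_whiskerRight X Y := by
    ext1; exact TensorProduct.ext' fun x y => rfl

/-- The module category structure on the representations of a `*`-algebra with coaction. -/
instance : MonoidalRightAction (StarRep A) (StarRep B) where
  actionObj X U := tens X U
  actionHomRight X _ _ g := tensHom (𝟙 X) g
  actionHomLeft f U := tensHom f (𝟙 U)
  actionHom f g := tensHom f g
  actionAssocIso X U V := (assocIso X U V).symm
  actionUnitIso X := ridIso X
  actionHom_def f g := by
    ext1; exact TensorProduct.ext' fun x y => rfl
  actionHomRight_id X U := by
    ext1; exact TensorProduct.ext' fun x y => rfl
  id_actionHomLeft X U := by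
    ext1; exact TensorProduct.ext' fun x y => rfl
  actionHom_comp f₁ f₂ g₁ g₂ := by
    ext1; exact TensorProduct.ext' fun x y => rfl
  actionAssocIso_hom_naturality f g h := by
    rw [Iso.symm_hom, Iso.symm_hom, Iso.eq_inv_comp, ← Category.assoc, Iso.comp_inv_eq]
    ext1; exact TensorProduct.ext_threefold fun x y z => rfl
  actionUnitIso_hom_naturality f := by
    ext1
    refine TensorProduct.ext' fun x y => ?_
    exact f.lin.map_smul y x
  actionHomRight_whiskerRight f U X := by
    rw [Iso.symm_hom, Iso.symm_inv, Iso.eq_inv_comp]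
    ext1; exact TensorProduct.ext_threefold fun x y z => rfl
  whiskerRight_actionHomLeft U _ _ f X := by
    rw [Iso.symm_hom, Iso.symm_inv, Iso.eq_inv_comp]
    ext1; exact TensorProduct.ext_threefold fun x y z => rfl
  actionHom_associator U V W X := by
    have : IsIso (tensHom (assocIso X U V).hom (𝟙 W)) :=
      ⟨tensHom (assocIso X U V).inv (𝟙 W), by
        ext1; exact TensorProduct.ext_fourfold fun x y z w => rfl, by
        ext1; exact TensorProduct.ext_fourfold'' fun x y z w => rfl⟩
    rw [← cancel_epi (assocIso X (U ⊗ V) W).hom,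
      ← cancel_epi (tensHom (assocIso X U V).hom (𝟙 W))]
    ext1; exact TensorProduct.ext_fourfold fun x y z w => rfl
  actionHom_leftUnitor U X := by
    rw [Iso.symm_hom, Iso.eq_inv_comp]
    ext1
    refine TensorProduct.ext_threefold fun x c y => ?_
    exact (TensorProduct.smul_tmul (show ℂ from c) x y).symm
  actionHom_rightUnitor U X := by
    rw [Iso.symm_hom, Iso.eq_inv_comp]
    ext1
    refine TensorProduct.ext_threefold fun x y c => ?_
    exact TensorProduct.tmul_smul (show ℂ from c) x y

end action

end StarRep

/-! ### Generalities on `*`-categories and module categories -/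

open MonoidalRightAction

/-- A `ℂ`-linear category with an involution `f ↦ f*` on morphisms, as underlies any
C*-category. -/
class StarCategory (C : Type*) [Category C] [Preadditive C] [Linear ℂ C] where
  /-- the adjoint of a morphism -/
  dag : ∀ {X Y : C}, (X ⟶ Y) → (Y ⟶ X)
  dag_dag : ∀ {X Y : C} (f : X ⟶ Y), dag (dag f) = f
  dag_id : ∀ X : C, dag (𝟙 X) = 𝟙 X
  dag_comp : ∀ {X Y Z : C} (f : X ⟶ Y) (g : Y ⟶ Z), dag (f ≫ g) = dag g ≫ dag f
  dag_add : ∀ {X Y : C} (f g : X ⟶ Y), dag (f + g) = dag f + dag g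
  dag_smul : ∀ {X Y : C} (c : ℂ) (f : X ⟶ Y), dag (c • f) = star c • dag f

/-- A morphism `v` is isometric if `v* v = 1`. -/
def IsIsometric {C : Type*} [Category C] [Preadditive C] [Linear ℂ C] [StarCategory C]
    {X Y : C} (v : X ⟶ Y) : Prop := v ≫ StarCategory.dag v = 𝟙 X

/-- An isomorphism is unitary if its inverse is its adjoint. -/
def IsUnitary {C : Type*} [Category C] [Preadditive C] [Linear ℂ C] [StarCategory C]
    {X Y : C} (e : X ≅ Y) : Prop := StarCategory.dag e.hom = e.inv

/-- The intertwiners between finite-dimensional `*`-representations, with the adjoints of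
linear maps between Hilbert spaces. -/
instance {A : Type} [Ring A] [StarRing A] [Algebra ℂ A] : StarCategory (StarRep A) where
  dag {X Y} f := ⟨LinearMap.adjoint f.lin, fun a => by
    have h := congrArg LinearMap.adjoint (f.comm (star a))
    have hx : X.π (star a) = star (X.π a) := map_star _ _
    have hy : Y.π (star a) = star (Y.π a) := map_star _ _
    rw [LinearMap.adjoint_comp, LinearMap.adjoint_comp, hx, hy] at h
    have h1 : LinearMap.adjoint (star (X.π a)) = X.π a := LinearMap.adjoint_adjoint _
    have h2 : LinearMap.adjoint (star (Y.π a)) = Y.π a := LinearMap.adjoint_adjoint _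
    rw [h1, h2] at h
    exact h.symm⟩
  dag_dag f := by ext1; exact LinearMap.adjoint_adjoint _
  dag_id X := by ext1; exact LinearMap.adjoint_id
  dag_comp f g := by ext1; exact LinearMap.adjoint_comp _ _
  dag_add f g := by ext1; exact map_add LinearMap.adjoint _ _
  dag_smul c f := by ext1; exact map_smulₛₗ LinearMap.adjoint _ _

section modulecat

variable {C : Type*} [Category C] [MonoidalCategory C]
  {D : Type*} [Category D] [MonoidalRightAction C D]

/-- A full subcategory inherits the involution. -/
instance {D : Type*} [Category D] [Preadditive D] [Linear ℂ D] [StarCategory D]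
    (Q : ObjectProperty D) : StarCategory Q.FullSubcategory where
  dag f := ObjectProperty.homMk (StarCategory.dag f.hom)
  dag_dag f := by ext1; exact StarCategory.dag_dag f.hom
  dag_id X := by ext1; exact StarCategory.dag_id X.obj
  dag_comp f g := by ext1; exact StarCategory.dag_comp f.hom g.hom
  dag_add f g := by ext1; exact StarCategory.dag_add f.hom g.hom
  dag_smul c f := by ext1; exact StarCategory.dag_smul c f.hom

/-- Full monoidal subcategories of `C` act on every `C`-module category. -/
instance restrictActing (P : ObjectProperty C) [P.IsMonoidal] :
    MonoidalRightAction P.FullSubcategory D where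
  actionObj X U := X ⊙ᵣ U.obj
  actionHomRight X _ _ g := X ⊴ᵣ g.hom
  actionHomLeft f U := f ⊵ᵣ U.obj
  actionHom f g := f ⊙ᵣₘ g.hom
  actionAssocIso X U V := αᵣ X U.obj V.obj
  actionUnitIso X := ρᵣ[C] X
  actionHom_def f g := MonoidalRightAction.actionHom_def f g.hom
  actionHomRight_id U X := MonoidalRightAction.actionHomRight_id U.obj X
  id_actionHomLeft U X := MonoidalRightAction.id_actionHomLeft U.obj X
  actionHom_comp f₁ f₂ g₁ g₂ := MonoidalRightAction.actionHom_comp f₁ f₂ g₁.hom g₂.hom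
  actionAssocIso_hom_naturality f g h :=
    MonoidalRightAction.actionAssocIso_hom_naturality f g.hom h.hom
  actionUnitIso_hom_naturality f := MonoidalRightAction.actionUnitIso_hom_naturality (C := C) f
  actionHomRight_whiskerRight f U X :=
    MonoidalRightAction.actionHomRight_whiskerRight f.hom U.obj X
  whiskerRight_actionHomLeft U _ _ f X :=
    MonoidalRightAction.whiskerRight_actionHomLeft U.obj f.hom X
  actionHom_associator U V W X :=
    MonoidalRightAction.actionHom_associator U.obj V.obj W.obj X
  actionHom_leftUnitor U X := MonoidalRightAction.actionHom_leftUnitor U.obj X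
  actionHom_rightUnitor U X := MonoidalRightAction.actionHom_rightUnitor U.obj X

variable (C) in
/-- The objects with property `Q` are stable under the action of `C`. -/
class StableUnderAction (Q : ObjectProperty D) : Prop where
  stable : ∀ (X : D) (U : C), Q X → Q (X ⊙ᵣ U)

/-- Full subcategories of `D` that are stable under the action are module categories. -/
instance restrictActed (Q : ObjectProperty D) [StableUnderAction C Q] :
    MonoidalRightAction C Q.FullSubcategory where
  actionObj X U := ⟨X.obj ⊙ᵣ U, StableUnderAction.stable X.obj U X.property⟩
  actionHomRight X _ _ g := ObjectProperty.homMk (X.obj ⊴ᵣ g)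
  actionHomLeft f U := ObjectProperty.homMk (f.hom ⊵ᵣ U)
  actionHom f g := ObjectProperty.homMk (f.hom ⊙ᵣₘ g)
  actionAssocIso X U V := Q.isoMk (αᵣ X.obj U V)
  actionUnitIso X := Q.isoMk (ρᵣ[C] X.obj)
  actionHom_def f g := by ext1; exact MonoidalRightAction.actionHom_def f.hom g
  actionHomRight_id U X := by ext1; exact MonoidalRightAction.actionHomRight_id U X.obj
  id_actionHomLeft U X := by ext1; exact MonoidalRightAction.id_actionHomLeft U X.obj
  actionHom_comp f₁ f₂ g₁ g₂ := by
    ext1; exact MonoidalRightAction.actionHom_comp f₁.hom f₂.hom g₁ g₂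
  actionAssocIso_hom_naturality f g h := by
    ext1; exact MonoidalRightAction.actionAssocIso_hom_naturality f.hom g h
  actionUnitIso_hom_naturality f := by
    ext1; exact MonoidalRightAction.actionUnitIso_hom_naturality (C := C) f.hom
  actionHomRight_whiskerRight f U X := by
    ext1; exact MonoidalRightAction.actionHomRight_whiskerRight f U X.obj
  whiskerRight_actionHomLeft U _ _ f X := by
    ext1; exact MonoidalRightAction.whiskerRight_actionHomLeft U f X.obj
  actionHom_associator U V W X := by
    ext1; exact MonoidalRightAction.actionHom_associator U V W X.obj
  actionHom_leftUnitor U X := by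
    ext1; exact MonoidalRightAction.actionHom_leftUnitor U X.obj
  actionHom_rightUnitor U X := by
    ext1; exact MonoidalRightAction.actionHom_rightUnitor U X.obj

variable (C) in
/-- The objects of the module category generated by `X₀`: the smallest class of objects that
contains `X₀`, and that is closed under isomorphisms, subobjects, finite direct sums, and the
action of `C`. -/
inductive Generated [Preadditive D] [Linear ℂ D] [StarCategory D] (X₀ : D) : D → Prop
  | base : Generated X₀ X₀
  | iso {Y Z : D} (e : Y ≅ Z) : Generated X₀ Z → Generated X₀ Y
  | sub {Y Z : D} (v : Y ⟶ Z) (hv : IsIsometric v) : Generated X₀ Z → Generated X₀ Y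
  | sum {Y Z W : D} (u : Y ⟶ W) (v : Z ⟶ W) (hu : IsIsometric u) (hv : IsIsometric v)
      (huv : StarCategory.dag u ≫ u + StarCategory.dag v ≫ v = 𝟙 W) :
      Generated X₀ Y → Generated X₀ Z → Generated X₀ W
  | act {Y : D} (U : C) : Generated X₀ Y → Generated X₀ (Y ⊙ᵣ U)

variable (C) in
/-- `Generated`, as a property of objects. -/
def generated [Preadditive D] [Linear ℂ D] [StarCategory D] (X₀ : D) : ObjectProperty D :=
  Generated C X₀

instance [Preadditive D] [Linear ℂ D] [StarCategory D] (X₀ : D) :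
    StableUnderAction C (generated C X₀) := ⟨fun _ U h => Generated.act U h⟩

variable (C D) in
/-- A ribbon braid on a module category `D` over a braided tensor category `C`: natural
isomorphisms `η_{X,U} : X ⊙ U → X ⊙ U` that satisfy the octagon equation and the ribbon
equation. Here `αᵣ X U V : X ⊙ (U ⊗ V) ≅ (X ⊙ U) ⊙ V` is the inverse of the
associator `Ψ_{X,U,V}`. No compatibility of `η` with the involution is required. -/
structure RibbonBraid [BraidedCategory C] where
  /-- the components of the braid -/
  η : ∀ (X : D) (U : C), X ⊙ᵣ U ≅ X ⊙ᵣ U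
  naturality : ∀ {X Y : D} {U V : C} (f : X ⟶ Y) (g : U ⟶ V),
    (f ⊙ᵣₘ g) ≫ (η Y V).hom = (η X U).hom ≫ (f ⊙ᵣₘ g)
  octagon : ∀ (X : D) (U V : C),
    (η (X ⊙ᵣ U) V).hom =
      (αᵣ X U V).inv ≫ (X ⊴ᵣ (β_ U V).hom) ≫ (αᵣ X V U).hom ≫ ((η X V).hom ⊵ᵣ U) ≫
        (αᵣ X V U).inv ≫ (X ⊴ᵣ (β_ V U).hom) ≫ (αᵣ X U V).hom
  ribbon : ∀ (X : D) (U V : C),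
    (η X (U ⊗ V)).hom =
      (αᵣ X U V).hom ≫ ((η X U).hom ⊵ᵣ V) ≫ (η (X ⊙ᵣ U) V).hom ≫ (αᵣ X U V).inv

/-- `(F, G, G₂)` is an equivalence between ribbon braided module C*-categories
`(D, η)` and `(D', η')` over `C`: `F` is a unitary monoidal automorphism of the identity functor
of `C`, `G` is a linear `*`-functor and an equivalence, and `G₂` is a unitary natural
isomorphism, such that the two diagrams for the associators and for the braids commute. -/
structure IsBraidedEquivalence [Preadditive C] [Linear ℂ C] [StarCategory C] [BraidedCategory C]
    [Preadditive D] [Linear ℂ D] [StarCategory D]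
    {D' : Type*} [Category D'] [MonoidalRightAction C D']
    [Preadditive D'] [Linear ℂ D'] [StarCategory D']
    (η : RibbonBraid C D) (η' : RibbonBraid C D')
    (F : 𝟭 C ≅ 𝟭 C) (G : D ⥤ D') (G₂ : ∀ (X : D) (U : C), G.obj X ⊙ᵣ U ≅ G.obj (X ⊙ᵣ U)) :
    Prop where
  F_monoidal : NatTrans.IsMonoidal F.hom
  F_unitary : ∀ U : C, IsUnitary (F.app U)
  G_equivalence : G.IsEquivalence
  G_additive : G.Additive
  G_linear : ∀ {X Y : D} (c : ℂ) (f : X ⟶ Y), G.map (c • f) = c • G.map f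
  G_star : ∀ {X Y : D} (f : X ⟶ Y), G.map (StarCategory.dag f) = StarCategory.dag (G.map f)
  G₂_natural : ∀ {X Y : D} {U V : C} (f : X ⟶ Y) (g : U ⟶ V),
    (G.map f ⊙ᵣₘ g) ≫ (G₂ Y V).hom = (G₂ X U).hom ≫ G.map (f ⊙ᵣₘ g)
  G₂_unitary : ∀ (X : D) (U : C), IsUnitary (G₂ X U)
  pentagon : ∀ (X : D) (U V : C),
    ((G₂ X U).hom ⊵ᵣ V) ≫ (G₂ (X ⊙ᵣ U) V).hom ≫ G.map (αᵣ X U V).inv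
      = (αᵣ (G.obj X) U V).inv ≫ (G₂ X (U ⊗ V)).hom
  braid : ∀ (X : D) (U : C),
    (η'.η (G.obj X) U).hom ≫ (G₂ X U).hom
      = (G.obj X ⊴ᵣ F.hom.app U) ≫ (G₂ X U).hom ≫ G.map (η.η X U).hom

end modulecat

/-! ### The category `Rep_q(su_2)` -/

instance : StarBialgebra (Uq q) where
  comul_star a := map_star_of_gen (Bialgebra.comulAlgHom ℂ (Uq q)) (by
    intro g
    rw [comul_gen]
    cases g
    · simp only [starGen, comulGen, map_mul, comul_gen, star_add, TensorProduct.star_tmul,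
        star_gen, star_one, add_mul, Algebra.TensorProduct.tmul_mul_tmul, gKi_gK, one_mul]
    · simp only [starGen, comulGen, map_mul, comul_gen, star_add, TensorProduct.star_tmul,
        star_gen, star_one, mul_add, Algebra.TensorProduct.tmul_mul_tmul, gKi_gK, mul_one]
    · simp only [starGen, comulGen, comul_gen, TensorProduct.star_tmul, star_gen]
    · simp only [starGen, comulGen, comul_gen, TensorProduct.star_tmul, star_gen]) a
  counit_star a := map_star_of_gen (Bialgebra.counitAlgHom ℂ (Uq q)) (by
    intro g
    rw [counit_gen]
    cases g <;> simp only [starGen, map_mul, counit_gen, counitGen] <;> simp) a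

/-- The weight space of weight `m`, where `K` acts as `q^m`. -/
def wt (X : StarRep (Uq q)) (m : ℤ) : Submodule ℂ X.carrier :=
  Module.End.eigenspace (X.π (gen q .K)) (qc q ^ m)

/-- A representation is admissible if it is the sum of its weight spaces of integral weight. -/
def admissible (q : Set.Ioo (0 : ℝ) 1) : ObjectProperty (StarRep (Uq q)) :=
  fun X => ⨆ m : ℤ, wt X m = ⊤

lemma mem_wt {X : StarRep (Uq q)} {m : ℤ} {x : X.carrier} :
    x ∈ wt X m ↔ X.π (gen q .K) x = qc q ^ m • x := Module.End.mem_eigenspace_iff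

/-- Two linear maps on an admissible representation agree if they agree on weight vectors. -/
lemma ext_wt {X : StarRep (Uq q)} (hX : admissible q X) {M : Type*} [AddCommGroup M] [Module ℂ M]
    {f g : X.carrier →ₗ[ℂ] M} (h : ∀ m, ∀ x ∈ wt X m, f x = g x) : f = g := by
  have : (⊤ : Submodule ℂ X.carrier) ≤ LinearMap.eqLocus f g := by
    rw [← (show ⨆ m : ℤ, wt X m = ⊤ from hX)]
    exact iSup_le fun m x hx => h m x hx
  ext x
  exact this trivial

/-- The pure tensors in the underlying space of a tensor product. -/
def pt {B A : Type} [Ring B] [StarRing B] [Algebra ℂ B] [StarModule ℂ B]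
    [Ring A] [StarRing A] [Bialgebra ℂ A] [StarBialgebra A] [StarCoaction B A]
    {X : StarRep B} {U : StarRep A} (x : X.carrier) (u : U.carrier) : (X.tens U).carrier :=
  x ⊗ₜ[ℂ] u

/-- The category `Rep_q(su_2)` of finite-dimensional admissible `*`-representations of
`U_q(su_2)`. -/
abbrev RepUq (q : Set.Ioo (0 : ℝ) 1) : Type 1 := (admissible q).FullSubcategory

/-- The action of a generator. -/
abbrev op (X : StarRep (Uq q)) (g : Gen) : X.carrier →ₗ[ℂ] X.carrier := X.π (gen q g)

lemma op_op (X : StarRep (Uq q)) (g h : Gen) (x : X.carrier) :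
    op X g (op X h x) = X.π (gen q g * gen q h) x := by
  rw [map_mul]; rfl

lemma wt_K {X : StarRep (Uq q)} {m : ℤ} {x : X.carrier} (hx : x ∈ wt X m) :
    op X .K x = qc q ^ m • x := mem_wt.1 hx

lemma wt_Ki {X : StarRep (Uq q)} {m : ℤ} {x : X.carrier} (hx : x ∈ wt X m) :
    op X .Ki x = qc q ^ (-m) • x := by
  have h : op X .Ki (op X .K x) = x := by rw [op_op, gKi_gK, map_one]; rfl
  rw [wt_K hx, map_smul] at h
  rw [zpow_neg, eq_inv_smul_iff₀ (zpow_ne_zero _ (qc_ne_zero q))]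
  exact h

lemma wt_E {X : StarRep (Uq q)} {m : ℤ} {x : X.carrier} (hx : x ∈ wt X m) :
    op X .E x ∈ wt X (m + 2) := by
  rw [mem_wt]
  change op X .K (op X .E x) = _
  rw [op_op, gK_gE, map_smul, LinearMap.smul_apply, ← op_op, wt_K hx, map_smul, smul_smul,
    add_comm, zpow_add₀ (qc_ne_zero q)]
  rfl

lemma wt_F {X : StarRep (Uq q)} {m : ℤ} {x : X.carrier} (hx : x ∈ wt X m) :
    op X .F x ∈ wt X (m - 2) := by
  rw [mem_wt]
  change op X .K (op X .F x) = _
  rw [op_op, gK_gF, map_smul, LinearMap.smul_apply, ← op_op, wt_K hx, map_smul, smul_smul,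
    sub_eq_add_neg, add_comm, zpow_add₀ (qc_ne_zero q)]
  rfl

lemma wt_E_pow {X : StarRep (Uq q)} {m : ℤ} {x : X.carrier} (hx : x ∈ wt X m) (k : ℕ) :
    (op X .E ^ k) x ∈ wt X (m + 2 * k) := by
  induction k with
  | zero => simpa using hx
  | succ k ih =>
    rw [pow_succ']
    have := wt_E ih
    rw [show m + 2 * (k : ℤ) + 2 = m + 2 * ((k + 1 : ℕ) : ℤ) by push_cast; ring] at this
    exact this

lemma wt_F_pow {X : StarRep (Uq q)} {m : ℤ} {x : X.carrier} (hx : x ∈ wt X m) (k : ℕ) :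
    (op X .F ^ k) x ∈ wt X (m - 2 * k) := by
  induction k with
  | zero => simpa using hx
  | succ k ih =>
    rw [pow_succ']
    have := wt_F ih
    rw [show m - 2 * (k : ℤ) - 2 = m - 2 * ((k + 1 : ℕ) : ℤ) by push_cast; ring] at this
    exact this

/-- Powers of `q` with real exponent. -/
def qpow (q : Set.Ioo (0 : ℝ) 1) (s : ℝ) : ℂ := (((q : ℝ) ^ s : ℝ) : ℂ)

lemma qpow_add (s s' : ℝ) : qpow q (s + s') = qpow q s * qpow q s' := by
  rw [qpow, Real.rpow_add q.2.1, Complex.ofReal_mul]; rfl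

lemma qpow_int (m : ℤ) : qpow q m = qc q ^ m := by
  rw [qpow, Real.rpow_intCast, Complex.ofReal_zpow]; rfl

lemma qpow_zero : qpow q 0 = 1 := by simp [qpow]

lemma qc_zpow_inj {m n : ℤ} (h : qc q ^ m = qc q ^ n) : m = n := by
  rw [qc, ← Complex.ofReal_zpow, ← Complex.ofReal_zpow, Complex.ofReal_inj] at h
  exact zpow_right_injective₀ q.2.1 q.2.2.ne h

lemma qc_sub_ne : qc q - (qc q)⁻¹ ≠ 0 := by
  intro h
  have : qc q ^ (1 : ℤ) = qc q ^ (-1 : ℤ) := by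
    rw [zpow_one, zpow_neg_one]; exact sub_eq_zero.1 h
  exact absurd (qc_zpow_inj this) (by norm_num)

/-- The quantum integers `[m] = (q^m - q^{-m}) / (q - q⁻¹)`. -/
def qInt (q : Set.Ioo (0 : ℝ) 1) (m : ℤ) : ℂ := (qc q ^ m - qc q ^ (-m)) / (qc q - (qc q)⁻¹)

lemma qInt_ne_zero {m : ℤ} (hm : m ≠ 0) : qInt q m ≠ 0 := by
  refine div_ne_zero (fun h => hm ?_) qc_sub_ne
  have := qc_zpow_inj (sub_eq_zero.1 h)
  omega

/-- The coefficients `c_k = (q⁻¹ - q)^k q^{-k(k-1)/2} / [k]!` of the universal `R`-matrix, as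
`∏_{j < k} (q⁻¹ - q) q^{-j} / [j+1]`. -/
def rc (q : Set.Ioo (0 : ℝ) 1) (k : ℕ) : ℂ :=
  ∏ j ∈ Finset.range k, ((qc q)⁻¹ - qc q) * qc q ^ (-(j : ℤ)) / qInt q (j + 1)

lemma rc_zero : rc q 0 = 1 := rfl

/-- The inverse quotients of subsequent coefficients. -/
def rg (q : Set.Ioo (0 : ℝ) 1) (k : ℕ) : ℂ :=
  (1 - qc q ^ (2 * (k : ℤ))) * (qc q)⁻¹ / ((qc q)⁻¹ - qc q) ^ 2

lemma rg_zero : rg q 0 = 0 := by simp [rg]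

lemma qc_sub_ne' : (qc q)⁻¹ - qc q ≠ 0 := by
  rw [← neg_sub, neg_ne_zero]; exact qc_sub_ne

lemma rg_rc (k : ℕ) : rg q (k + 1) * rc q (k + 1) = rc q k := by
  rw [rc, Finset.prod_range_succ]
  change _ * (rc q k * _) = _
  rw [mul_left_comm]
  convert mul_one _ using 2
  have h1 := qInt_ne_zero (q := q) (m := (k : ℤ) + 1) (by omega)
  have h2 := qc_sub_ne' (q := q)
  have h3 := qc_sub_ne (q := q)
  have h0 := qc_ne_zero q
  have h4 := zpow_ne_zero (k : ℤ) h0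
  rw [← mul_div_assoc, div_eq_one_iff_eq h1, rg, qInt, Nat.cast_succ, neg_add, mul_add, two_mul,
    zpow_add₀ h0, zpow_add₀ h0, zpow_add₀ h0, zpow_add₀ h0, zpow_neg, mul_one, zpow_neg, zpow_one]
  rw [show (qc q - (qc q)⁻¹) = - ((qc q)⁻¹ - qc q) by ring] at *
  simp only [zpow_natCast]
  rw [zpow_ofNat]
  field_simp
  ring

lemma rg_add (i j : ℕ) : rg q (i + j) = rg q i + qc q ^ (2 * (i : ℤ)) * rg q j := by
  rw [rg, rg, rg, ← mul_div_assoc, ← add_div]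
  congr 1
  push_cast
  rw [mul_add, zpow_add₀ (qc_ne_zero q)]
  ring

lemma rg_add' (i j : ℕ) : rg q (i + j) = qc q ^ (2 * (j : ℤ)) * rg q i + rg q j := by
  rw [add_comm i j, rg_add, add_comm]

section tensorgen

variable {X U : StarRep (Uq q)}

/-- Pure tensors, as a bilinear map. -/
def ptL (X U : StarRep (Uq q)) : X.carrier →ₗ[ℂ] U.carrier →ₗ[ℂ] (X.tens U).carrier :=
  TensorProduct.mk ℂ X.carrier U.carrier

lemma ptL_apply (x : X.carrier) (u : U.carrier) : ptL X U x u = pt x u := rfl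

/-- The tensor product of two linear maps. -/
def tmap {X' U' : StarRep (Uq q)} (f : X.carrier →ₗ[ℂ] X'.carrier)
    (g : U.carrier →ₗ[ℂ] U'.carrier) : (X.tens U).carrier →ₗ[ℂ] (X'.tens U').carrier :=
  StarRep.boxMap f g

lemma tmap_pt {X' U' : StarRep (Uq q)} (f : X.carrier →ₗ[ℂ] X'.carrier)
    (g : U.carrier →ₗ[ℂ] U'.carrier) (x : X.carrier) (u : U.carrier) :
    tmap f g (pt x u) = pt (f x) (g u) := rfl

lemma pt_add_left (x y : X.carrier) (u : U.carrier) : pt (x + y) u = pt x u + pt y u :=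
  LinearMap.map_add₂ (ptL X U) x y u

lemma pt_add_right (x : X.carrier) (u v : U.carrier) : pt x (u + v) = pt x u + pt x v :=
  map_add (ptL X U x) u v

lemma pt_smul_left (c : ℂ) (x : X.carrier) (u : U.carrier) : pt (c • x) u = c • pt x u :=
  LinearMap.map_smul₂ (ptL X U) c x u

lemma pt_smul_right (c : ℂ) (x : X.carrier) (u : U.carrier) : pt x (c • u) = c • pt x u :=
  map_smul (ptL X U x) c u

lemma pt_zero_left (u : U.carrier) : pt (0 : X.carrier) u = 0 :=
  LinearMap.map_zero₂ (ptL X U) u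

lemma pt_zero_right (x : X.carrier) : pt x (0 : U.carrier) = 0 :=
  map_zero (ptL X U x)

lemma pt_sum_left {ι : Type*} (s : Finset ι) (f : ι → X.carrier) (u : U.carrier) :
    pt (∑ i ∈ s, f i) u = ∑ i ∈ s, pt (f i) u := by
  change ptL X U _ u = _
  rw [map_sum, LinearMap.sum_apply]
  rfl

lemma pt_sum_right {ι : Type*} (s : Finset ι) (x : X.carrier) (f : ι → U.carrier) :
    pt x (∑ i ∈ s, f i) = ∑ i ∈ s, pt x (f i) := map_sum (ptL X U x) _ _

lemma tens_op (X U : StarRep (Uq q)) (g : Gen) :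
    op (X.tens U) g = (X.box U).π (comulGen q g) := by
  rw [← comul_gen]; rfl

lemma tens_E (x : X.carrier) (u : U.carrier) :
    op (X.tens U) .E (pt x u) = pt (op X .E x) u + pt (op X .K x) (op U .E u) := by
  rw [tens_op, comulGen, map_add]
  change pt (op X .E x) (U.π 1 u) + _ = _
  rw [map_one]
  rfl

lemma tens_F (x : X.carrier) (u : U.carrier) :
    op (X.tens U) .F (pt x u) = pt (op X .F x) (op U .Ki u) + pt x (op U .F u) := by
  rw [tens_op, comulGen, map_add]
  change _ + pt (X.π 1 x) (op U .F u) = _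
  rw [map_one]
  rfl

lemma tens_K (x : X.carrier) (u : U.carrier) :
    op (X.tens U) .K (pt x u) = pt (op X .K x) (op U .K u) := by
  rw [tens_op]; rfl

lemma tens_Ki (x : X.carrier) (u : U.carrier) :
    op (X.tens U) .Ki (pt x u) = pt (op X .Ki x) (op U .Ki u) := by
  rw [tens_op]; rfl

lemma wt_pt {m n : ℤ} {x : X.carrier} {u : U.carrier} (hx : x ∈ wt X m) (hu : u ∈ wt U n) :
    pt x u ∈ wt (X.tens U) (m + n) := by
  rw [mem_wt]
  refine (tens_K x u).trans ?_
  rw [wt_K hx, wt_K hu, pt_smul_left, pt_smul_right, smul_smul, zpow_add₀ (qc_ne_zero q)]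

lemma ext_pt {M : Type*} [AddCommGroup M] [Module ℂ M] {f g : (X.tens U).carrier →ₗ[ℂ] M}
    (h : ∀ x u, f (pt x u) = g (pt x u)) : f = g := TensorProduct.ext' h

lemma ext_pt_wt (hX : admissible q X) (hU : admissible q U) {M : Type*} [AddCommGroup M]
    [Module ℂ M] {f g : (X.tens U).carrier →ₗ[ℂ] M}
    (h : ∀ m n, ∀ x ∈ wt X m, ∀ u ∈ wt U n, f (pt x u) = g (pt x u)) : f = g := by
  refine ext_pt fun x u => ?_
  have h1 : ∀ m, ∀ x ∈ wt X m, f ∘ₗ ptL X U x = g ∘ₗ ptL X U x := fun m x hx =>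
    ext_wt hU fun n u hu => h m n x hx u hu
  have h2 : f ∘ₗ (ptL X U).flip u = g ∘ₗ (ptL X U).flip u :=
    ext_wt hX fun m x hx => LinearMap.congr_fun (h1 m x hx) u
  exact LinearMap.congr_fun h2 x

end tensorgen

lemma admissible_tens {X U : StarRep (Uq q)} (hX : admissible q X) (hU : admissible q U) :
    admissible q (X.tens U) := by
  change ⨆ m : ℤ, wt (X.tens U) m = ⊤
  rw [← Submodule.ker_mkQ (⨆ m : ℤ, wt (X.tens U) m), LinearMap.ker_eq_top]
  refine ext_pt_wt hX hU fun m n x hx u hu => ?_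
  rw [LinearMap.zero_apply, Submodule.mkQ_apply, Submodule.Quotient.mk_eq_zero]
  exact Submodule.mem_iSup_of_mem (m + n) (wt_pt hx hu)

lemma admissible_unit : admissible q (StarRep.unit (Uq q)) := by
  refine eq_top_iff.2 fun z _ => Submodule.mem_iSup_of_mem 0 (mem_wt.2 ?_)
  refine (StarRep.ofChar_π (counitStar (Uq q)) _ _).trans ?_
  change Bialgebra.counitAlgHom ℂ (Uq q) (gen q .K) * _ = _
  rw [counit_gen, zpow_zero, one_smul]
  exact one_mul (M := ℂ) z

instance : (admissible q).IsMonoidal where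
  prop_unit := admissible_unit
  prop_tensor _ _ hX hU := admissible_tens hX hU

section nilpotent

/-- The representation has finitely many weights. -/
lemma finite_wt (X : StarRep (Uq q)) : {m : ℤ | wt X m ≠ ⊥}.Finite := by
  have h := (Module.End.eigenspaces_iSupIndep (op X .K)).comp
    (f := fun m : ℤ => qc q ^ m) fun m n h => qc_zpow_inj h
  exact WellFoundedGT.finite_ne_bot_of_iSupIndep h

/-- The finite set of weights of a representation. -/
def wts (X : StarRep (Uq q)) : Finset ℤ := (finite_wt X).toFinset

lemma mem_wts {X : StarRep (Uq q)} {m : ℤ} : m ∈ wts X ↔ wt X m ≠ ⊥ := by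
  rw [wts, Set.Finite.mem_toFinset]; rfl

lemma eq_zero_of_notMem {X : StarRep (Uq q)} {m : ℤ} (hm : m ∉ wts X) {x : X.carrier}
    (hx : x ∈ wt X m) : x = 0 := by
  rw [mem_wts, not_not] at hm
  rw [hm] at hx
  exact (Submodule.mem_bot ℂ).1 hx

lemma exists_bound (X : StarRep (Uq q)) : ∃ N : ℕ, ∀ m ∈ wts X, |m| ≤ N := by
  obtain ⟨b, hb⟩ := (wts X).finite_toSet.image (fun m : ℤ => m.natAbs) |>.bddAbove
  refine ⟨b, fun m hm => ?_⟩
  have := hb ⟨m, hm, rfl⟩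
  simp only at this
  rw [Int.abs_eq_natAbs]
  exact_mod_cast this

lemma nilpotent_E {X : StarRep (Uq q)} (hX : admissible q X) : IsNilpotent (op X .E) := by
  obtain ⟨N, hN⟩ := exists_bound X
  refine ⟨N + 1, ext_wt hX fun m x hx => ?_⟩
  by_cases h0 : m ∈ wts X
  · refine eq_zero_of_notMem (fun h => ?_) (wt_E_pow hx (N + 1))
    have h1 := hN _ h
    have h2 := hN _ h0
    rw [abs_le] at h1 h2
    push_cast at h1
    omega
  · rw [eq_zero_of_notMem h0 hx, map_zero, map_zero]

lemma nilpotent_F {X : StarRep (Uq q)} (hX : admissible q X) : IsNilpotent (op X .F) := by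
  obtain ⟨N, hN⟩ := exists_bound X
  refine ⟨N + 1, ext_wt hX fun m x hx => ?_⟩
  by_cases h0 : m ∈ wts X
  · refine eq_zero_of_notMem (fun h => ?_) (wt_F_pow hx (N + 1))
    have h1 := hN _ h
    have h2 := hN _ h0
    rw [abs_le] at h1 h2
    push_cast at h1
    omega
  · rw [eq_zero_of_notMem h0 hx, map_zero, map_zero]

lemma E_pow_eq_zero {X : StarRep (Uq q)} (hX : admissible q X) {k : ℕ}
    (hk : nilpotencyClass (op X .E) ≤ k) : op X .E ^ k = 0 :=
  pow_eq_zero_of_le hk (pow_nilpotencyClass (nilpotent_E hX))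

end nilpotent

section rmatrix

/-- The operator `q^{-H ⊗ H / 2}`, multiplying the vectors of weight `(m, n)` by `q^{-mn/2}`. -/
def cartan (X U : StarRep (Uq q)) : (X.tens U).carrier →ₗ[ℂ] (X.tens U).carrier :=
  ∑ m ∈ wts X, ∑ n ∈ wts U, qpow q (-((m : ℝ) * n) / 2) •
    tmap (wt X m).starProjection.toLinearMap (wt U n).starProjection.toLinearMap

/-- The operator `∑_k c_k E^k ⊗ F^k`. -/
def theta (X U : StarRep (Uq q)) : (X.tens U).carrier →ₗ[ℂ] (X.tens U).carrier :=
  ∑ k ∈ Finset.range (nilpotencyClass (op X .E)), rc q k •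
    tmap (op X .E ^ k) (op U .F ^ k)

/-- The action of the universal `R`-matrix `(∑_k c_k E^k ⊗ F^k) q^{-H ⊗ H / 2}`. -/
def rmat (X U : StarRep (Uq q)) : (X.tens U).carrier →ₗ[ℂ] (X.tens U).carrier :=
  theta X U ∘ₗ cartan X U

lemma symm_K (X : StarRep (Uq q)) : (op X .K).IsSymmetric := by
  have h : star (op X .K) = op X .K := by
    rw [← map_star, star_gen]; rfl
  exact LinearMap.isSymmetric_iff_isSelfAdjoint _ |>.2 h

lemma proj_wt {X : StarRep (Uq q)} {m m' : ℤ} {x : X.carrier} (hx : x ∈ wt X m) :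
    (wt X m').starProjection x = if m' = m then x else 0 := by
  split_ifs with h
  · subst h
    exact Submodule.starProjection_eq_self_iff.2 hx
  · rw [Submodule.starProjection_apply_eq_zero_iff, Submodule.mem_orthogonal]
    intro y hy
    exact (symm_K X).orthogonalFamily_eigenspaces (fun h' => h (qc_zpow_inj h')) ⟨y, hy⟩ ⟨x, hx⟩

lemma cartan_pt {X U : StarRep (Uq q)} {m n : ℤ} {x : X.carrier} {u : U.carrier}
    (hx : x ∈ wt X m) (hu : u ∈ wt U n) :
    cartan X U (pt x u) = qpow q (-((m : ℝ) * n) / 2) • pt x u := by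
  have h : cartan X U (pt x u) = ∑ m' ∈ wts X, ∑ n' ∈ wts U,
      qpow q (-((m' : ℝ) * n') / 2) •
        pt ((wt X m').starProjection x) ((wt U n').starProjection u) := by
    rw [cartan, LinearMap.sum_apply]
    refine Finset.sum_congr rfl fun m' _ => ?_
    rw [LinearMap.sum_apply]
    rfl
  rw [h]
  by_cases hm : m ∈ wts X
  · by_cases hn : n ∈ wts U
    · rw [Finset.sum_eq_single_of_mem m hm, Finset.sum_eq_single_of_mem n hn, proj_wt hx,
        proj_wt hu, if_pos rfl, if_pos rfl]
      · intro n' _ h'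
        rw [proj_wt hu, if_neg h', pt_zero_right, smul_zero]
      · intro m' _ h'
        refine Finset.sum_eq_zero fun n' _ => ?_
        rw [proj_wt hx, if_neg h', pt_zero_left, smul_zero]
    · have := eq_zero_of_notMem hn hu
      subst this
      simp only [map_zero, pt_zero_right, smul_zero, Finset.sum_const_zero]
  · have := eq_zero_of_notMem hm hx
    subst this
    simp only [map_zero, pt_zero_left, smul_zero, Finset.sum_const_zero]

lemma theta_pt {X U : StarRep (Uq q)} (hX : admissible q X) {N : ℕ}
    (hN : nilpotencyClass (op X .E) ≤ N) (x : X.carrier) (u : U.carrier) :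
    theta X U (pt x u) =
      ∑ k ∈ Finset.range N, rc q k • pt ((op X .E ^ k) x) ((op U .F ^ k) u) := by
  rw [theta, LinearMap.sum_apply]
  refine Finset.sum_subset (Finset.range_mono hN) fun k _ hk => ?_
  rw [E_pow_eq_zero hX (by simpa using hk), LinearMap.smul_apply, tmap_pt, LinearMap.zero_apply, pt_zero_left,
    smul_zero]

lemma rmat_pt {X U : StarRep (Uq q)} (hX : admissible q X) {N : ℕ}
    (hN : nilpotencyClass (op X .E) ≤ N) {m n : ℤ} {x : X.carrier} {u : U.carrier}
    (hx : x ∈ wt X m) (hu : u ∈ wt U n) :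
    rmat X U (pt x u) = qpow q (-((m : ℝ) * n) / 2) •
      ∑ k ∈ Finset.range N, rc q k • pt ((op X .E ^ k) x) ((op U .F ^ k) u) := by
  rw [rmat, LinearMap.comp_apply, cartan_pt hx hu, map_smul, theta_pt hX hN]

end rmatrix

section intertwine

variable {X U : StarRep (Uq q)}

lemma EF_comm {m : ℤ} {x : X.carrier} (hx : x ∈ wt X m) :
    op X .E (op X .F x) = op X .F (op X .E x) + qInt q m • x := by
  have h : X.π (gen q .E * gen q .F - gen q .F * gen q .E) x = qInt q m • x := by
    rw [gE_gF, map_smul, map_sub, LinearMap.smul_apply, LinearMap.sub_apply]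
    change (qc q - (qc q)⁻¹)⁻¹ • (op X .K x - op X .Ki x) = _
    rw [wt_K hx, wt_Ki hx, ← sub_smul, smul_smul, qInt, div_eq_inv_mul]
  rw [map_sub, LinearMap.sub_apply, ← op_op, ← op_op, sub_eq_iff_eq_add'] at h
  exact h

lemma qInt_succ_mul (k : ℕ) (n : ℤ) :
    qInt q k * qInt q (n - k + 1) + qInt q (n - 2 * k) = qInt q (k + 1) * qInt q (n - k) := by
  have h0 := qc_ne_zero q
  have h2 := qc_sub_ne (q := q)
  simp only [qInt, neg_add, neg_sub, mul_comm (2 : ℤ), mul_two, zpow_add₀ h0, zpow_sub₀ h0,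
    zpow_neg, zpow_one]
  have h3 := zpow_ne_zero n h0
  have h4 := zpow_ne_zero (k : ℤ) h0
  generalize qc q ^ n = a at *
  generalize qc q ^ (k : ℤ) = b at *
  generalize qc q = c at *
  field_simp
  ring

lemma qInt_one : qInt q 1 = 1 := by
  rw [qInt, zpow_one, zpow_neg_one, div_self qc_sub_ne]

lemma pow_succ_app {M : Type*} [AddCommGroup M] [Module ℂ M] (f : M →ₗ[ℂ] M) (k : ℕ) (x : M) :
    f ((f ^ k) x) = (f ^ (k + 1)) x := by rw [pow_succ']; rfl

lemma E_F_pow {n : ℤ} {u : U.carrier} (hu : u ∈ wt U n) (k : ℕ) :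
    op U .E ((op U .F ^ (k + 1)) u) = (op U .F ^ (k + 1)) (op U .E u)
      + (qInt q (k + 1) * qInt q (n - k)) • (op U .F ^ k) u := by
  induction k with
  | zero =>
    simp only [zero_add, pow_one, pow_zero, Nat.cast_zero, sub_zero]
    rw [EF_comm hu]
    congr 2
    rw [qInt_one, one_mul]
  | succ k ih =>
    rw [← pow_succ_app _ (k + 1), EF_comm (wt_F_pow hu (k + 1)), ih, map_add,
      map_smul, pow_succ_app, pow_succ_app, add_assoc, ← add_smul]
    congr 2
    have := qInt_succ_mul (q := q) (k + 1) n
    push_cast at this ⊢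
    rw [← this]
    congr 3
    ring

lemma E_pow_F {m : ℤ} {x : X.carrier} (hx : x ∈ wt X m) (k : ℕ) :
    (op X .E ^ (k + 1)) (op X .F x) = op X .F ((op X .E ^ (k + 1)) x)
      + (qInt q (k + 1) * qInt q (m + k)) • (op X .E ^ k) x := by
  induction k with
  | zero =>
    simp only [zero_add, pow_one, pow_zero, Nat.cast_zero, add_zero]
    rw [EF_comm hx]
    congr 2
    rw [qInt_one, one_mul]
  | succ k ih =>
    rw [← pow_succ_app _ (k + 1), ih, map_add, map_smul,
      EF_comm (wt_E_pow hx (k + 1)), pow_succ_app, pow_succ_app, add_assoc, ← add_smul]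
    congr 2
    have h0 := qc_ne_zero q
    have h2 := qc_sub_ne (q := q)
    simp only [qInt, neg_add, Nat.cast_add, Nat.cast_one, mul_add, mul_one, two_mul,
      zpow_add₀ h0, zpow_neg, zpow_one]
    have h3 := zpow_ne_zero m h0
    have h4 := zpow_ne_zero (k : ℤ) h0
    generalize qc q ^ m = a at *
    generalize qc q ^ (k : ℤ) = b at *
    generalize qc q = c at *
    field_simp
    ring

lemma rc_succ_mul (k : ℕ) (n : ℤ) :
    rc q (k + 1) * (qInt q (k + 1) * qInt q (n - k))
      = rc q k * (qc q ^ (-n) - qc q ^ (n - 2 * k)) := by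
  have h : rc q (k + 1) = rc q k * (((qc q)⁻¹ - qc q) * qc q ^ (-(k : ℤ)) / qInt q (k + 1)) :=
    Finset.prod_range_succ _ _
  have h1 := qInt_ne_zero (q := q) (m := (k : ℤ) + 1) (by omega)
  rw [h, mul_assoc]
  congr 1
  rw [← mul_assoc, div_mul_cancel₀ _ h1]
  have h0 := qc_ne_zero q
  have h2 := qc_sub_ne (q := q)
  simp only [qInt, neg_sub, zpow_sub₀ h0, zpow_neg, two_mul, zpow_add₀ h0]
  have h3 := zpow_ne_zero n h0
  have h4 := zpow_ne_zero (k : ℤ) h0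
  rw [← mul_div_assoc, div_eq_iff h2]
  generalize qc q ^ n = a at *
  generalize qc q ^ (k : ℤ) = b at *
  generalize qc q = c at *
  field_simp
  ring

/-- The flip of the tensor factors. -/
def flip (X U : StarRep (Uq q)) : (X.tens U).carrier ≃ₗ[ℂ] (U.tens X).carrier :=
  TensorProduct.comm ℂ X.carrier U.carrier

lemma flip_pt (x : X.carrier) (u : U.carrier) : flip X U (pt x u) = pt u x := rfl

/-- The linear map `Σ R`. -/
def braidLin (X U : StarRep (Uq q)) : (X.tens U).carrier →ₗ[ℂ] (U.tens X).carrier :=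
  (flip X U).toLinearMap ∘ₗ rmat X U

lemma braidLin_pt (hX : admissible q X) {N : ℕ}
    (hN : nilpotencyClass (op X .E) ≤ N) {m n : ℤ} {x : X.carrier} {u : U.carrier}
    (hx : x ∈ wt X m) (hu : u ∈ wt U n) :
    braidLin X U (pt x u) = qpow q (-((m : ℝ) * n) / 2) •
      ∑ k ∈ Finset.range N, rc q k • pt ((op U .F ^ k) u) ((op X .E ^ k) x) := by
  rw [braidLin, LinearMap.comp_apply, rmat_pt hX hN hx hu, map_smul, map_sum]
  congr 1
  refine Finset.sum_congr rfl fun k _ => ?_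
  rw [map_smul]
  rfl

lemma qpow_shift {s s' : ℝ} (m : ℤ) (h : s' = s + m) : qpow q s' = qpow q s * qc q ^ m := by
  rw [h, qpow_add, qpow_int]

lemma braid_K (hX : admissible q X) (hU : admissible q U) :
    braidLin X U ∘ₗ op (X.tens U) .K = op (U.tens X) .K ∘ₗ braidLin X U := by
  refine ext_pt_wt hX hU fun m n x hx u hu => ?_
  rw [LinearMap.comp_apply, LinearMap.comp_apply, tens_K, wt_K hx, wt_K hu, pt_smul_left,
    pt_smul_right, map_smul, map_smul, braidLin_pt hX le_rfl hx hu, map_smul, smul_smul,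
    smul_comm, map_sum, Finset.smul_sum]
  congr 1
  refine Finset.sum_congr rfl fun k _ => ?_
  rw [map_smul, tens_K, wt_K (wt_F_pow hu k), wt_K (wt_E_pow hx k), pt_smul_left, pt_smul_right,
    smul_comm]
  congr 1
  rw [smul_smul, ← zpow_add₀ (qc_ne_zero q), ← zpow_add₀ (qc_ne_zero q)]
  congr 2
  ring

lemma braid_E (hX : admissible q X) (hU : admissible q U) :
    braidLin X U ∘ₗ op (X.tens U) .E = op (U.tens X) .E ∘ₗ braidLin X U := by
  refine ext_pt_wt hX hU fun m n x hx u hu => ?_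
  set N := nilpotencyClass (op X .E) with hN
  have hN0 : op X .E ^ (N + 1) = 0 := E_pow_eq_zero hX (by omega)
  rw [LinearMap.comp_apply, LinearMap.comp_apply, tens_E, wt_K hx, pt_smul_left, map_add,
    map_smul, braidLin_pt hX (hN ▸ Nat.le_succ N) hx hu,
    braidLin_pt hX (hN ▸ Nat.le_succ N) (wt_E hx) hu,
    braidLin_pt hX (hN ▸ Nat.le_succ N) hx (wt_E hu), map_smul,
    qpow_shift (s := -((m : ℝ) * n) / 2) (-n) (by push_cast; ring), smul_smul,
    qpow_shift (s := -((m : ℝ) * n) / 2) (s' := -((m : ℝ) * (n + 2 : ℤ)) / 2) (-m)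
      (by push_cast; ring),
    mul_left_comm, ← zpow_add₀ (qc_ne_zero q), add_neg_cancel, zpow_zero, mul_one, mul_smul,
    ← smul_add, map_sum]
  congr 1
  simp only [← Module.End.mul_apply, ← pow_succ]
  have h1 : ∀ k, op (U.tens X) .E (rc q k • pt ((op U .F ^ k) u) ((op X .E ^ k) x)) =
      rc q k • pt (op U .E ((op U .F ^ k) u)) ((op X .E ^ k) x) +
      (rc q k * qc q ^ (n - 2 * k)) • pt ((op U .F ^ k) u) ((op X .E ^ (k + 1)) x) := fun k => by
    rw [map_smul, tens_E, wt_K (wt_F_pow hu k), pt_smul_left, smul_add, smul_smul, pow_succ' _ k]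
    rfl
  simp only [h1, Finset.sum_add_distrib]
  rw [Finset.sum_range_succ' (fun k => rc q k • pt (op U .E ((op U .F ^ k) u)) _)]
  simp only [E_F_pow hu, pt_add_left, pt_smul_left, smul_add, Finset.sum_add_distrib]
  rw [Finset.sum_range_succ' (fun k => rc q k • pt ((op U .F ^ k * op U .E) u) _)]
  rw [Finset.sum_range_succ
    (fun k => (rc q k * qc q ^ (n - 2 * (k : ℤ))) • pt ((op U .F ^ k) u) _),
    Finset.sum_range_succ (fun k => rc q k • pt ((op U .F ^ k) u) ((op X .E ^ (k + 1)) x))]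
  rw [hN0, LinearMap.zero_apply, pt_zero_right, smul_zero, smul_zero, add_zero, add_zero]
  rw [add_comm]
  have h2 : ∑ k ∈ Finset.range N, rc q (k + 1) • (qInt q (k + 1) * qInt q (n - k)) •
      pt ((op U .F ^ k) u) ((op X .E ^ (k + 1)) x) +
      ∑ k ∈ Finset.range N, (rc q k * qc q ^ (n - 2 * (k : ℤ))) •
        pt ((op U .F ^ k) u) ((op X .E ^ (k + 1)) x) =
      qc q ^ (-n) • ∑ k ∈ Finset.range N, rc q k •
        pt ((op U .F ^ k) u) ((op X .E ^ (k + 1)) x) := by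
    rw [← Finset.sum_add_distrib, Finset.smul_sum]
    refine Finset.sum_congr rfl fun k _ => ?_
    rw [smul_smul, smul_smul, rc_succ_mul, ← add_smul]
    congr 1
    ring
  rw [← h2]
  simp only [pow_zero, one_mul, Module.End.one_apply]
  have h3 : ∀ k, (op U .F ^ (k + 1) * op U .E) u = (op U .F ^ (k + 1)) (op U .E u) :=
    fun k => rfl
  simp only [h3]
  abel

lemma braid_F (hX : admissible q X) (hU : admissible q U) :
    braidLin X U ∘ₗ op (X.tens U) .F = op (U.tens X) .F ∘ₗ braidLin X U := by
  refine ext_pt_wt hX hU fun m n x hx u hu => ?_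
  set N := nilpotencyClass (op X .E) with hN
  have hN0 : op X .E ^ N = 0 := E_pow_eq_zero hX le_rfl
  rw [LinearMap.comp_apply, LinearMap.comp_apply, tens_F, wt_Ki hu, pt_smul_right, map_add,
    map_smul, braidLin_pt hX (hN ▸ Nat.le_succ N) hx hu,
    braidLin_pt hX (hN ▸ Nat.le_succ N) (wt_F hx) hu,
    braidLin_pt hX (hN ▸ Nat.le_succ N) hx (wt_F hu), map_smul,
    qpow_shift (s := -((m : ℝ) * n) / 2) n (by push_cast; ring), smul_smul,
    qpow_shift (s := -((m : ℝ) * n) / 2) (s' := -((m : ℝ) * (n - 2 : ℤ)) / 2) m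
      (by push_cast; ring),
    mul_left_comm, ← zpow_add₀ (qc_ne_zero q), neg_add_cancel, zpow_zero, mul_one, mul_smul,
    ← smul_add, map_sum]
  congr 1
  simp only [← Module.End.mul_apply, ← pow_succ]
  have h1 : ∀ k, op (U.tens X) .F (rc q k • pt ((op U .F ^ k) u) ((op X .E ^ k) x)) =
      (rc q k * qc q ^ (-(m + 2 * (k : ℤ)))) • pt ((op U .F ^ (k + 1)) u) ((op X .E ^ k) x) +
      rc q k • pt ((op U .F ^ k) u) (op X .F ((op X .E ^ k) x)) := fun k => by
    rw [map_smul, tens_F, wt_Ki (wt_E_pow hx k), pt_smul_right, smul_add, smul_smul,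
      pow_succ' _ k]
    rfl
  simp only [h1, Finset.sum_add_distrib]
  rw [Finset.sum_range_succ' (fun k => rc q k • pt _ ((op X .E ^ k * op X .F) x))]
  have h3 : ∀ k, (op X .E ^ (k + 1) * op X .F) x = (op X .E ^ (k + 1)) (op X .F x) :=
    fun k => rfl
  simp only [h3, E_pow_F hx, pt_add_right, pt_smul_right, smul_add, Finset.sum_add_distrib]
  rw [Finset.sum_range_succ' (fun k => rc q k • pt ((op U .F ^ k) u) (op X .F _))]
  rw [Finset.sum_range_succ
    (fun k => (rc q k * qc q ^ (-(m + 2 * (k : ℤ)))) • pt ((op U .F ^ (k + 1)) u) _),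
    Finset.sum_range_succ (fun k => rc q k • pt ((op U .F ^ (k + 1)) u) ((op X .E ^ k) x))]
  rw [hN0, LinearMap.zero_apply, pt_zero_right, smul_zero, smul_zero, add_zero, add_zero]
  have h2 : ∑ k ∈ Finset.range N, (rc q k * qc q ^ (-(m + 2 * (k : ℤ)))) •
        pt ((op U .F ^ (k + 1)) u) ((op X .E ^ k) x) =
      ∑ k ∈ Finset.range N, rc q (k + 1) • (qInt q (k + 1) * qInt q (m + k)) •
        pt ((op U .F ^ (k + 1)) u) ((op X .E ^ k) x) +
      qc q ^ m • ∑ k ∈ Finset.range N, rc q k •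
        pt ((op U .F ^ (k + 1)) u) ((op X .E ^ k) x) := by
    rw [Finset.smul_sum, ← Finset.sum_add_distrib]
    refine Finset.sum_congr rfl fun k _ => ?_
    have h4 := rc_succ_mul (q := q) k (m + 2 * k)
    rw [show m + 2 * (k : ℤ) - k = m + k by ring, show m + 2 * (k : ℤ) - 2 * k = m by ring] at h4
    rw [smul_smul, smul_smul, h4, ← add_smul]
    congr 1
    ring
  rw [h2]
  simp only [pow_zero, one_mul, Module.End.one_apply]
  abel

lemma braid_Ki (hX : admissible q X) (hU : admissible q U) :
    braidLin X U ∘ₗ op (X.tens U) .Ki = op (U.tens X) .Ki ∘ₗ braidLin X U := by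
  have h1 : ∀ Y : StarRep (Uq q), op Y .K ∘ₗ op Y .Ki = LinearMap.id := fun Y => by
    ext y; exact (op_op Y .K .Ki y).trans (by rw [gK_gKi, map_one]; rfl)
  have h2 : ∀ Y : StarRep (Uq q), op Y .Ki ∘ₗ op Y .K = LinearMap.id := fun Y => by
    ext y; exact (op_op Y .Ki .K y).trans (by rw [gKi_gK, map_one]; rfl)
  calc braidLin X U ∘ₗ op (X.tens U) .Ki
      = (op (U.tens X) .Ki ∘ₗ op (U.tens X) .K) ∘ₗ braidLin X U ∘ₗ op (X.tens U) .Ki := by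
        rw [h2, LinearMap.id_comp]
    _ = op (U.tens X) .Ki ∘ₗ (op (U.tens X) .K ∘ₗ braidLin X U) ∘ₗ op (X.tens U) .Ki := rfl
    _ = op (U.tens X) .Ki ∘ₗ (braidLin X U ∘ₗ (op (X.tens U) .K ∘ₗ op (X.tens U) .Ki)) := by
        rw [← braid_K hX hU]; rfl
    _ = _ := by rw [h1, LinearMap.comp_id]

/-- A linear map that commutes with the generators is an intertwiner. -/
lemma comm_of_gen {Y Z : StarRep (Uq q)} {f : Y.carrier →ₗ[ℂ] Z.carrier}
    (h : ∀ g, f ∘ₗ op Y g = op Z g ∘ₗ f) (a : Uq q) : f ∘ₗ Y.π a = Z.π a ∘ₗ f := by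
  obtain ⟨b, rfl⟩ : ∃ b, mk q b = a := RingQuot.mkAlgHom_surjective ℂ (Rel q) a
  induction b using FreeAlgebra.induction with
  | grade0 c =>
    rw [AlgHom.commutes, AlgHomClass.commutes, AlgHomClass.commutes]
    ext y
    exact f.map_smul c y
  | grade1 g => exact h g
  | add a b ha hb => rw [map_add, map_add, map_add, LinearMap.comp_add, ha, hb,
      LinearMap.add_comp]
  | mul a b ha hb =>
    rw [map_mul, map_mul, map_mul]
    change (f ∘ₗ Y.π (mk q a)) ∘ₗ Y.π (mk q b) = _
    rw [ha, LinearMap.comp_assoc, hb]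
    rfl

lemma braid_comm (hX : admissible q X) (hU : admissible q U) (a : Uq q) :
    braidLin X U ∘ₗ (X.tens U).π a = (U.tens X).π a ∘ₗ braidLin X U :=
  comm_of_gen (fun g => by
    cases g
    · exact braid_E hX hU
    · exact braid_F hX hU
    · exact braid_K hX hU
    · exact braid_Ki hX hU) a

end intertwine

section invertible

variable {X U : StarRep (Uq q)}

lemma isUnit_one_add_sum {A : Type*} [Ring A] [Algebra ℂ A] {n : A} (hn : IsNilpotent n)
    (c : ℕ → ℂ) (N : ℕ) : IsUnit (1 + ∑ k ∈ Finset.range N, c k • n ^ (k + 1)) := by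
  refine IsNilpotent.isUnit_one_add ?_
  have h : ∑ k ∈ Finset.range N, c k • n ^ (k + 1) = n * ∑ k ∈ Finset.range N, c k • n ^ k := by
    rw [Finset.mul_sum]
    exact Finset.sum_congr rfl fun k _ => by rw [pow_succ', mul_smul_comm]
  rw [h]
  refine Commute.isNilpotent_mul_right ?_ hn
  exact Commute.sum_right _ _ _ fun k _ => ((Commute.refl n).pow_right k).smul_right _

lemma tmap_pow (f : X.carrier →ₗ[ℂ] X.carrier) (g : U.carrier →ₗ[ℂ] U.carrier) (k : ℕ) :
    (tmap f g : (X.tens U).carrier →ₗ[ℂ] (X.tens U).carrier) ^ k = tmap (f ^ k) (g ^ k) := by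
  induction k with
  | zero => exact ext_pt fun x u => rfl
  | succ k ih =>
    rw [pow_succ', ih, pow_succ', pow_succ']
    exact ext_pt fun x u => rfl

lemma isUnit_theta (hX : admissible q X) : IsUnit (theta X U) := by
  have h : theta X U = 1 + ∑ k ∈ Finset.range (nilpotencyClass (op X .E)),
      rc q (k + 1) • (tmap (op X .E) (op U .F) :
        (X.tens U).carrier →ₗ[ℂ] (X.tens U).carrier) ^ (k + 1) := by
    refine ext_pt fun x u => ?_
    rw [theta_pt hX (Nat.le_succ _), Finset.sum_range_succ', LinearMap.add_apply,
      LinearMap.sum_apply, add_comm]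
    congr 1
    · exact one_smul ℂ _
    · refine Finset.sum_congr rfl fun k _ => ?_
      rw [tmap_pow]
      rfl
  rw [h]
  refine isUnit_one_add_sum ?_ _ _
  obtain ⟨N, hN⟩ := nilpotent_E hX
  refine ⟨N, ?_⟩
  rw [tmap_pow, hN]
  exact ext_pt fun x u => pt_zero_left _

lemma bijective_cartan (hX : admissible q X) (hU : admissible q U) :
    Function.Bijective (cartan X U) := by
  rw [Function.Bijective, LinearMap.injective_iff_surjective, and_self, ← LinearMap.range_eq_top,
    ← Submodule.ker_mkQ (LinearMap.range _), LinearMap.ker_eq_top]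
  refine ext_pt_wt hX hU fun m n x hx u hu => ?_
  rw [LinearMap.zero_apply, Submodule.mkQ_apply, Submodule.Quotient.mk_eq_zero]
  refine ⟨qpow q (((m : ℝ) * n) / 2) • pt x u, ?_⟩
  rw [map_smul, cartan_pt hx hu, smul_smul, ← qpow_add]
  rw [show (m : ℝ) * n / 2 + -(m * n) / 2 = 0 by ring, qpow_zero, one_smul]

lemma bijective_braid (hX : admissible q X) (hU : admissible q U) :
    Function.Bijective (braidLin X U) := by
  rw [braidLin, rmat, LinearMap.coe_comp, LinearMap.coe_comp]
  exact (flip X U).bijective.comp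
    (((Module.End.isUnit_iff _).1 (isUnit_theta hX)).comp (bijective_cartan hX hU))

end invertible

section hexagon

variable {X Y Z : StarRep (Uq q)}

lemma wt_hom (f : X ⟶ Y) {m : ℤ} {x : X.carrier} (hx : x ∈ wt X m) : f.lin x ∈ wt Y m := by
  rw [mem_wt] at hx ⊢
  rw [← StarRep.comm_apply, hx, map_smul]

lemma hom_op_pow (f : X ⟶ Y) (g : Gen) (k : ℕ) (x : X.carrier) :
    f.lin ((op X g ^ k) x) = (op Y g ^ k) (f.lin x) := by
  induction k with
  | zero => rfl
  | succ k ih => rw [← pow_succ_app, ← pow_succ_app, StarRep.comm_apply, ih]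

lemma braid_natural {X' Y' : StarRep (Uq q)} (hX : admissible q X) (hY : admissible q Y)
    (hX' : admissible q X') (f : X ⟶ X') (g : Y ⟶ Y') :
    braidLin X' Y' ∘ₗ tmap f.lin g.lin = tmap g.lin f.lin ∘ₗ braidLin X Y := by
  refine ext_pt_wt hX hY fun m n x hx y hy => ?_
  rw [LinearMap.comp_apply, LinearMap.comp_apply, tmap_pt,
    braidLin_pt hX' (le_max_right _ _) (wt_hom f hx) (wt_hom g hy),
    braidLin_pt hX (le_max_left _ _) hx hy, map_smul, map_sum]
  congr 1
  refine Finset.sum_congr rfl fun k _ => ?_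
  rw [map_smul, tmap_pt, hom_op_pow, hom_op_pow]

/-- Divided powers. -/
def dpow (X : StarRep (Uq q)) (g : Gen) (k : ℕ) : X.carrier →ₗ[ℂ] X.carrier :=
  rc q k • op X g ^ k

lemma op_dpow (g : Gen) (k : ℕ) (x : X.carrier) :
    op X g (dpow X g k x) = rg q (k + 1) • dpow X g (k + 1) x := by
  rw [dpow, dpow, LinearMap.smul_apply, map_smul, pow_succ_app, LinearMap.smul_apply, smul_smul,
    rg_rc]

lemma rg_ne_zero (k : ℕ) : rg q (k + 1) ≠ 0 := by
  intro h
  have := rg_rc (q := q) k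
  rw [h, zero_mul] at this
  refine Finset.prod_ne_zero_iff.2 (fun j _ => ?_) this.symm
  exact div_ne_zero (mul_ne_zero qc_sub_ne' (zpow_ne_zero _ (qc_ne_zero q)))
    (qInt_ne_zero (by omega))

lemma wt_dpow_E {m : ℤ} {x : X.carrier} (hx : x ∈ wt X m) (k : ℕ) :
    dpow X .E k x ∈ wt X (m + 2 * k) := Submodule.smul_mem _ _ (wt_E_pow hx k)

lemma wt_dpow_F {m : ℤ} {x : X.carrier} (hx : x ∈ wt X m) (k : ℕ) :
    dpow X .F k x ∈ wt X (m - 2 * k) := Submodule.smul_mem _ _ (wt_F_pow hx k)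

lemma dpow_F_tens {p : ℤ} (y : Y.carrier) {z : Z.carrier} (hz : z ∈ wt Z p) (k : ℕ) :
    dpow (Y.tens Z) .F k (pt y z) = ∑ a ∈ Finset.HasAntidiagonal.antidiagonal k,
      qc q ^ (-(a.1 * p : ℤ)) • pt (dpow Y .F a.1 y) (dpow Z .F a.2 z) := by
  induction k with
  | zero =>
    simp [dpow, rc_zero]
  | succ k ih =>
    refine smul_right_injective _ (rg_ne_zero (q := q) k) ?_
    simp only
    rw [← op_dpow, ih, map_sum, Finset.smul_sum]
    have h1 : ∀ a : ℕ × ℕ, op (Y.tens Z) .F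
        (qc q ^ (-(a.1 * p : ℤ)) • pt (dpow Y .F a.1 y) (dpow Z .F a.2 z)) =
        (qc q ^ (2 * (a.2 : ℤ)) * rg q (a.1 + 1)) •
          qc q ^ (-((a.1 + 1 : ℕ) * p : ℤ)) • pt (dpow Y .F (a.1 + 1) y) (dpow Z .F a.2 z) +
        rg q (a.2 + 1) •
          qc q ^ (-(a.1 * p : ℤ)) • pt (dpow Y .F a.1 y) (dpow Z .F (a.2 + 1) z) := fun a => by
      rw [map_smul, tens_F, wt_Ki (wt_dpow_F hz a.2), op_dpow, op_dpow, pt_smul_right,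
        pt_smul_left, pt_smul_right, smul_add, smul_smul, smul_smul, smul_smul, smul_smul,
        smul_smul]
      congr 2
      · rw [← zpow_add₀ (qc_ne_zero q), mul_right_comm, ← zpow_add₀ (qc_ne_zero q)]
        congr 2
        push_cast
        ring
      · rw [mul_comm]
    have h2 : ∀ a ∈ Finset.HasAntidiagonal.antidiagonal (k + 1), rg q (k + 1) • qc q ^ (-(a.1 * p : ℤ)) •
        pt (dpow Y .F a.1 y) (dpow Z .F a.2 z) =
        (qc q ^ (2 * (a.2 : ℤ)) * rg q a.1) •
          qc q ^ (-(a.1 * p : ℤ)) • pt (dpow Y .F a.1 y) (dpow Z .F a.2 z) +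
        rg q a.2 •
          qc q ^ (-(a.1 * p : ℤ)) • pt (dpow Y .F a.1 y) (dpow Z .F a.2 z) := fun a ha => by
      rw [← add_smul, ← rg_add', Finset.HasAntidiagonal.mem_antidiagonal.1 ha]
    rw [Finset.sum_congr rfl h2, Finset.sum_congr rfl fun a _ => h1 a, Finset.sum_add_distrib,
      Finset.sum_add_distrib]
    congr 1
    · rw [Finset.Nat.sum_antidiagonal_succ, rg_zero, mul_zero, zero_smul, zero_add]
    · rw [Finset.Nat.sum_antidiagonal_succ', rg_zero, zero_smul, zero_add]

lemma dpow_E_tens {m : ℤ} {x : X.carrier} (hx : x ∈ wt X m) (y : Y.carrier) (k : ℕ) :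
    dpow (X.tens Y) .E k (pt x y) = ∑ a ∈ Finset.HasAntidiagonal.antidiagonal k,
      qc q ^ (m * a.2 : ℤ) • pt (dpow X .E a.1 x) (dpow Y .E a.2 y) := by
  induction k with
  | zero =>
    simp [dpow, rc_zero]
  | succ k ih =>
    refine smul_right_injective _ (rg_ne_zero (q := q) k) ?_
    simp only
    rw [← op_dpow, ih, map_sum, Finset.smul_sum]
    have h1 : ∀ a : ℕ × ℕ, op (X.tens Y) .E
        (qc q ^ (m * a.2 : ℤ) • pt (dpow X .E a.1 x) (dpow Y .E a.2 y)) =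
        rg q (a.1 + 1) •
          qc q ^ (m * a.2 : ℤ) • pt (dpow X .E (a.1 + 1) x) (dpow Y .E a.2 y) +
        (qc q ^ (2 * (a.1 : ℤ)) * rg q (a.2 + 1)) •
          qc q ^ (m * (a.2 + 1 : ℕ) : ℤ) • pt (dpow X .E a.1 x) (dpow Y .E (a.2 + 1) y) :=
        fun a => by
      rw [map_smul, tens_E, wt_K (wt_dpow_E hx a.1), op_dpow, op_dpow, pt_smul_right,
        pt_smul_left, pt_smul_left, smul_add, smul_smul, smul_smul, smul_smul, smul_smul,
        smul_smul]
      congr 2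
      · rw [mul_comm]
      · rw [mul_right_comm, ← zpow_add₀ (qc_ne_zero q), mul_right_comm,
          ← zpow_add₀ (qc_ne_zero q)]
        congr 2
        push_cast
        ring
    have h2 : ∀ a ∈ Finset.HasAntidiagonal.antidiagonal (k + 1), rg q (k + 1) • qc q ^ (m * a.2 : ℤ) •
        pt (dpow X .E a.1 x) (dpow Y .E a.2 y) =
        rg q a.1 •
          qc q ^ (m * a.2 : ℤ) • pt (dpow X .E a.1 x) (dpow Y .E a.2 y) +
        (qc q ^ (2 * (a.1 : ℤ)) * rg q a.2) •
          qc q ^ (m * a.2 : ℤ) • pt (dpow X .E a.1 x) (dpow Y .E a.2 y) := fun a ha => by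
      rw [← add_smul, ← rg_add, Finset.HasAntidiagonal.mem_antidiagonal.1 ha]
    rw [Finset.sum_congr rfl h2, Finset.sum_congr rfl fun a _ => h1 a, Finset.sum_add_distrib,
      Finset.sum_add_distrib]
    congr 1
    · rw [Finset.Nat.sum_antidiagonal_succ, rg_zero, zero_smul, zero_add]
    · rw [Finset.Nat.sum_antidiagonal_succ', rg_zero, mul_zero, zero_smul, zero_add]

lemma sum_antidiagonal_range {M : Type*} [AddCommMonoid M] (N : ℕ) (G : ℕ → ℕ → M)
    (hG : ∀ i j, N ≤ i + j → G i j = 0) :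
    ∑ k ∈ Finset.range N, ∑ a ∈ Finset.HasAntidiagonal.antidiagonal k, G a.1 a.2 =
      ∑ i ∈ Finset.range N, ∑ j ∈ Finset.range N, G i j := by
  rw [← Finset.sum_product' (f := G),
    ← Finset.sum_filter_of_ne (p := fun a : ℕ × ℕ => a.1 + a.2 < N)
      (fun a _ ha => by by_contra h; exact ha (hG _ _ (by omega))),
    ← Finset.sum_fiberwise_of_maps_to (t := Finset.range N) (g := fun a : ℕ × ℕ => a.1 + a.2)
      (fun a ha => Finset.mem_range.2 (Finset.mem_filter.1 ha).2)]
  refine Finset.sum_congr rfl fun k hk => Finset.sum_congr ?_ fun _ _ => rfl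
  ext a
  simp only [Finset.HasAntidiagonal.mem_antidiagonal, Finset.mem_filter, Finset.mem_product, Finset.mem_range]
    at hk ⊢
  omega

lemma braidLin_pt_F {U : StarRep (Uq q)} (hX : admissible q X) {N : ℕ}
    (hN : nilpotencyClass (op X .E) ≤ N) {m n : ℤ} {x : X.carrier} {u : U.carrier}
    (hx : x ∈ wt X m) (hu : u ∈ wt U n) :
    braidLin X U (pt x u) = qpow q (-((m : ℝ) * n) / 2) •
      ∑ k ∈ Finset.range N, pt (dpow U .F k u) ((op X .E ^ k) x) := by
  rw [braidLin_pt hX hN hx hu]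
  simp only [dpow, LinearMap.smul_apply, pt_smul_left]

lemma braidLin_pt_E {U : StarRep (Uq q)} (hX : admissible q X) {N : ℕ}
    (hN : nilpotencyClass (op X .E) ≤ N) {m n : ℤ} {x : X.carrier} {u : U.carrier}
    (hx : x ∈ wt X m) (hu : u ∈ wt U n) :
    braidLin X U (pt x u) = qpow q (-((m : ℝ) * n) / 2) •
      ∑ k ∈ Finset.range N, pt ((op U .F ^ k) u) (dpow X .E k x) := by
  rw [braidLin_pt hX hN hx hu]
  simp only [dpow, LinearMap.smul_apply, pt_smul_right]

/-- The associator of the underlying vector spaces. -/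
def assocL (X Y Z : StarRep (Uq q)) :
    ((X.tens Y).tens Z).carrier ≃ₗ[ℂ] (X.tens (Y.tens Z)).carrier := StarRep.boxAssoc X Y Z

lemma assocL_pt (x : X.carrier) (y : Y.carrier) (z : Z.carrier) :
    assocL X Y Z (pt (pt x y) z) = pt x (pt y z) := rfl

lemma assocL_symm_pt (x : X.carrier) (y : Y.carrier) (z : Z.carrier) :
    (assocL X Y Z).symm (pt x (pt y z)) = pt (pt x y) z := rfl

lemma ext_pt_wt₃ (hX : admissible q X) (hY : admissible q Y) (hZ : admissible q Z) {M : Type*}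
    [AddCommGroup M] [Module ℂ M] {f g : ((X.tens Y).tens Z).carrier →ₗ[ℂ] M}
    (h : ∀ m n p, ∀ x ∈ wt X m, ∀ y ∈ wt Y n, ∀ z ∈ wt Z p,
      f (pt (pt x y) z) = g (pt (pt x y) z)) : f = g := by
  refine ext_pt fun w z => ?_
  have h1 : ∀ w, f ∘ₗ ptL (X.tens Y) Z w = g ∘ₗ ptL (X.tens Y) Z w := fun w =>
    ext_wt hZ fun p z hz => by
      have h2 : f ∘ₗ (ptL (X.tens Y) Z).flip z = g ∘ₗ (ptL (X.tens Y) Z).flip z :=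
        ext_pt_wt hX hY fun m n x hx y hy => h m n p x hx y hy z hz
      exact LinearMap.congr_fun h2 w
  exact LinearMap.congr_fun (h1 w) z

lemma ext_pt_wt₃' (hX : admissible q X) (hY : admissible q Y) (hZ : admissible q Z) {M : Type*}
    [AddCommGroup M] [Module ℂ M] {f g : (X.tens (Y.tens Z)).carrier →ₗ[ℂ] M}
    (h : ∀ m n p, ∀ x ∈ wt X m, ∀ y ∈ wt Y n, ∀ z ∈ wt Z p,
      f (pt x (pt y z)) = g (pt x (pt y z))) : f = g := by
  have h1 : f ∘ₗ (assocL X Y Z).toLinearMap = g ∘ₗ (assocL X Y Z).toLinearMap :=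
    ext_pt_wt₃ hX hY hZ h
  ext w
  obtain ⟨v, rfl⟩ := (assocL X Y Z).surjective w
  exact LinearMap.congr_fun h1 v

lemma hexagon_forward (hX : admissible q X) (hY : admissible q Y) (hZ : admissible q Z) :
    (assocL Y Z X).toLinearMap ∘ₗ braidLin X (Y.tens Z) ∘ₗ (assocL X Y Z).toLinearMap =
      tmap LinearMap.id (braidLin X Z) ∘ₗ (assocL Y X Z).toLinearMap ∘ₗ
        tmap (braidLin X Y) LinearMap.id := by
  refine ext_pt_wt₃ hX hY hZ fun m n p x hx y hy z hz => ?_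
  set N := nilpotencyClass (op X .E) with hN
  have hl : ((assocL Y Z X).toLinearMap ∘ₗ braidLin X (Y.tens Z) ∘ₗ
      (assocL X Y Z).toLinearMap) (pt (pt x y) z) =
      qpow q (-((m : ℝ) * (n + p : ℤ)) / 2) • ∑ k ∈ Finset.range N,
        ∑ a ∈ Finset.HasAntidiagonal.antidiagonal k, qc q ^ (-(a.1 * p : ℤ)) •
          pt (dpow Y .F a.1 y) (pt (dpow Z .F a.2 z) ((op X .E ^ (a.1 + a.2)) x)) := by
    change assocL Y Z X (braidLin X (Y.tens Z) (pt x (pt y z))) = _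
    rw [braidLin_pt_F hX hN.ge hx (wt_pt hy hz), map_smul, map_sum]
    congr 1
    refine Finset.sum_congr rfl fun k _ => ?_
    rw [dpow_F_tens y hz, pt_sum_left, map_sum]
    refine Finset.sum_congr rfl fun a ha => ?_
    rw [pt_smul_left, map_smul, assocL_pt, Finset.HasAntidiagonal.mem_antidiagonal.1 ha]
  have hr : (tmap LinearMap.id (braidLin X Z) ∘ₗ (assocL Y X Z).toLinearMap ∘ₗ
        tmap (braidLin X Y) LinearMap.id) (pt (pt x y) z) =
      qpow q (-((m : ℝ) * n) / 2) • ∑ i ∈ Finset.range N,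
        qpow q (-(((m + 2 * i : ℤ) : ℝ) * p) / 2) • ∑ j ∈ Finset.range N,
          pt (dpow Y .F i y) (pt (dpow Z .F j z) ((op X .E ^ (i + j)) x)) := by
    change tmap LinearMap.id (braidLin X Z) (assocL Y X Z (pt (braidLin X Y (pt x y)) z)) = _
    rw [braidLin_pt_F hX hN.ge hx hy, pt_smul_left, map_smul, map_smul, pt_sum_left, map_sum,
      map_sum]
    congr 1
    refine Finset.sum_congr rfl fun i _ => ?_
    rw [assocL_pt, tmap_pt, braidLin_pt_F hX hN.ge (wt_E_pow hx i) hz, pt_smul_right,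
      pt_sum_right]
    congr 1
    refine Finset.sum_congr rfl fun j _ => ?_
    rw [add_comm i j, pow_add]
    rfl
  rw [hl, hr, sum_antidiagonal_range N (fun i j => qc q ^ (-(i * p : ℤ)) •
      pt (dpow Y .F i y) (pt (dpow Z .F j z) ((op X .E ^ (i + j)) x)))
    (fun i j h => by
      rw [E_pow_eq_zero hX (hN ▸ h), LinearMap.zero_apply, pt_zero_right, pt_zero_right,
        smul_zero]), Finset.smul_sum, Finset.smul_sum]
  refine Finset.sum_congr rfl fun i _ => ?_
  rw [← Finset.smul_sum, smul_smul, smul_smul, ← qpow_add, ← qpow_int, ← qpow_add]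
  congr 2
  push_cast
  ring

lemma hexagon_reverse (hX : admissible q X) (hY : admissible q Y) (hZ : admissible q Z) :
    (assocL Z X Y).symm.toLinearMap ∘ₗ braidLin (X.tens Y) Z ∘ₗ (assocL X Y Z).symm.toLinearMap =
      tmap (braidLin X Z) LinearMap.id ∘ₗ (assocL X Z Y).symm.toLinearMap ∘ₗ
        tmap LinearMap.id (braidLin Y Z) := by
  refine ext_pt_wt₃' hX hY hZ fun m n p x hx y hy z hz => ?_
  obtain ⟨N₀, hF⟩ := nilpotent_F hZ
  set N := max N₀ (max (nilpotencyClass (op (X.tens Y) .E))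
    (max (nilpotencyClass (op X .E)) (nilpotencyClass (op Y .E)))) with hN
  have h1 : nilpotencyClass (op (X.tens Y) .E) ≤ N := by simp [hN]
  have h2 : nilpotencyClass (op X .E) ≤ N := by simp [hN]
  have h3 : nilpotencyClass (op Y .E) ≤ N := by simp [hN]
  have hl : ((assocL Z X Y).symm.toLinearMap ∘ₗ braidLin (X.tens Y) Z ∘ₗ
      (assocL X Y Z).symm.toLinearMap) (pt x (pt y z)) =
      qpow q (-(((m + n : ℤ) : ℝ) * p) / 2) • ∑ k ∈ Finset.range N,
        ∑ a ∈ Finset.HasAntidiagonal.antidiagonal k, qc q ^ (m * a.2 : ℤ) •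
          pt (pt ((op Z .F ^ (a.1 + a.2)) z) (dpow X .E a.1 x)) (dpow Y .E a.2 y) := by
    change (assocL Z X Y).symm (braidLin (X.tens Y) Z (pt (pt x y) z)) = _
    rw [braidLin_pt_E (admissible_tens hX hY) h1 (wt_pt hx hy) hz, map_smul, map_sum]
    congr 1
    refine Finset.sum_congr rfl fun k _ => ?_
    rw [dpow_E_tens hx y, pt_sum_right, map_sum]
    refine Finset.sum_congr rfl fun a ha => ?_
    rw [pt_smul_right, map_smul, assocL_symm_pt, Finset.HasAntidiagonal.mem_antidiagonal.1 ha]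
  have hr : (tmap (braidLin X Z) LinearMap.id ∘ₗ (assocL X Z Y).symm.toLinearMap ∘ₗ
        tmap LinearMap.id (braidLin Y Z)) (pt x (pt y z)) =
      qpow q (-((n : ℝ) * p) / 2) • ∑ j ∈ Finset.range N,
        qpow q (-((m : ℝ) * (p - 2 * j : ℤ)) / 2) • ∑ i ∈ Finset.range N,
          pt (pt ((op Z .F ^ (i + j)) z) (dpow X .E i x)) (dpow Y .E j y) := by
    change tmap (braidLin X Z) LinearMap.id
      ((assocL X Z Y).symm (pt x (braidLin Y Z (pt y z)))) = _
    rw [braidLin_pt_E hY h3 hy hz, pt_smul_right, map_smul, map_smul, pt_sum_right, map_sum,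
      map_sum]
    congr 1
    refine Finset.sum_congr rfl fun j _ => ?_
    rw [assocL_symm_pt, tmap_pt, braidLin_pt_E hX h2 hx (wt_F_pow hz j), pt_smul_left,
      pt_sum_left]
    congr 1
    refine Finset.sum_congr rfl fun i _ => ?_
    rw [pow_add]
    rfl
  rw [hl, hr, sum_antidiagonal_range N (fun i j => qc q ^ (m * j : ℤ) •
      pt (pt ((op Z .F ^ (i + j)) z) (dpow X .E i x)) (dpow Y .E j y))
    (fun i j h => by
      rw [pow_eq_zero_of_le ((le_max_left _ _).trans h) hF, LinearMap.zero_apply, pt_zero_left,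
        pt_zero_left, smul_zero]), Finset.sum_comm, Finset.smul_sum, Finset.smul_sum]
  refine Finset.sum_congr rfl fun j _ => ?_
  rw [← Finset.smul_sum, smul_smul, smul_smul, ← qpow_add, ← qpow_int, ← qpow_add]
  congr 2
  push_cast
  ring

end hexagon

/-- The braiding isomorphism `Σ R`. -/
def braidIso {X U : StarRep (Uq q)} (hX : admissible q X) (hU : admissible q U) :
    X.tens U ≅ U.tens X :=
  StarRep.mkIso (LinearEquiv.ofBijective (braidLin X U) (bijective_braid hX hU))
    (braid_comm hX hU)

/-- The braided tensor category `Rep_q(su_2)`, with the braiding `Σ R`. -/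
instance : BraidedCategory (RepUq q) where
  braiding X U := (admissible q).isoMk (braidIso X.property U.property)
  braiding_naturality_right X _ _ f := by
    ext1; ext1
    exact braid_natural X.property (ObjectProperty.FullSubcategory.property _) X.property
      (𝟙 X.obj) f.hom
  braiding_naturality_left f Z := by
    ext1; ext1
    exact braid_natural (ObjectProperty.FullSubcategory.property _) Z.property
      (ObjectProperty.FullSubcategory.property _) f.hom (𝟙 Z.obj)
  hexagon_forward X Y Z := by
    ext1; ext1
    exact hexagon_forward X.property Y.property Z.property
  hexagon_reverse X Y Z := by
    ext1; ext1
    exact hexagon_reverse X.property Y.property Z.property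

/-! ### The coideal `U_q^t(t_θ)` -/

/-- The generator `B_t = F - q⁻² E K⁻¹ + i t K⁻¹` of the coideal. -/
def Bt (q : Set.Ioo (0 : ℝ) 1) (t : ℝ) : Uq q :=
  gen q .F - (qc q ^ 2)⁻¹ • (gen q .E * gen q .Ki) + (Complex.I * t) • gen q .Ki

/-- The coideal `*`-subalgebra of `U_q(su_2)` generated by `B_t`. -/
def coideal (q : Set.Ioo (0 : ℝ) 1) (t : ℝ) : StarSubalgebra ℂ (Uq q) :=
  StarAlgebra.adjoin ℂ {Bt q t}

lemma comul_Bt (t : ℝ) : comulStar (Uq q) (Bt q t)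
    = Bt q t ⊗ₜ gen q .Ki + 1 ⊗ₜ (gen q .F - (qc q ^ 2)⁻¹ • (gen q .E * gen q .Ki)) := by
  change Bialgebra.comulAlgHom ℂ (Uq q) (Bt q t) = _
  simp only [Bt, map_add, map_sub, map_smul, map_mul, comul_gen, comulGen, add_mul,
    Algebra.TensorProduct.tmul_mul_tmul, gK_gKi, one_mul, TensorProduct.add_tmul,
    TensorProduct.sub_tmul, TensorProduct.tmul_sub, smul_add, TensorProduct.smul_tmul',
    TensorProduct.tmul_smul]
  abel

section coaction

variable {t : ℝ}

/-- The inclusion of `coideal ⊗ U_q(su_2)` in `U_q(su_2) ⊗ U_q(su_2)`. -/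
def inclTensor (q : Set.Ioo (0 : ℝ) 1) (t : ℝ) : coideal q t ⊗[ℂ] Uq q →⋆ₐ[ℂ] Uq q ⊗[ℂ] Uq q :=
  { Algebra.TensorProduct.map (coideal q t).subtype.toAlgHom (AlgHom.id ℂ (Uq q)) with
    map_star' := fun z => by
      change Algebra.TensorProduct.map (coideal q t).subtype.toAlgHom (AlgHom.id ℂ (Uq q)) (star z)
        = star (Algebra.TensorProduct.map (coideal q t).subtype.toAlgHom (AlgHom.id ℂ (Uq q)) z)
      induction z with
      | zero => simp only [star_zero, map_zero]
      | add x y hx hy => rw [star_add, map_add, map_add, star_add, hx, hy]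
      | tmul b a => rfl }

lemma incl_injective {M : Type} [Ring M] [Algebra ℂ M] : Function.Injective
    (Algebra.TensorProduct.map (coideal q t).subtype.toAlgHom (AlgHom.id ℂ M)) :=
  Module.Flat.rTensor_preserves_injective_linearMap (M := M)
    (coideal q t).subtype.toAlgHom.toLinearMap Subtype.coe_injective

lemma inclTensor_injective : Function.Injective (inclTensor q t) := incl_injective

lemma comul_mem (b : coideal q t) : comulStar (Uq q) b ∈ (inclTensor q t).range := by
  have h : coideal q t ≤ ((inclTensor q t).range).comap (comulStar (Uq q)) := by
    refine StarAlgebra.adjoin_le ?_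
    rw [Set.singleton_subset_iff]
    refine ⟨⟨Bt q t, StarAlgebra.self_mem_adjoin_singleton ℂ _⟩ ⊗ₜ gen q .Ki +
      1 ⊗ₜ (gen q .F - (qc q ^ 2)⁻¹ • (gen q .E * gen q .Ki)), ?_⟩
    refine Eq.trans ?_ (comul_Bt t).symm
    exact map_add _ _ _
  exact h b.2

/-- The restriction of the comultiplication to the coideal. -/
def coidealCoact (q : Set.Ioo (0 : ℝ) 1) (t : ℝ) : coideal q t →⋆ₐ[ℂ] coideal q t ⊗[ℂ] Uq q :=
  ((StarAlgEquiv.ofInjective (inclTensor q t) inclTensor_injective).symm : _ →⋆ₐ[ℂ] _).comp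
    (StarAlgHom.codRestrict ((comulStar (Uq q)).comp (coideal q t).subtype) _ comul_mem)

/-- The coaction of `U_q(su_2)` on the coideal is the comultiplication. -/
lemma incl_coact (b : coideal q t) :
    inclTensor q t (coidealCoact q t b) = comulStar (Uq q) b :=
  congrArg Subtype.val
    ((StarAlgEquiv.ofInjective (inclTensor q t) inclTensor_injective).apply_symm_apply
      ⟨comulStar (Uq q) b, comul_mem b⟩)

instance : StarCoaction (coideal q t) (Uq q) where
  coact := coidealCoact q t
  coassoc b := by
    apply incl_injective
    set z := coidealCoact q t b with hz
    have hb : inclTensor q t z = comulStar (Uq q) b := incl_coact b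
    have h1 : Algebra.TensorProduct.map (coideal q t).subtype.toAlgHom (AlgHom.id ℂ _)
        (Algebra.TensorProduct.map (AlgHom.id ℂ (coideal q t)) (Bialgebra.comulAlgHom ℂ (Uq q)) z)
        = Algebra.TensorProduct.map (AlgHom.id ℂ (Uq q)) (Bialgebra.comulAlgHom ℂ (Uq q))
          (inclTensor q t z) := by
      induction z with
      | zero => simp only [map_zero]
      | add x y hx hy => simp only [map_add, hx, hy]
      | tmul b a => rfl
    have h2 : Algebra.TensorProduct.map (coideal q t).subtype.toAlgHom (AlgHom.id ℂ _)
        (Algebra.TensorProduct.assoc ℂ ℂ ℂ (coideal q t) (Uq q) (Uq q)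
          (Algebra.TensorProduct.map (coidealCoact q t).toAlgHom (AlgHom.id ℂ (Uq q)) z))
        = Algebra.TensorProduct.assoc ℂ ℂ ℂ (Uq q) (Uq q) (Uq q)
          (Algebra.TensorProduct.map (Bialgebra.comulAlgHom ℂ (Uq q)) (AlgHom.id ℂ (Uq q))
            (inclTensor q t z)) := by
      induction z with
      | zero => simp only [map_zero]
      | add x y hx hy => simp only [map_add, hx, hy]
      | tmul b a =>
        have h3 : Bialgebra.comulAlgHom ℂ (Uq q) (b : Uq q) = inclTensor q t (coidealCoact q t b) :=
          (incl_coact b).symm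
        change _ = Algebra.TensorProduct.assoc ℂ ℂ ℂ (Uq q) (Uq q) (Uq q)
          (Bialgebra.comulAlgHom ℂ (Uq q) (b : Uq q) ⊗ₜ a)
        rw [h3]
        change Algebra.TensorProduct.map (coideal q t).subtype.toAlgHom (AlgHom.id ℂ _)
          (Algebra.TensorProduct.assoc ℂ ℂ ℂ (coideal q t) (Uq q) (Uq q)
            (coidealCoact q t b ⊗ₜ a)) = _
        induction coidealCoact q t b with
        | zero => simp only [TensorProduct.zero_tmul, map_zero]
        | add x y hx hy => simp only [TensorProduct.add_tmul, map_add, hx, hy]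
        | tmul c d => rfl
    rw [h1, h2, hb]
    exact Coalgebra.coassoc_apply (b : Uq q)
  counital b := by
    apply incl_injective
    set z := coidealCoact q t b with hz
    have hb : inclTensor q t z = comulStar (Uq q) b := incl_coact b
    have h1 : Algebra.TensorProduct.map (coideal q t).subtype.toAlgHom (AlgHom.id ℂ _)
        (Algebra.TensorProduct.map (AlgHom.id ℂ (coideal q t)) (Bialgebra.counitAlgHom ℂ (Uq q)) z)
        = Algebra.TensorProduct.map (AlgHom.id ℂ (Uq q)) (Bialgebra.counitAlgHom ℂ (Uq q))
          (inclTensor q t z) := by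
      induction z with
      | zero => simp only [map_zero]
      | add x y hx hy => simp only [map_add, hx, hy]
      | tmul b a => rfl
    rw [h1, hb]
    exact Coalgebra.lTensor_counit_comul (R := ℂ) (b : Uq q)

end coaction

/-- The trivial representation of the coideal, given by the restriction of the counit. -/
def epsRep (q : Set.Ioo (0 : ℝ) 1) (t : ℝ) : StarRep (coideal q t) :=
  StarRep.ofChar ((counitStar (Uq q)).comp (coideal q t).subtype)

/-- The module category `Rep_q^t(t_θ; ε)` over `Rep_q(su_2)` that is generated by `ε`, inside the
category of all finite-dimensional `*`-representations of the coideal. -/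
abbrev RepEps (q : Set.Ioo (0 : ℝ) 1) (t : ℝ) : Type 1 :=
  (generated (RepUq q) (epsRep q t)).FullSubcategory

/-- The object `ε` of `Rep_q^t(t_θ; ε)`. -/
def eps (q : Set.Ioo (0 : ℝ) 1) (t : ℝ) : RepEps q t := ⟨epsRep q t, Generated.base⟩

/-! ### The fundamental representation -/

/-- The matrices of the generators in the fundamental representation. -/
def fundMat (q : Set.Ioo (0 : ℝ) 1) : Gen → Matrix (Fin 2) (Fin 2) ℂ
  | .E => !![0, qpow q (1 / 2); 0, 0]
  | .F => !![0, 0; qpow q (-1 / 2), 0]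
  | .K => !![qc q, 0; 0, (qc q)⁻¹]
  | .Ki => !![(qc q)⁻¹, 0; 0, qc q]

lemma qpow_half : qpow q (1 / 2) * qpow q (-1 / 2) = 1 := by
  rw [← qpow_add, show (1 / 2 : ℝ) + -1 / 2 = 0 by norm_num, qpow_zero]

lemma qpow_half' : qpow q (-1 / 2) * qpow q (1 / 2) = 1 := by rw [mul_comm, qpow_half]

lemma star_qpow (s : ℝ) : star (qpow q s) = qpow q s := Complex.conj_ofReal _

lemma isRel_fundMat : IsRel q (fundMat q) where
  K_Ki := by
    ext i j; fin_cases i <;> fin_cases j <;> simp [fundMat, qc_ne_zero q]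
  Ki_K := by
    ext i j; fin_cases i <;> fin_cases j <;> simp [fundMat, qc_ne_zero q]
  K_E := by
    have := qc_ne_zero q
    ext i j; fin_cases i <;> fin_cases j <;> simp [fundMat]
    field_simp
  K_F := by
    have := qc_ne_zero q
    ext i j; fin_cases i <;> fin_cases j <;> simp [fundMat]
    field_simp
  E_F := by
    have h := qc_sub_ne (q := q)
    ext i j; fin_cases i <;> fin_cases j <;> simp [-one_div, fundMat, qpow_half, qpow_half', h]
    rw [← neg_sub (qc q) (qc q)⁻¹, mul_neg, inv_mul_cancel₀ h]

/-- The fundamental representation by matrices. -/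
def fundHom (q : Set.Ioo (0 : ℝ) 1) : Uq q →⋆ₐ[ℂ] Matrix (Fin 2) (Fin 2) ℂ :=
  { lift (fundMat q) isRel_fundMat with
    map_star' := map_star_of_gen _ (by
      have h1 : qpow q (-1 / 2) * qc q = qpow q (1 / 2) := by
        rw [← zpow_one (qc q), ← qpow_shift (s' := 1 / 2)]
        norm_num
      have h2 : (qc q)⁻¹ * qpow q (1 / 2) = qpow q (-1 / 2) := by
        rw [← zpow_neg_one, mul_comm, ← qpow_shift (s' := -1 / 2)]
        norm_num
      have h3 : (starRingEnd ℂ) (qc q) = qc q := star_qc q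
      have h4 : ∀ s, (starRingEnd ℂ) (qpow q s) = qpow q s := fun s => star_qpow s
      intro g
      cases g <;> simp only [starGen, map_mul, lift_gen] <;>
        (ext i j; fin_cases i <;> fin_cases j <;>
          simp [-one_div, fundMat, Matrix.star_apply, h1, h2, h3, h4])) }

/-- The underlying `*`-representation of the fundamental representation. -/
def fundRep (q : Set.Ioo (0 : ℝ) 1) : StarRep (Uq q) where
  carrier := EuclideanSpace ℂ (Fin 2)
  π := ((LinearMap.toMatrixOrthonormal (EuclideanSpace.basisFun (Fin 2) ℂ)).symm :
    _ →⋆ₐ[ℂ] _).comp (fundHom q)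

lemma fundRep_op (g : Gen) (v : EuclideanSpace ℂ (Fin 2)) (i : Fin 2) :
    (show EuclideanSpace ℂ (Fin 2) from op (fundRep q) g v) i = (fundMat q g).mulVec v.ofLp i := by
  have h : (fundHom q) (gen q g) = fundMat q g := lift_gen _ isRel_fundMat g
  rw [← h]
  change ((LinearMap.toMatrixOrthonormal (EuclideanSpace.basisFun (Fin 2) ℂ)).symm
    (fundHom q (gen q g)) v) i = _
  rfl

lemma admissible_fundRep : admissible q (fundRep q) := by
  refine eq_top_iff.2 fun (v : EuclideanSpace ℂ (Fin 2)) _ => ?_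
  have hv : v = WithLp.toLp 2 ![v 0, 0] + WithLp.toLp 2 ![0, v 1] := by
    ext i; fin_cases i <;> simp
  rw [hv]
  refine Submodule.add_mem _ (Submodule.mem_iSup_of_mem 1 (mem_wt.2 ?_))
    (Submodule.mem_iSup_of_mem (-1) (mem_wt.2 ?_))
  · refine PiLp.ext (x := op (fundRep q) .K _) fun i => ?_
    refine (fundRep_op .K _ i).trans ?_
    fin_cases i
    · refine Eq.trans ?_ (show (qc q * v 0) = (qc q ^ (1 : ℤ)) * v 0 by rw [zpow_one])
      simp [fundMat, mul_comm]
    · refine Eq.trans ?_ (show (0 : ℂ) = (qc q ^ (1 : ℤ)) * 0 from (mul_zero _).symm)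
      simp [fundMat]
  · refine PiLp.ext (x := op (fundRep q) .K _) fun i => ?_
    refine (fundRep_op .K _ i).trans ?_
    fin_cases i
    · refine Eq.trans ?_ (show (0 : ℂ) = (qc q ^ (-1 : ℤ)) * 0 from (mul_zero _).symm)
      simp [fundMat]
    · refine Eq.trans ?_ (show ((qc q)⁻¹ * v 1) = (qc q ^ (-1 : ℤ)) * v 1 by rw [zpow_neg_one])
      simp [fundMat, mul_comm]

/-- The fundamental two-dimensional representation `V`. -/
def fund (q : Set.Ioo (0 : ℝ) 1) : RepUq q := ⟨fundRep q, admissible_fundRep⟩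

/-! ### The parameter `λ_t` -/

lemma existsUnique_lam (q : Set.Ioo (0 : ℝ) 1) (t : ℝ) : ∃! l : ℝ,
    t = (q : ℝ) ^ (-(1 / 2) : ℝ) * (((q : ℝ) ^ (-l) - (q : ℝ) ^ l) / ((q : ℝ)⁻¹ - q)) := by
  obtain ⟨h0, h1⟩ := q.2
  have hlog : Real.log (q : ℝ) < 0 := Real.log_neg h0 h1
  have hd : 0 < (q : ℝ)⁻¹ - q := sub_pos.2 (h1.trans ((one_lt_inv₀ h0).2 h1))
  have hc : 0 < (q : ℝ) ^ (-(1 / 2) : ℝ) := Real.rpow_pos_of_pos h0 _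
  have key : ∀ l : ℝ, (q : ℝ) ^ (-l) - (q : ℝ) ^ l = 2 * Real.sinh (-Real.log q * l) := fun l => by
    rw [Real.rpow_def_of_pos h0, Real.rpow_def_of_pos h0, Real.sinh_eq]
    ring_nf
  have key2 : ∀ l : ℝ,
      t = (q : ℝ) ^ (-(1 / 2) : ℝ) * (((q : ℝ) ^ (-l) - (q : ℝ) ^ l) / ((q : ℝ)⁻¹ - q)) ↔
      l = Real.arsinh (t / (q : ℝ) ^ (-(1 / 2) : ℝ) * ((q : ℝ)⁻¹ - q) / 2) / (-Real.log q) :=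
    fun l => by
      rw [key, eq_div_iff (by linarith), mul_comm l, ← Real.sinh_injective.eq_iff (a := _ * l),
        Real.sinh_arsinh, eq_comm (a := Real.sinh _), div_eq_iff two_ne_zero, ← eq_div_iff hd.ne',
        div_eq_iff hc.ne', mul_comm ((q : ℝ) ^ _), mul_comm (2 : ℝ)]
  exact ⟨_, (key2 _).2 rfl, fun l hl => (key2 l).1 hl⟩

/-- The unique real number `λ` with `t = q^{-1/2} (q^{-λ} - q^λ) / (q⁻¹ - q)`. -/
def lam (q : Set.Ioo (0 : ℝ) 1) (t : ℝ) : ℝ := (existsUnique_lam q t).choose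

lemma lam_spec (q : Set.Ioo (0 : ℝ) 1) (t : ℝ) :
    t = (q : ℝ) ^ (-(1 / 2) : ℝ) *
      (((q : ℝ) ^ (-lam q t) - (q : ℝ) ^ lam q t) / ((q : ℝ)⁻¹ - q)) :=
  (existsUnique_lam q t).choose_spec.1

/-! ### Ribbon braids on `Rep_q^t(t_θ; ε)` -/

/-- The operator `C = η_{ε,V}` on the Hilbert space `ε ⊙ V`. -/
def braidC {t : ℝ} (η : RibbonBraid (RepUq q) (RepEps q t)) :
    (eps q t ⊙ᵣ fund q).obj.carrier →ₗ[ℂ] (eps q t ⊙ᵣ fund q).obj.carrier :=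
  (η.η (eps q t) (fund q)).hom.hom.lin

/-- The operator `C = η_{ε,V}` is not a scalar multiple of the identity. -/
def NonScalar {t : ℝ} (η : RibbonBraid (RepUq q) (RepEps q t)) : Prop :=
  ∀ c : ℂ, braidC η ≠ c • LinearMap.id

end QSU2

end

/-!
The coideal is generated by the single skew-adjoint element `B_t`, so that a linear map between
its representations is an intertwiner as soon as it commutes with `B_t`, and every function of the
self-adjoint operator `-i B_t` is an automorphism of the identity functor (`fcal`, `comm_of_opB`).

*Existence.* For such an automorphism `τ`, the isomorphisms `η_{X,U} = τ_{X ⊙ U} (τ_X ⊙ 1)⁻¹`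
automatically satisfy naturality and the ribbon equation. Write the eigenvalues of `-i B_t` as
`q^{-1/2} (q^{-s} - q^s) / (q⁻¹ - q)`, and let `τ` act on the eigenvectors with parameter `s` as
`e^{iπs/2} q^{-s²/2}`. On `x ⊗ V`, for an eigenvector `x` with parameter `s`, the operator `B_t`
has the parameters `s ± 1`, and comparison of the eigenvalues shows that `η_{X,V}` is
`B_{X ⊙ V} - q B_X ⊗ 1` (`tw_fund`). With this formula the octagon equation for `(U, V)` is a
computation on weight vectors (`octagon_fund_lin`). Both hexagon equations propagate the octagon
equation to `(U, V^{⊗ n})` (`Octagon.tensor`), and then to all `(U, W)` by naturality, as every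
representation is spanned by the images of intertwiners from the tensor powers of `V`: highest
weight vectors of the same weight generate isomorphic representations (`iSup_range_tpow`).

*Uniqueness.* Since `C = η_{ε,V}` commutes with `B_t`, its matrix has the form `[[a, -b], [b, d]]`,
with `a - d` proportional to `b`; it is scalar if `b = 0`. On the invariant vector of `V ⊗ V`, the
braid `η_{ε,V ⊗ V}` is the identity by naturality, whereas the ribbon and octagon equations express
it by `C` and the braiding; this gives `b d = 0` and `q b² = 1` (`sign_of_entries`). Hence `C` is
determined up to a sign, and the sign is absorbed by the monoidal automorphism that acts as `(-1)^m`
on vectors of weight `m` (`parity`). A ribbon braid is determined by `C`, since the equations and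
naturality carry an identity for `(ε, V)` to all pairs `(X, U)` (`agree_of_fund`).

*Singular values.* On a two-dimensional space they are determined by the Hilbert-Schmidt norm and
the determinant, here `(q⁻¹ - q)² t² + 2 q⁻¹ = q⁻¹ (q^{2λ} + q^{-2λ})` for the squared norm, and
`q⁻¹` for the modulus of the determinant.
-/

open scoped TensorProduct

noncomputable section

set_option linter.unusedSectionVars false

namespace QSU2

/-! ### Functional calculus of symmetric operators -/

section calculus

variable {E : Type*} [NormedAddCommGroup E] [InnerProductSpace ℂ E] [FiniteDimensional ℂ E]

/-- The operator `g(T)` for a diagonalizable operator `T`: it multiplies the eigenvectors of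
eigenvalue `μ` by `g μ`. -/
def fcal (T : E →ₗ[ℂ] E) (g : ℂ → ℂ) : E →ₗ[ℂ] E :=
  ∑ μ ∈ (Module.End.finite_hasEigenvalue T).toFinset,
    g μ • (Module.End.eigenspace T μ).starProjection.toLinearMap

lemma fcal_apply {T : E →ₗ[ℂ] E} (hT : T.IsSymmetric) (g : ℂ → ℂ) {μ : ℂ} {x : E}
    (hx : T x = μ • x) : fcal T g x = g μ • x := by
  have hx' : x ∈ Module.End.eigenspace T μ := Module.End.mem_eigenspace_iff.2 hx
  by_cases h0 : x = 0
  · rw [h0, map_zero, smul_zero]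
  have hμ : μ ∈ (Module.End.finite_hasEigenvalue T).toFinset := by
    rw [Set.Finite.mem_toFinset]
    exact Module.End.hasEigenvalue_of_hasEigenvector ⟨hx', h0⟩
  rw [fcal, LinearMap.sum_apply, Finset.sum_eq_single_of_mem μ hμ]
  · change g μ • (Module.End.eigenspace T μ).starProjection x = _
    rw [Submodule.starProjection_eq_self_iff.2 hx']
  · intro ν _ hν
    change g ν • (Module.End.eigenspace T ν).starProjection x = _
    rw [(Submodule.starProjection_apply_eq_zero_iff _).2, smul_zero]
    rw [Submodule.mem_orthogonal]
    intro y hy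
    exact hT.orthogonalFamily_eigenspaces hν ⟨y, hy⟩ ⟨x, hx'⟩

/-- The eigenvectors of a symmetric operator span, and have real eigenvalues. -/
lemma ext_eigen {T : E →ₗ[ℂ] E} (hT : T.IsSymmetric) {M : Type*} [AddCommGroup M] [Module ℂ M]
    {f g : E →ₗ[ℂ] M} (h : ∀ (r : ℝ) (x : E), T x = (r : ℂ) • x → f x = g x) : f = g := by
  have h1 : ⨆ μ : ℂ, Module.End.eigenspace T μ = ⊤ := by
    rw [← Submodule.orthogonal_eq_bot_iff]
    exact hT.orthogonalComplement_iSup_eigenspaces_eq_bot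
  have h2 : (⊤ : Submodule ℂ E) ≤ LinearMap.eqLocus f g := by
    rw [← h1]
    refine iSup_le fun μ x hx => ?_
    by_cases h0 : x = 0
    · rw [h0]; exact Submodule.zero_mem _
    have hr := hT.conj_eigenvalue_eq_self
      (Module.End.hasEigenvalue_of_hasEigenvector ⟨hx, h0⟩)
    obtain ⟨r, rfl⟩ := Complex.conj_eq_iff_real.1 hr
    exact h r x (Module.End.mem_eigenspace_iff.1 hx)
  exact LinearMap.ext fun x => h2 trivial

lemma fcal_mul {T : E →ₗ[ℂ] E} (hT : T.IsSymmetric) {g h : ℂ → ℂ} (hgh : ∀ z, g z * h z = 1) :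
    fcal T g ∘ₗ fcal T h = LinearMap.id := by
  refine ext_eigen hT fun r x hx => ?_
  rw [LinearMap.comp_apply, fcal_apply hT h hx, map_smul, fcal_apply hT g hx, smul_smul, mul_comm,
    hgh, one_smul, LinearMap.id_apply]

/-- Linear maps that intertwine two symmetric operators intertwine their functional calculi. -/
lemma fcal_comm {E' : Type*} [NormedAddCommGroup E'] [InnerProductSpace ℂ E']
    [FiniteDimensional ℂ E'] {T : E →ₗ[ℂ] E} {T' : E' →ₗ[ℂ] E'} (hT : T.IsSymmetric)
    (hT' : T'.IsSymmetric) {f : E →ₗ[ℂ] E'} (hf : f ∘ₗ T = T' ∘ₗ f) (g : ℂ → ℂ) :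
    f ∘ₗ fcal T g = fcal T' g ∘ₗ f := by
  refine ext_eigen hT fun r x hx => ?_
  have h : T' (f x) = (r : ℂ) • f x := by
    rw [← LinearMap.comp_apply, ← hf, LinearMap.comp_apply, hx, map_smul]
  rw [LinearMap.comp_apply, LinearMap.comp_apply, fcal_apply hT g hx, map_smul,
    fcal_apply hT' g h]

end calculus

open CategoryTheory MonoidalCategory MonoidalRightAction

/-! ### Ribbon braids on module categories -/

section generic

variable {C : Type*} [Category C] [MonoidalCategory C] [BraidedCategory C]
  {D : Type*} [Category D] [MonoidalRightAction C D]

/-- The action of the braiding, `(X ⊙ U) ⊙ W ⟶ (X ⊙ W) ⊙ U`. -/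
def swapAct (X : D) (U W : C) : (X ⊙ᵣ U) ⊙ᵣ W ⟶ (X ⊙ᵣ W) ⊙ᵣ U :=
  (αᵣ X U W).inv ≫ X ⊴ᵣ (β_ U W).hom ≫ (αᵣ X W U).hom

lemma swapAct_natural {X Y : D} (f : X ⟶ Y) (U W : C) :
    (f ⊵ᵣ U) ⊵ᵣ W ≫ swapAct Y U W = swapAct X U W ≫ (f ⊵ᵣ W) ⊵ᵣ U := by
  have h1 : ∀ U W : C, (f ⊵ᵣ U) ⊵ᵣ W = (αᵣ X U W).inv ≫ f ⊵ᵣ (U ⊗ W) ≫ (αᵣ Y U W).hom := by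
    intro U W
    simp
  rw [h1, h1, swapAct, swapAct]
  simp only [Category.assoc, Iso.hom_inv_id_assoc]
  rw [action_exchange_assoc]

lemma swapAct_natural_right (X : D) (U : C) {W W' : C} (g : W ⟶ W') :
    (X ⊙ᵣ U) ⊴ᵣ g ≫ swapAct X U W' = swapAct X U W ≫ (X ⊴ᵣ g) ⊵ᵣ U := by
  have h1 : (X ⊴ᵣ g) ⊵ᵣ U = (αᵣ X W U).inv ≫ X ⊴ᵣ (g ▷ U) ≫ (αᵣ X W' U).hom := by
    simp
  rw [h1, swapAct, swapAct, action_actionHomRight]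
  simp only [Category.assoc, Iso.hom_inv_id_assoc]
  rw [← actionHomRight_comp_assoc, ← actionHomRight_comp_assoc,
    BraidedCategory.braiding_naturality_right]

lemma swapAct_natural_right' (X : D) (U : C) {W W' : C} (g : W ⟶ W') :
    (X ⊴ᵣ g) ⊵ᵣ U ≫ swapAct X W' U = swapAct X W U ≫ (X ⊙ᵣ U) ⊴ᵣ g := by
  have h1 : (X ⊴ᵣ g) ⊵ᵣ U = (αᵣ X W U).inv ≫ X ⊴ᵣ (g ▷ U) ≫ (αᵣ X W' U).hom := by
    simp
  rw [h1, swapAct, swapAct, action_actionHomRight]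
  simp only [Category.assoc, Iso.hom_inv_id_assoc]
  rw [← actionHomRight_comp_assoc, ← actionHomRight_comp_assoc,
    BraidedCategory.braiding_naturality_left]

lemma actionAssoc_inv_tensor (X : D) (U V W : C) :
    (αᵣ X U (V ⊗ W)).inv = (αᵣ (X ⊙ᵣ U) V W).hom ≫ (αᵣ X U V).inv ⊵ᵣ W ≫
      (αᵣ X (U ⊗ V) W).inv ≫ X ⊴ᵣ (α_ U V W).hom := by
  rw [← cancel_epi (αᵣ X U (V ⊗ W)).hom, ← cancel_epi (X ⊴ᵣ (α_ U V W).hom),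
    reassoc_of% actionHom_associator U V W X]
  simp

/-- Swapping with a tensor product, from the first hexagon equation. -/
lemma swapAct_tensor (X : D) (U W W' : C) :
    swapAct X U (W ⊗ W') ≫ (αᵣ X W W').hom ⊵ᵣ U =
      (αᵣ (X ⊙ᵣ U) W W').hom ≫ (swapAct X U W) ⊵ᵣ W' ≫ swapAct (X ⊙ᵣ W) U W' := by
  have h1 := actionHom_associator W U W' X
  have h1' : (αᵣ X (W ⊗ U) W').hom ≫ (αᵣ X W U).hom ⊵ᵣ W' ≫ (αᵣ (X ⊙ᵣ W) U W').inv ≫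
      (αᵣ X W (U ⊗ W')).inv = X ⊴ᵣ (α_ W U W').hom := by
    rw [← reassoc_of% h1]
    simp
  rw [swapAct, swapAct, swapAct, action_actionHomRight, comp_actionHomLeft, comp_actionHomLeft]
  have h2 : (X ⊴ᵣ (β_ U W).hom) ⊵ᵣ W' = (αᵣ X (U ⊗ W) W').inv ≫ X ⊴ᵣ ((β_ U W).hom ▷ W') ≫
      (αᵣ X (W ⊗ U) W').hom := by simp
  rw [h2]
  simp only [Category.assoc]
  rw [reassoc_of% h1', ← actionHom_associator, actionAssoc_inv_tensor]
  simp only [Category.assoc]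
  rw [← actionHomRight_comp_assoc, ← actionHomRight_comp_assoc, ← actionHomRight_comp_assoc,
    ← actionHomRight_comp_assoc, Category.assoc, Category.assoc,
    BraidedCategory.hexagon_forward]

/-- Swapping with a tensor product, from the second hexagon equation. -/
lemma swapAct_tensor' (X : D) (U W W' : C) :
    (αᵣ X W W').hom ⊵ᵣ U ≫ swapAct (X ⊙ᵣ W) W' U ≫ (swapAct X W U) ⊵ᵣ W' =
      swapAct X (W ⊗ W') U ≫ (αᵣ (X ⊙ᵣ U) W W').hom := by
  have h1 := actionHom_associator W U W' X
  have h1' : (αᵣ X W (U ⊗ W')).hom ≫ (αᵣ (X ⊙ᵣ W) U W').hom ≫ (αᵣ X W U).inv ⊵ᵣ W' ≫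
      (αᵣ X (W ⊗ U) W').inv = X ⊴ᵣ (α_ W U W').inv := by
    rw [← cancel_epi (X ⊴ᵣ (α_ W U W').hom), reassoc_of% h1]
    simp
  have h3 : (αᵣ X W W').hom ⊵ᵣ U ≫ (αᵣ (X ⊙ᵣ W) W' U).inv ≫ (αᵣ X W (W' ⊗ U)).inv =
      (αᵣ X (W ⊗ W') U).inv ≫ X ⊴ᵣ (α_ W W' U).hom := by
    rw [Iso.eq_inv_comp, ← reassoc_of% actionHom_associator W W' U X]
    simp
  have h4 : (αᵣ X U (W ⊗ W')).hom = X ⊴ᵣ (α_ U W W').inv ≫ (αᵣ X (U ⊗ W) W').hom ≫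
      (αᵣ X U W).hom ⊵ᵣ W' ≫ (αᵣ (X ⊙ᵣ U) W W').inv := by
    rw [← cancel_epi (X ⊴ᵣ (α_ U W W').hom), actionHomRight_hom_inv_assoc,
      ← reassoc_of% actionHom_associator U W W' X]
    simp
  rw [swapAct, swapAct, swapAct, action_actionHomRight, comp_actionHomLeft, comp_actionHomLeft, h4]
  have h2 : (X ⊴ᵣ (β_ W U).hom) ⊵ᵣ W' = (αᵣ X (W ⊗ U) W').inv ≫ X ⊴ᵣ ((β_ W U).hom ▷ W') ≫
      (αᵣ X (U ⊗ W) W').hom := by simp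
  rw [h2]
  simp only [Category.assoc, Iso.inv_hom_id, Category.comp_id]
  rw [reassoc_of% h1', reassoc_of% h3]
  rw [← actionHomRight_comp_assoc, ← actionHomRight_comp_assoc, ← actionHomRight_comp_assoc,
    ← actionHomRight_comp_assoc]
  congr 2
  have h5 := BraidedCategory.hexagon_reverse W W' U
  rw [Iso.inv_comp_eq] at h5
  rw [h5]
  simp only [Category.assoc]

/-! ### Ribbon braids from twists -/

section twist

/-- The automorphism `τ_{X ⊙ U} (τ_X ⊙ 1)⁻¹` of `X ⊙ U` for an automorphism `τ` of the identity
functor of a module category. -/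
def twistBraid (τ : ∀ X : D, X ≅ X) (X : D) (U : C) : X ⊙ᵣ U ≅ X ⊙ᵣ U where
  hom := (τ X).inv ⊵ᵣ U ≫ (τ (X ⊙ᵣ U)).hom
  inv := (τ (X ⊙ᵣ U)).inv ≫ (τ X).hom ⊵ᵣ U

variable {τ : ∀ X : D, X ≅ X} (hτ : ∀ {X Y : D} (f : X ⟶ Y), f ≫ (τ Y).hom = (τ X).hom ≫ f)
include hτ

lemma twist_inv {X Y : D} (f : X ⟶ Y) : f ≫ (τ Y).inv = (τ X).inv ≫ f := by
  rw [Iso.eq_inv_comp, ← reassoc_of% hτ f, Iso.hom_inv_id, Category.comp_id]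

lemma twistBraid_natural {X Y : D} {U V : C} (f : X ⟶ Y) (g : U ⟶ V) :
    (f ⊙ᵣₘ g) ≫ (twistBraid τ Y V).hom = (twistBraid τ X U).hom ≫ (f ⊙ᵣₘ g) := by
  simp only [twistBraid, Category.assoc]
  rw [← hτ, ← Category.assoc, ← Category.assoc]
  congr 1
  rw [actionHom_def, Category.assoc, action_exchange, ← comp_actionHomLeft_assoc,
    ← comp_actionHomLeft_assoc, twist_inv hτ]

lemma twistBraid_tensor (X : D) (U V : C) :
    (twistBraid τ X (U ⊗ V)).hom =
      (αᵣ X U V).hom ≫ ((twistBraid τ X U).hom ⊵ᵣ V) ≫ (twistBraid τ (X ⊙ᵣ U) V).hom ≫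
        (αᵣ X U V).inv := by
  simp only [twistBraid, comp_actionHomLeft, Category.assoc, hom_inv_actionHomLeft_assoc]
  rw [← hτ]
  simp

/-- The octagon equation for the automorphisms `τ_{X ⊙ U} (τ_X ⊙ 1)⁻¹`. -/
def Octagon (τ : ∀ X : D, X ≅ X) (X : D) (U W : C) : Prop :=
  (twistBraid τ (X ⊙ᵣ U) W).hom =
    swapAct X U W ≫ (twistBraid τ X W).hom ⊵ᵣ U ≫ swapAct X W U

/-- The octagon equation passes to tensor products in the second variable. -/
lemma Octagon.tensor {U W W' : C} (h : ∀ X, Octagon τ X U W) (h' : ∀ X, Octagon τ X U W') (X : D) :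
    Octagon τ X U (W ⊗ W') := by
  have hn : (swapAct X W U) ⊵ᵣ W' ≫ (twistBraid τ ((X ⊙ᵣ U) ⊙ᵣ W) W').hom =
      (twistBraid τ ((X ⊙ᵣ W) ⊙ᵣ U) W').hom ≫ (swapAct X W U) ⊵ᵣ W' := by
    have := twistBraid_natural hτ (swapAct X W U) (𝟙 W')
    simpa only [actionHom_id] using this
  have e1 : (αᵣ (X ⊙ᵣ U) W W').hom ≫ (twistBraid τ (X ⊙ᵣ U) W).hom ⊵ᵣ W' ≫
      (twistBraid τ ((X ⊙ᵣ U) ⊙ᵣ W) W').hom =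
      swapAct X U (W ⊗ W') ≫ (αᵣ X W W').hom ⊵ᵣ U ≫ ((twistBraid τ X W).hom ⊵ᵣ W') ⊵ᵣ U ≫
        (twistBraid τ (X ⊙ᵣ W) W').hom ⊵ᵣ U ≫ swapAct (X ⊙ᵣ W) W' U ≫ (swapAct X W U) ⊵ᵣ W' := by
    have e2 := h X
    have e3 := h' (X ⊙ᵣ W)
    rw [Octagon] at e2 e3
    rw [e2]
    simp only [comp_actionHomLeft, Category.assoc]
    rw [hn, e3, reassoc_of% swapAct_tensor]
    simp only [Category.assoc]
    rw [← reassoc_of% swapAct_natural]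
  rw [Octagon, twistBraid_tensor hτ, twistBraid_tensor hτ, reassoc_of% e1]
  simp only [comp_actionHomLeft, Category.assoc]
  have e4 := congrArg (· ≫ (αᵣ (X ⊙ᵣ U) W W').inv) (swapAct_tensor' X U W W')
  simp only [Category.assoc, Iso.hom_inv_id, Category.comp_id] at e4
  rw [← e4, inv_hom_actionHomLeft_assoc]

lemma twistBraid_unit (X : D) : (twistBraid τ X (𝟙_ C)).hom = 𝟙 _ := by
  simp only [twistBraid]
  rw [unit_actionHomRight, Category.assoc, Category.assoc, hτ (ρᵣ[C] X).inv]
  simp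

/-- The octagon equation holds for the unit object in the second variable. -/
lemma Octagon.unit (X : D) (U : C) : Octagon τ X U (𝟙_ C) := by
  rw [Octagon, twistBraid_unit hτ, twistBraid_unit hτ, id_actionHomLeft, Category.id_comp, swapAct,
    swapAct]
  simp only [Category.assoc, Iso.hom_inv_id_assoc]
  rw [← actionHomRight_comp_assoc, braiding_tensorUnit_right, braiding_tensorUnit_left]
  simp

/-- If the octagon equation holds for `(U, W')`, then it holds for `(U, W)` on the image of
`g : W' ⟶ W`. -/
lemma Octagon.comp {U W W' : C} {X : D} (h : Octagon τ X U W') (g : W' ⟶ W) :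
    (X ⊙ᵣ U) ⊴ᵣ g ≫ (twistBraid τ (X ⊙ᵣ U) W).hom =
      (X ⊙ᵣ U) ⊴ᵣ g ≫ swapAct X U W ≫ (twistBraid τ X W).hom ⊵ᵣ U ≫ swapAct X W U := by
  have h1 := twistBraid_natural hτ (𝟙 (X ⊙ᵣ U)) g
  have h2 := twistBraid_natural hτ (𝟙 X) g
  rw [id_actionHom] at h1 h2
  rw [h1, h, reassoc_of% swapAct_natural_right, ← comp_actionHomLeft_assoc, h2]
  simp only [comp_actionHomLeft, Category.assoc]
  rw [swapAct_natural_right']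

/-- The ribbon braid of an automorphism of the identity functor that satisfies the octagon
equation. -/
def RibbonBraid.ofTwist (h : ∀ (X : D) (U W : C), Octagon τ X U W) : RibbonBraid C D where
  η := twistBraid τ
  naturality := twistBraid_natural hτ
  octagon X U V := by
    rw [h X U V]
    simp only [swapAct, Category.assoc]
  ribbon := twistBraid_tensor hτ

end twist

/-! ### Comparison of ribbon braids -/

section compare

/-- On the unit object, every ribbon braid is trivial. -/
lemma RibbonBraid.unit (η : RibbonBraid C D) (X : D) : (η.η X (𝟙_ C)).hom = 𝟙 _ := by
  have h1 := η.naturality (𝟙 X) (λ_ (𝟙_ C)).hom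
  have h2 := η.naturality (ρᵣ[C] X).hom (𝟙 (𝟙_ C))
  rw [id_actionHom] at h1
  rw [actionHom_id] at h2
  have h3 := η.ribbon X (𝟙_ C) (𝟙_ C)
  have h4 : (αᵣ X (𝟙_ C) (𝟙_ C)).hom ≫ (ρᵣ (X ⊙ᵣ 𝟙_ C)).hom = X ⊴ᵣ (λ_ (𝟙_ C)).hom := by
    rw [← actionHom_rightUnitor, unitors_equal]
  have h5 := actionHom_leftUnitor (𝟙_ C) X
  rw [h3] at h1
  have h6 : (αᵣ X (𝟙_ C) (𝟙_ C)).inv ≫ X ⊴ᵣ (λ_ (𝟙_ C)).hom = (ρᵣ X).hom ⊵ᵣ 𝟙_ C := by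
    rw [Iso.inv_comp_eq, h5]
  simp only [Category.assoc] at h1
  rw [h6, ← h2, unit_actionHomRight, Category.assoc, Category.assoc, ← h4] at h1
  have h7 : (ρᵣ[C] X).hom ⊵ᵣ 𝟙_ C = (ρᵣ (X ⊙ᵣ 𝟙_ C)).hom := by
    rw [← h6, ← h4, Iso.inv_hom_id_assoc]
  rw [h7, Category.assoc, cancel_epi, cancel_epi, Iso.inv_hom_id_assoc] at h1
  rw [← cancel_epi (η.η X (𝟙_ C)).hom, ← h1, Category.comp_id]

variable (η η' : RibbonBraid C D) (F : 𝟭 C ≅ 𝟭 C)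

/-- The braids `η'` and `η (1 ⊙ F)` agree on `X ⊙ U`. -/
def Agree (X : D) (U : C) : Prop := (η'.η X U).hom = X ⊴ᵣ F.hom.app U ≫ (η.η X U).hom

variable {η η' F}

lemma Agree.act {X : D} {W : C} (h : Agree η η' F X W) (U : C) : Agree η η' F (X ⊙ᵣ U) W := by
  have h0 : ∀ η : RibbonBraid C D, (η.η (X ⊙ᵣ U) W).hom =
      swapAct X U W ≫ (η.η X W).hom ⊵ᵣ U ≫ swapAct X W U := fun η => by
    rw [η.octagon]
    simp only [swapAct, Category.assoc]
  rw [Agree] at h ⊢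
  have h1 := swapAct_natural_right X U (F.hom.app W)
  simp only [Functor.id_obj] at h1
  rw [h0, h0, h, comp_actionHomLeft, Category.assoc]
  have h2 := congrArg (· ≫ (η.η X W).hom ⊵ᵣ U ≫ swapAct X W U) h1
  simp only [Category.assoc] at h2
  exact h2.symm

lemma Agree.tensor [NatTrans.IsMonoidal F.hom] {X : D} {U W : C} (h : Agree η η' F X U)
    (h' : Agree η η' F (X ⊙ᵣ U) W) : Agree η η' F X (U ⊗ W) := by
  have h1 : F.hom.app (U ⊗ W) = F.hom.app U ⊗ₘ F.hom.app W := by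
    simpa using NatTrans.IsMonoidal.tensor (τ := F.hom) U W
  have h2 := actionAssocIso_hom_naturality (𝟙 X) (F.hom.app U) (F.hom.app W)
  rw [id_actionHom, id_actionHom] at h2
  rw [Agree] at h h' ⊢
  rw [η'.ribbon, η.ribbon, h1, h, h']
  simp only [Functor.id_obj] at h2 ⊢
  rw [reassoc_of% h2, actionHom_def, comp_actionHomLeft]
  simp only [Category.assoc]
  rw [← action_exchange_assoc]

lemma Agree.unit [NatTrans.IsMonoidal F.hom] (X : D) : Agree η η' F X (𝟙_ C) := by
  have h1 : F.hom.app (𝟙_ C) = 𝟙 (𝟙_ C) := by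
    simpa using NatTrans.IsMonoidal.unit (τ := F.hom)
  rw [Agree, η.unit, η'.unit, h1]
  simp

lemma Agree.comp_right {X : D} {U U' : C} (h : Agree η η' F X U') (g : U' ⟶ U) :
    X ⊴ᵣ g ≫ (η'.η X U).hom = X ⊴ᵣ g ≫ X ⊴ᵣ F.hom.app U ≫ (η.η X U).hom := by
  have h1 := η.naturality (𝟙 X) g
  have h2 := η'.naturality (𝟙 X) g
  have h3 := F.hom.naturality g
  simp only [Functor.id_map, Functor.id_obj] at h3
  rw [id_actionHom] at h1 h2
  rw [h2, h, Category.assoc]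
  simp only [Functor.id_obj]
  rw [← actionHomRight_comp_assoc, h3, actionHomRight_comp_assoc, h1]

lemma Agree.comp_left {X Y : D} {U : C} (h : Agree η η' F Y U) (f : X ⟶ Y) :
    (η'.η X U).hom ≫ f ⊵ᵣ U = (X ⊴ᵣ F.hom.app U ≫ (η.η X U).hom) ≫ f ⊵ᵣ U := by
  have h1 := η.naturality f (𝟙 U)
  have h2 := η'.naturality f (𝟙 U)
  rw [actionHom_id] at h1 h2
  rw [← h2, h, Category.assoc, ← h1]
  exact (action_exchange_assoc f (F.hom.app U) _).symm

/-- Ribbon braids that agree up to `F` are equivalent by the identity functor. -/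
lemma isBraidedEquivalence_of_agree [Preadditive C] [Linear ℂ C] [StarCategory C] [Preadditive D]
    [Linear ℂ D] [StarCategory D] (hF : NatTrans.IsMonoidal F.hom)
    (hF' : ∀ U : C, IsUnitary (F.app U)) (h : ∀ X U, Agree η η' F X U) :
    IsBraidedEquivalence η η' F (𝟭 D) (fun X U => Iso.refl (X ⊙ᵣ U)) where
  F_monoidal := hF
  F_unitary := hF'
  G_equivalence := inferInstance
  G_additive := inferInstance
  G_linear _ _ := rfl
  G_star _ := rfl
  G₂_natural f g := by simp
  G₂_unitary X U := StarCategory.dag_id _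
  pentagon X U V := by simp
  braid X U := by
    have h1 := h X U
    rw [Agree] at h1
    simp only [Functor.id_obj, Functor.id_map, Iso.refl_hom, Category.comp_id, Category.id_comp]
    exact h1

end compare

end generic

variable {q : Set.Ioo (0 : ℝ) 1} {t : ℝ}

/-! ### Generation of the representation category by the fundamental representation -/

section highest

open scoped InnerProductSpace

lemma inner_π {A : Type} [Ring A] [StarRing A] [Algebra ℂ A] (X : StarRep A) (a : A)
    (x y : X.carrier) : ⟪X.π a x, y⟫_ℂ = ⟪x, X.π (star a) y⟫_ℂ := by
  rw [map_star, LinearMap.star_eq_adjoint, LinearMap.adjoint_inner_right]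

lemma inner_K {X : StarRep (Uq q)} (x y : X.carrier) : ⟪op X .K x, y⟫_ℂ = ⟪x, op X .K y⟫_ℂ := by
  rw [inner_π, star_gen]; rfl

lemma inner_E {X : StarRep (Uq q)} (x y : X.carrier) :
    ⟪x, op X .E y⟫_ℂ = ⟪op X .F (op X .K x), y⟫_ℂ := by
  rw [op_op, inner_π, star_mul, star_gen, star_gen, starGen, starGen, ← mul_assoc, gK_gKi, one_mul]

lemma inner_F {X : StarRep (Uq q)} (x y : X.carrier) :
    ⟪x, op X .F y⟫_ℂ = ⟪op X .Ki (op X .E x), y⟫_ℂ := by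
  rw [op_op, inner_π, star_mul, star_gen, star_gen, starGen, starGen, mul_assoc, gK_gKi, mul_one]

lemma star_qc_zpow (m : ℤ) : (starRingEnd ℂ) (qc q ^ m) = qc q ^ m := by
  rw [map_zpow₀]
  exact congrArg (· ^ m) (star_qc q)

lemma star_qInt (m : ℤ) : (starRingEnd ℂ) (qInt q m) = qInt q m := by
  have h : (starRingEnd ℂ) (qc q) = qc q := star_qc q
  rw [qInt, map_div₀, map_sub, map_sub, map_inv₀, star_qc_zpow, star_qc_zpow, h]

variable {X : StarRep (Uq q)}

lemma E_F_highest {m : ℤ} {e : X.carrier} (he : e ∈ wt X m) (hE : op X .E e = 0) (k : ℕ) :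
    op X .E ((op X .F ^ (k + 1)) e) = (qInt q (k + 1) * qInt q (m - k)) • (op X .F ^ k) e := by
  rw [E_F_pow he, hE, map_zero, zero_add]

/-- The number `‖F^{k+1} e‖² / ‖F^k e‖²` for a highest weight vector `e` of weight `m`. -/
def normRatio (q : Set.Ioo (0 : ℝ) 1) (m : ℤ) (k : ℕ) : ℂ :=
  qc q ^ (-(m - 2 * k)) * (qInt q (k + 1) * qInt q (m - k))

lemma star_normRatio (m : ℤ) (k : ℕ) :
    (starRingEnd ℂ) (normRatio q m k) = normRatio q m k := by
  rw [normRatio, map_mul, map_mul, star_qc_zpow, star_qInt, star_qInt]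

lemma Ki_E_F_highest {m : ℤ} {e : X.carrier} (he : e ∈ wt X m) (hE : op X .E e = 0) (k : ℕ) :
    op X .Ki (op X .E ((op X .F ^ (k + 1)) e)) = normRatio q m k • (op X .F ^ k) e := by
  rw [E_F_highest he hE, map_smul, wt_Ki (wt_F_pow he k), smul_smul, mul_comm]
  rfl

lemma inner_F_pow_highest {m : ℤ} {e : X.carrier} (he : e ∈ wt X m) (hE : op X .E e = 0)
    (k : ℕ) : ⟪(op X .F ^ (k + 1)) e, (op X .F ^ (k + 1)) e⟫_ℂ
      = normRatio q m k * ⟪(op X .F ^ k) e, (op X .F ^ k) e⟫_ℂ := by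
  conv_lhs => rw [← pow_succ_app _ k e]
  rw [inner_F, pow_succ_app, Ki_E_F_highest he hE, inner_smul_left, star_normRatio]

/-- The weight of a highest weight vector is a natural number `n`, and `n` is the largest exponent
of a power of `F` that does not annihilate the vector. -/
lemma exists_weight_highest (hX : admissible q X) {m : ℤ} {e : X.carrier} (he : e ∈ wt X m)
    (hE : op X .E e = 0) (h0 : e ≠ 0) :
    ∃ n : ℕ, m = n ∧ (∀ k ≤ n, (op X .F ^ k) e ≠ 0) ∧ (op X .F ^ (n + 1)) e = 0 := by
  obtain ⟨N, hN⟩ := nilpotent_F hX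
  have hex : ∃ k, (op X .F ^ k) e = 0 := ⟨N, by rw [hN]; rfl⟩
  classical
  obtain ⟨n, hn⟩ : ∃ n, Nat.find hex = n + 1 := Nat.exists_eq_succ_of_ne_zero fun h =>
    h0 (by simpa [h] using Nat.find_spec hex)
  have h1 : (op X .F ^ (n + 1)) e = 0 := hn ▸ Nat.find_spec hex
  have h2 : ∀ k ≤ n, (op X .F ^ k) e ≠ 0 := fun k hk => Nat.find_min hex (by omega)
  refine ⟨n, ?_, h2, h1⟩
  have h3 := E_F_highest he hE n
  rw [h1, map_zero, eq_comm, smul_eq_zero, mul_eq_zero] at h3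
  by_contra hm
  rcases h3 with (h3 | h3) | h3
  · exact qInt_ne_zero (by omega) h3
  · exact qInt_ne_zero (by omega) h3
  · exact h2 n le_rfl h3

/-- The map that sends `F^k e` to `F^k w`, and that vanishes on the orthogonal complement of the
vectors `F^k e`. -/
def highestMap {W : StarRep (Uq q)} (e : X.carrier) (w : W.carrier) (n : ℕ) :
    X.carrier →ₗ[ℂ] W.carrier :=
  ∑ k ∈ Finset.range (n + 1), (⟪(op X .F ^ k) e, (op X .F ^ k) e⟫_ℂ)⁻¹ •
    ((innerSL ℂ ((op X .F ^ k) e)).toLinearMap.smulRight ((op W .F ^ k) w))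

lemma highestMap_apply {W : StarRep (Uq q)} (e : X.carrier) (w : W.carrier) (n : ℕ)
    (x : X.carrier) : highestMap e w n x = ∑ k ∈ Finset.range (n + 1),
      ((⟪(op X .F ^ k) e, (op X .F ^ k) e⟫_ℂ)⁻¹ * ⟪(op X .F ^ k) e, x⟫_ℂ) • (op W .F ^ k) w := by
  rw [highestMap, LinearMap.sum_apply]
  refine Finset.sum_congr rfl fun k _ => ?_
  rw [mul_smul]
  rfl

section
variable {W : StarRep (Uq q)} {n : ℕ} {e : X.carrier} {w : W.carrier}
  (he : e ∈ wt X n) (hE : op X .E e = 0) (hF : (op X .F ^ (n + 1)) e = 0)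
  (h0 : ∀ k ≤ n, (op X .F ^ k) e ≠ 0)
  (hw : w ∈ wt W n) (hwE : op W .E w = 0) (hwF : (op W .F ^ (n + 1)) w = 0)

include he hE in
lemma highestMap_highest (h0' : e ≠ 0) : highestMap e w n e = w := by
  rw [highestMap_apply, Finset.sum_range_succ', Finset.sum_eq_zero, zero_add]
  · rw [pow_zero, pow_zero, Module.End.one_apply, Module.End.one_apply, inv_mul_cancel₀, one_smul]
    exact inner_self_ne_zero.2 h0'
  · intro k _
    have h : ⟪(op X .F ^ (k + 1)) e, e⟫_ℂ = 0 := by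
      rw [← inner_conj_symm, ← pow_succ_app, inner_F, hE, map_zero, inner_zero_left, map_zero]
    rw [h, mul_zero, zero_smul]

include he hw in
lemma highestMap_K : highestMap e w n ∘ₗ op X .K = op W .K ∘ₗ highestMap e w n := by
  ext x
  rw [LinearMap.comp_apply, LinearMap.comp_apply, highestMap_apply, highestMap_apply, map_sum]
  refine Finset.sum_congr rfl fun k _ => ?_
  rw [← inner_K, wt_K (wt_F_pow he k), map_smul, wt_K (wt_F_pow hw k), inner_smul_left,
    star_qc_zpow, smul_smul]
  congr 1
  ring

include he hE hF h0 hw hwE in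
lemma highestMap_E : highestMap e w n ∘ₗ op X .E = op W .E ∘ₗ highestMap e w n := by
  ext x
  rw [LinearMap.comp_apply, LinearMap.comp_apply, highestMap_apply, highestMap_apply, map_sum,
    Finset.sum_range_succ, Finset.sum_range_succ']
  have h1 : ∀ k : ℕ, ⟪(op X .F ^ k) e, op X .E x⟫_ℂ
      = qc q ^ ((n : ℤ) - 2 * k) * ⟪(op X .F ^ (k + 1)) e, x⟫_ℂ := fun k => by
    rw [inner_E, wt_K (wt_F_pow he k), map_smul, pow_succ_app, inner_smul_left, star_qc_zpow]
  rw [h1 n, hF, inner_zero_left, mul_zero, mul_zero, zero_smul, add_zero, map_smul, pow_zero,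
    pow_zero, Module.End.one_apply, Module.End.one_apply, hwE, smul_zero, add_zero]
  refine Finset.sum_congr rfl fun k hk => ?_
  rw [h1, map_smul, E_F_highest hw hwE, smul_smul]
  congr 1
  have h2 := inner_F_pow_highest he hE k
  have h3 := inner_self_ne_zero (𝕜 := ℂ).2 (h0 k (Finset.mem_range.1 hk).le)
  have h4 := inner_self_ne_zero (𝕜 := ℂ).2 (h0 (k + 1) (Finset.mem_range.1 hk))
  have h5 := zpow_ne_zero ((n : ℤ) - 2 * k) (qc_ne_zero q)
  rw [normRatio, zpow_neg] at h2
  generalize ⟪(op X .F ^ (k + 1)) e, x⟫_ℂ = y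
  generalize ⟪(op X .F ^ (k + 1)) e, (op X .F ^ (k + 1)) e⟫_ℂ = N' at *
  generalize ⟪(op X .F ^ k) e, (op X .F ^ k) e⟫_ℂ = N at *
  generalize qc q ^ ((n : ℤ) - 2 * k) = c at *
  generalize qInt q (k + 1) = a at *
  generalize qInt q ((n : ℤ) - k) = b at *
  field_simp at h2 ⊢
  rw [h2]

include he hE hF h0 hw hwE hwF in
lemma highestMap_F : highestMap e w n ∘ₗ op X .F = op W .F ∘ₗ highestMap e w n := by
  ext x
  rw [LinearMap.comp_apply, LinearMap.comp_apply, highestMap_apply, highestMap_apply, map_sum,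
    Finset.sum_range_succ', Finset.sum_range_succ]
  rw [map_smul, pow_succ_app, hwF, smul_zero, add_zero, inner_F, pow_zero, Module.End.one_apply,
    hE, map_zero, inner_zero_left, mul_zero, zero_smul, add_zero]
  refine Finset.sum_congr rfl fun k hk => ?_
  rw [inner_F, Ki_E_F_highest he hE, map_smul, pow_succ_app, inner_smul_left, star_normRatio]
  congr 1
  have h2 := inner_F_pow_highest he hE k
  have h3 := inner_self_ne_zero (𝕜 := ℂ).2 (h0 k (Finset.mem_range.1 hk).le)
  have h4 := inner_self_ne_zero (𝕜 := ℂ).2 (h0 (k + 1) (Finset.mem_range.1 hk))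
  rw [h2] at h4 ⊢
  field_simp [left_ne_zero_of_mul h4]

/-- A linear map that commutes with `K`, `E` and `F` is an intertwiner. -/
lemma comm_of_KEF {f : X.carrier →ₗ[ℂ] W.carrier} (hK : f ∘ₗ op X .K = op W .K ∘ₗ f)
    (hE : f ∘ₗ op X .E = op W .E ∘ₗ f) (hF : f ∘ₗ op X .F = op W .F ∘ₗ f) (a : Uq q) :
    f ∘ₗ X.π a = W.π a ∘ₗ f := by
  refine comm_of_gen (fun g => ?_) a
  cases g
  · exact hE
  · exact hF
  · exact hK
  · ext x
    have h1 : op W .Ki (op W .K (f (op X .Ki x))) = f (op X .Ki x) := by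
      rw [op_op, gKi_gK, map_one]; rfl
    have h2 : op X .K (op X .Ki x) = x := by
      rw [op_op, gK_gKi, map_one]; rfl
    have h3 := LinearMap.congr_fun hK (op X .Ki x)
    rw [LinearMap.comp_apply, LinearMap.comp_apply, h2] at h3
    rw [LinearMap.comp_apply, LinearMap.comp_apply, h3, h1]

end

end highest

/-- The tensor powers `V^{⊗ n}` of the fundamental representation. -/
def tpow (q : Set.Ioo (0 : ℝ) 1) : ℕ → RepUq q
  | 0 => 𝟙_ (RepUq q)
  | n + 1 => tpow q n ⊗ fund q

/-- The basis vectors of the fundamental representation. -/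
def fe (q : Set.Ioo (0 : ℝ) 1) (i : Fin 2) : (fundRep q).carrier :=
  (EuclideanSpace.single i 1 : EuclideanSpace ℂ (Fin 2))

lemma fund_ext {M : Type*} [AddCommGroup M] [Module ℂ M] {f g : (fundRep q).carrier →ₗ[ℂ] M}
    (h0 : f (fe q 0) = g (fe q 0)) (h1 : f (fe q 1) = g (fe q 1)) : f = g := by
  have hb : ∀ i, (EuclideanSpace.basisFun (Fin 2) ℂ).toBasis i = fe q i := fun i => by
    rw [OrthonormalBasis.coe_toBasis, EuclideanSpace.basisFun_apply, fe]
  refine (EuclideanSpace.basisFun (Fin 2) ℂ).toBasis.ext fun i => ?_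
  fin_cases i
  · exact (congrArg f (hb 0)).trans (h0.trans (congrArg g (hb 0)).symm)
  · exact (congrArg f (hb 1)).trans (h1.trans (congrArg g (hb 1)).symm)

lemma fund_op_apply (g : Gen) (i : Fin 2) :
    op (fundRep q) g (fe q i) = fundMat q g 0 i • fe q 0 + fundMat q g 1 i • fe q 1 := by
  refine PiLp.ext (x := op (fundRep q) g _) fun j => ?_
  refine (fundRep_op g _ j).trans ?_
  change _ = fundMat q g 0 i * (EuclideanSpace.single (0 : Fin 2) (1 : ℂ)) j +
    fundMat q g 1 i * (EuclideanSpace.single (1 : Fin 2) (1 : ℂ)) j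
  fin_cases i <;> fin_cases j <;> simp [fe]

lemma fund_K0 : op (fundRep q) .K (fe q 0) = qc q • fe q 0 := by
  rw [fund_op_apply]; simp [fundMat]
lemma fund_K1 : op (fundRep q) .K (fe q 1) = (qc q)⁻¹ • fe q 1 := by
  rw [fund_op_apply]; simp [fundMat]
lemma fund_Ki0 : op (fundRep q) .Ki (fe q 0) = (qc q)⁻¹ • fe q 0 := by
  rw [fund_op_apply]; simp [fundMat]
lemma fund_Ki1 : op (fundRep q) .Ki (fe q 1) = qc q • fe q 1 := by
  rw [fund_op_apply]; simp [fundMat]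
lemma fund_E0 : op (fundRep q) .E (fe q 0) = 0 := by
  rw [fund_op_apply]; simp [fundMat]
lemma fund_E1 : op (fundRep q) .E (fe q 1) = qpow q (1 / 2) • fe q 0 := by
  rw [fund_op_apply]; simp [fundMat]
lemma fund_F0 : op (fundRep q) .F (fe q 0) = qpow q (-1 / 2) • fe q 1 := by
  rw [fund_op_apply]; simp [fundMat]
lemma fund_F1 : op (fundRep q) .F (fe q 1) = 0 := by
  rw [fund_op_apply]; simp [fundMat]

lemma wt_fe0 : fe q 0 ∈ wt (fundRep q) 1 := by
  rw [mem_wt, zpow_one]; exact fund_K0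
lemma wt_fe1 : fe q 1 ∈ wt (fundRep q) (-1) := by
  rw [mem_wt, zpow_neg_one]; exact fund_K1

lemma fe_ne_zero (i : Fin 2) : fe q i ≠ 0 := by
  change (EuclideanSpace.single i 1 : EuclideanSpace ℂ (Fin 2)) ≠ 0
  simp

lemma exists_highest_tpow (n : ℕ) : ∃ e : (tpow q n).obj.carrier,
    e ≠ 0 ∧ e ∈ wt (tpow q n).obj n ∧ op (tpow q n).obj .E e = 0 := by
  induction n with
  | zero =>
    refine ⟨(1 : ℂ), one_ne_zero (α := ℂ), ?_, ?_⟩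
    · refine mem_wt (X := (tpow q 0).obj).2 ?_
      refine (StarRep.ofChar_π (counitStar (Uq q)) _ _).trans ?_
      change Bialgebra.counitAlgHom ℂ (Uq q) (gen q .K) * _ = _
      rw [counit_gen, Nat.cast_zero, zpow_zero]
      exact (one_mul (M := ℂ) 1).trans (one_smul ℂ (1 : ℂ)).symm
    · refine (StarRep.ofChar_π (counitStar (Uq q)) _ _).trans ?_
      change Bialgebra.counitAlgHom ℂ (Uq q) (gen q .E) * _ = _
      rw [counit_gen]
      exact zero_mul (M₀ := ℂ) _
  | succ n ih =>
    obtain ⟨e, h0, h1, h2⟩ := ih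
    refine ⟨pt (U := fundRep q) e (fe q 0), ?_, ?_, ?_⟩
    · intro h
      have h3 : ‖e‖ * ‖fe q 0‖ = 0 := by
        rw [← TensorProduct.norm_tmul (𝕜 := ℂ)]
        exact norm_eq_zero.2 h
      rcases mul_eq_zero.1 h3 with h3 | h3
      · exact h0 (norm_eq_zero.1 h3)
      · exact fe_ne_zero 0 (norm_eq_zero.1 h3)
    · have := wt_pt (U := fundRep q) h1 wt_fe0
      exact_mod_cast this
    · refine (tens_E (U := fundRep q) e (fe q 0)).trans ?_
      rw [h2, fund_E0, pt_zero_left, pt_zero_right, add_zero]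
      rfl

/-- Every representation in `Rep_q(su_2)` is spanned by the images of intertwiners from the tensor
powers of the fundamental representation. -/
theorem iSup_range_tpow (W : RepUq q) :
    ⨆ (n : ℕ) (f : tpow q n ⟶ W), LinearMap.range f.hom.lin = ⊤ := by
  set S : Submodule ℂ W.obj.carrier :=
    ⨆ (n : ℕ) (f : tpow q n ⟶ W), LinearMap.range f.hom.lin with hS
  have hf : ∀ n (f : tpow q n ⟶ W) x, f.hom.lin x ∈ S := fun n f x =>
    Submodule.mem_iSup_of_mem n (Submodule.mem_iSup_of_mem f ⟨x, rfl⟩)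
  have hSπ : ∀ a, S ≤ S.comap (W.obj.π a) := by
    intro a
    refine iSup_le fun n => iSup_le fun f => ?_
    rintro _ ⟨x, rfl⟩
    rw [Submodule.mem_comap, ← StarRep.comm_apply]
    exact hf n f _
  have hSo : ∀ a, ∀ y ∈ Sᗮ, W.obj.π a y ∈ Sᗮ := by
    intro a y hy
    rw [Submodule.mem_orthogonal] at hy ⊢
    intro s hs
    have := inner_π W.obj (star a) s y
    rw [star_star] at this
    rw [← this]
    exact hy _ (hSπ _ hs)
  have hno : ∀ y ∈ Sᗮ, ∀ m, y ∈ wt W.obj m → y = 0 := by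
    intro y hy m hm
    by_contra hy0
    -- a highest weight vector in the orthogonal complement
    obtain ⟨N, hN⟩ := nilpotent_E W.property
    have hex : ∃ k, (op W.obj .E ^ k) y = 0 := ⟨N, by rw [hN]; rfl⟩
    classical
    obtain ⟨k, hk⟩ : ∃ k, Nat.find hex = k + 1 := Nat.exists_eq_succ_of_ne_zero fun h =>
      hy0 (by simpa [h] using Nat.find_spec hex)
    have hw0 : (op W.obj .E ^ k) y ≠ 0 := Nat.find_min hex (by omega)
    have hwE : op W.obj .E ((op W.obj .E ^ k) y) = 0 := by
      rw [pow_succ_app, ← hk]; exact Nat.find_spec hex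
    have hw := wt_E_pow hm k
    have hwS : (op W.obj .E ^ k) y ∈ Sᗮ := by
      have : ∀ j, (op W.obj .E ^ j) y ∈ Sᗮ := fun j => by
        induction j with
        | zero => exact hy
        | succ j ih => rw [← pow_succ_app]; exact hSo _ _ ih
      exact this k
    obtain ⟨n, hn, _, hwF⟩ := exists_weight_highest W.property hw hwE hw0
    rw [hn] at hw
    obtain ⟨e, he0, he, heE⟩ := exists_highest_tpow (q := q) n
    obtain ⟨n', hn', h0, hF⟩ := exists_weight_highest (tpow q n).property he heE he0
    obtain rfl : n = n' := by exact_mod_cast hn'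
    set w := (op W.obj .E ^ k) y
    let f : tpow q n ⟶ W := ObjectProperty.homMk ⟨highestMap e w n,
      comm_of_KEF (highestMap_K he hw) (highestMap_E he heE hF h0 hw hwE)
        (highestMap_F he heE hF h0 hw hwE hwF)⟩
    have hwS' : w ∈ S := by
      have := hf n f e
      rwa [show f.hom.lin e = w from highestMap_highest he heE he0] at this
    exact hw0 ((Submodule.disjoint_def.1 S.orthogonal_disjoint) w hwS' hwS)
  rw [← Submodule.ker_mkQ S, LinearMap.ker_eq_top]
  refine ext_wt W.property fun m x hx => ?_
  rw [LinearMap.zero_apply, Submodule.mkQ_apply, Submodule.Quotient.mk_eq_zero]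
  -- the component of `x` in the orthogonal complement is again a weight vector
  obtain ⟨s, hs, y, hy, rfl⟩ := Submodule.exists_add_mem_mem_orthogonal (K := S) x
  have h1 : op W.obj .K y - qc q ^ m • y ∈ Sᗮ := Submodule.sub_mem _ (hSo _ _ hy)
    (Submodule.smul_mem _ _ hy)
  have h2 : op W.obj .K y - qc q ^ m • y ∈ S := by
    have h3 : op W.obj .K y - qc q ^ m • y = qc q ^ m • s - op W.obj .K s := by
      have := wt_K hx
      rw [map_add, smul_add] at this
      rw [sub_eq_sub_iff_add_eq_add, add_comm, this]
    rw [h3]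
    exact Submodule.sub_mem _ (Submodule.smul_mem _ _ hs) (hSπ _ hs)
  have h3 := (Submodule.disjoint_def.1 S.orthogonal_disjoint) _ h2 h1
  rw [hno y hy m (mem_wt.2 (sub_eq_zero.1 h3)), add_zero]
  exact hs

/-! ### Representations of the coideal -/

section coidealRep

/-- The generator `B_t` as an element of the coideal. -/
def btc (q : Set.Ioo (0 : ℝ) 1) (t : ℝ) : coideal q t :=
  ⟨Bt q t, StarAlgebra.self_mem_adjoin_singleton ℂ _⟩

lemma coact_btc : StarCoaction.coact (A := Uq q) (btc q t) = btc q t ⊗ₜ gen q .Ki +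
    1 ⊗ₜ (gen q .F - (qc q ^ 2)⁻¹ • (gen q .E * gen q .Ki)) := by
  apply inclTensor_injective
  refine (incl_coact _).trans ((comul_Bt t).trans ?_)
  exact (map_add _ _ _).symm

lemma star_Bt : star (Bt q t) = -Bt q t := by
  have h2 := pow_ne_zero 2 (qc_ne_zero q)
  rw [Bt, star_add, star_sub, star_smul, star_smul, star_mul, star_gen, star_gen, star_gen]
  simp only [starGen]
  rw [isRel_gen.Ki_E, star_inv₀, star_pow, star_qc, ← mul_assoc, isRel_gen.Ki_F, smul_mul_assoc,
    mul_assoc, gKi_gK, mul_one, smul_smul, inv_mul_cancel₀ h2, one_smul]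
  have h3 : star (Complex.I * (t : ℂ)) = -(Complex.I * t) := by
    change (starRingEnd ℂ) _ = _
    simp
  rw [h3, neg_smul]
  abel

/-- The action of `B_t`. -/
abbrev opB (X : StarRep (coideal q t)) : X.carrier →ₗ[ℂ] X.carrier := X.π (btc q t)

lemma star_btc : star (btc q t) = -btc q t := Subtype.ext star_Bt

/-- A linear map that commutes with `B_t` is an intertwiner: the coideal is generated by `B_t` as
an algebra, as `B_t` is skew-adjoint. -/
lemma comm_of_opB {X Y : StarRep (coideal q t)} {f : X.carrier →ₗ[ℂ] Y.carrier}
    (h : f ∘ₗ opB X = opB Y ∘ₗ f) (a : coideal q t) : f ∘ₗ X.π a = Y.π a ∘ₗ f := by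
  obtain ⟨a, ha⟩ := a
  have ha' : a ∈ Algebra.adjoin ℂ ({Bt q t} ∪ star {Bt q t}) := by
    rw [← StarAlgebra.adjoin_toSubalgebra]; exact ha
  suffices ∃ hb : a ∈ coideal q t, f ∘ₗ X.π ⟨a, hb⟩ = Y.π ⟨a, hb⟩ ∘ₗ f from this.2
  induction ha' using Algebra.adjoin_induction with
  | mem x hx =>
    rcases hx with hx | hx
    · obtain rfl : x = Bt q t := hx
      exact ⟨(btc q t).2, h⟩
    · have hx' : star x = Bt q t := hx
      obtain rfl : x = -Bt q t := by rw [← star_star x, hx', star_Bt]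
      refine ⟨(-btc q t).2, ?_⟩
      change f ∘ₗ X.π (-btc q t) = Y.π (-btc q t) ∘ₗ f
      rw [map_neg, map_neg, LinearMap.comp_neg, LinearMap.neg_comp, h]
  | algebraMap r =>
    refine ⟨(algebraMap ℂ (coideal q t) r).2, ?_⟩
    change f ∘ₗ X.π (algebraMap ℂ (coideal q t) r) = Y.π (algebraMap ℂ (coideal q t) r) ∘ₗ f
    rw [AlgHomClass.commutes, AlgHomClass.commutes]
    ext y
    exact f.map_smul r y
  | add x y hx hy hx' hy' =>
    obtain ⟨h1, h2⟩ := hx' (by rw [← StarAlgebra.adjoin_toSubalgebra] at hx; exact hx)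
    obtain ⟨h3, h4⟩ := hy' (by rw [← StarAlgebra.adjoin_toSubalgebra] at hy; exact hy)
    refine ⟨add_mem h1 h3, ?_⟩
    change f ∘ₗ X.π (⟨x, h1⟩ + ⟨y, h3⟩) = Y.π (⟨x, h1⟩ + ⟨y, h3⟩) ∘ₗ f
    rw [map_add, map_add, LinearMap.comp_add, LinearMap.add_comp, h2, h4]
  | mul x y hx hy hx' hy' =>
    obtain ⟨h1, h2⟩ := hx' (by rw [← StarAlgebra.adjoin_toSubalgebra] at hx; exact hx)
    obtain ⟨h3, h4⟩ := hy' (by rw [← StarAlgebra.adjoin_toSubalgebra] at hy; exact hy)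
    refine ⟨mul_mem h1 h3, ?_⟩
    change f ∘ₗ X.π (⟨x, h1⟩ * ⟨y, h3⟩) = Y.π (⟨x, h1⟩ * ⟨y, h3⟩) ∘ₗ f
    rw [map_mul, map_mul]
    change (f ∘ₗ X.π ⟨x, h1⟩) ∘ₗ X.π ⟨y, h3⟩ = _
    rw [h2, LinearMap.comp_assoc, h4]
    rfl

/-- The symmetric operator `-i B_t`. -/
def opA (X : StarRep (coideal q t)) : X.carrier →ₗ[ℂ] X.carrier := (-Complex.I) • opB X

lemma symm_opA (X : StarRep (coideal q t)) : (opA X).IsSymmetric := by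
  intro x y
  have h : X.π (-btc q t) y = -opB X y := by rw [map_neg]; rfl
  rw [opA, LinearMap.smul_apply, LinearMap.smul_apply, inner_smul_left, inner_smul_right, inner_π,
    star_btc, h, inner_neg_right]
  simp

lemma opB_of_opA {X : StarRep (coideal q t)} {x : X.carrier} {r : ℂ} (h : opA X x = r • x) :
    opB X x = (Complex.I * r) • x := by
  rw [mul_smul, ← h, opA, LinearMap.smul_apply, smul_smul]
  simp

lemma opA_of_opB {X : StarRep (coideal q t)} {x : X.carrier} {r : ℂ}
    (h : opB X x = (Complex.I * r) • x) : opA X x = r • x := by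
  rw [opA, LinearMap.smul_apply, h, smul_smul, ← mul_assoc]
  simp

/-- Pure tensors in `X ⊙ U`, as a bilinear map. -/
def ptB (X : StarRep (coideal q t)) (U : StarRep (Uq q)) :
    X.carrier →ₗ[ℂ] U.carrier →ₗ[ℂ] (X.tens U).carrier :=
  TensorProduct.mk ℂ X.carrier U.carrier

/-- The action of `F - q⁻² E K⁻¹`. -/
def opJ (U : StarRep (Uq q)) : U.carrier →ₗ[ℂ] U.carrier :=
  op U .F - (qc q ^ 2)⁻¹ • (op U .E ∘ₗ op U .Ki)

lemma opB_tens (X : StarRep (coideal q t)) (U : StarRep (Uq q)) (x : X.carrier) (u : U.carrier) :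
    opB (X.tens U) (ptB X U x u) = ptB X U (opB X x) (op U .Ki u) + ptB X U x (opJ U u) := by
  have h1 : U.π (gen q .F - (qc q ^ 2)⁻¹ • (gen q .E * gen q .Ki)) = opJ U := by
    rw [map_sub, map_smul, map_mul]; rfl
  rw [opB, StarRep.tens_π, coact_btc, map_add]
  change ptB X U (opB X x) (op U .Ki u) + ptB X U (X.π 1 x) (U.π _ u) = _
  rw [map_one, h1]
  rfl

lemma ptB_ext {X : StarRep (coideal q t)} {U : StarRep (Uq q)} {M : Type*} [AddCommGroup M]
    [Module ℂ M] {f g : (X.tens U).carrier →ₗ[ℂ] M}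
    (h : ∀ x u, f (ptB X U x u) = g (ptB X U x u)) : f = g := TensorProduct.ext' h

lemma fund_J0 : opJ (fundRep q) (fe q 0) = qpow q (-1 / 2) • fe q 1 := by
  rw [opJ, LinearMap.sub_apply, LinearMap.smul_apply, LinearMap.comp_apply, fund_Ki0, map_smul,
    fund_E0, fund_F0, smul_zero, smul_zero, sub_zero]

lemma fund_J1 : opJ (fundRep q) (fe q 1) = -qpow q (-1 / 2) • fe q 0 := by
  rw [opJ, LinearMap.sub_apply, LinearMap.smul_apply, LinearMap.comp_apply, fund_Ki1, map_smul,
    fund_E1, fund_F1, zero_sub, smul_smul, smul_smul, neg_smul]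
  congr 2
  rw [qpow_shift (s := -1 / 2) (s' := 1 / 2) 1 (by norm_num), zpow_one]
  have := qc_ne_zero q
  field_simp

end coidealRep

/-! ### The twist -/

section twist

/-- The eigenvalue of `-i B_t` on a vector with parameter `s`: the number
`q^{-1/2} (q^{-s} - q^s) / (q⁻¹ - q)`. -/
def tval (q : Set.Ioo (0 : ℝ) 1) (s : ℝ) : ℝ :=
  (q : ℝ) ^ (-(1 / 2) : ℝ) * (((q : ℝ) ^ (-s) - (q : ℝ) ^ s) / ((q : ℝ)⁻¹ - q))

lemma lam_tval (s : ℝ) : lam q (tval q s) = s :=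
  (existsUnique_lam q (tval q s)).unique (lam_spec q (tval q s)) rfl

lemma tval_lam (r : ℝ) : tval q (lam q r) = r := (lam_spec q r).symm

lemma tval_eq (s : ℝ) : (tval q s : ℂ) =
    qpow q (-1 / 2) * ((qpow q (-s) - qpow q s) / ((qc q)⁻¹ - qc q)) := by
  rw [tval, show (-(1 / 2) : ℝ) = -1 / 2 by norm_num]
  simp only [Complex.ofReal_mul, Complex.ofReal_div, Complex.ofReal_sub, Complex.ofReal_inv]
  rfl

lemma qpow_ne_zero (s : ℝ) : qpow q s ≠ 0 := by
  intro h
  have := qpow_add (q := q) s (-s)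
  rw [add_neg_cancel, qpow_zero, h, zero_mul] at this
  exact one_ne_zero this

lemma qpow_neg (s : ℝ) : qpow q (-s) = (qpow q s)⁻¹ := by
  refine eq_inv_of_mul_eq_one_left ?_
  rw [← qpow_add, neg_add_cancel, qpow_zero]

lemma qpow_one : qpow q 1 = qc q := by
  have := qpow_int (q := q) 1
  simpa using this

lemma tval_add_one (s : ℝ) : (tval q (s + 1) : ℂ) - qc q * tval q s =
    qpow q (-s) * qpow q (-1 / 2) := by
  have h0 := qc_ne_zero q
  have h1 := qc_sub_ne' (q := q)
  have h2 := qpow_ne_zero (q := q) s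
  rw [tval_eq, tval_eq, neg_add, qpow_add, qpow_add, qpow_neg 1, qpow_one, qpow_neg s]
  generalize qpow q s = a at *
  have h3 : (qc q)⁻¹ - qc q = (1 - qc q ^ 2) / qc q := by field_simp
  rw [h3] at h1 ⊢
  have h4 : 1 - qc q ^ 2 ≠ 0 := fun h => h1 (by rw [h, zero_div])
  field_simp
  ring

lemma tval_sub_one (s : ℝ) : (tval q (s - 1) : ℂ) - qc q * tval q s =
    -(qpow q s * qpow q (-1 / 2)) := by
  have h0 := qc_ne_zero q
  have h1 := qc_sub_ne' (q := q)
  have h2 := qpow_ne_zero (q := q) s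
  rw [tval_eq, tval_eq, show -(s - 1) = -s + 1 by ring, show s - 1 = s + -1 by ring, qpow_add,
    qpow_add, qpow_neg 1, qpow_one, qpow_neg s]
  generalize qpow q s = a at *
  have h3 : (qc q)⁻¹ - qc q = (1 - qc q ^ 2) / qc q := by field_simp
  rw [h3] at h1 ⊢
  have h4 : 1 - qc q ^ 2 ≠ 0 := fun h => h1 (by rw [h, zero_div])
  field_simp
  ring

/-- The eigenvalue of the twist on an eigenvector of `-i B_t` with parameter `s`: the number
`e^{iπs/2} q^{-s²/2}`. -/
def twistFun (q : Set.Ioo (0 : ℝ) 1) (z : ℂ) : ℂ :=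
  Complex.exp (Complex.I * (Real.pi / 2) * lam q z.re) * qpow q (-(lam q z.re ^ 2) / 2)

lemma twistFun_ne_zero (z : ℂ) : twistFun q z ≠ 0 :=
  mul_ne_zero (Complex.exp_ne_zero _) (qpow_ne_zero _)

lemma exp_I_pi_div_two : Complex.exp (Complex.I * (Real.pi / 2)) = Complex.I := by
  rw [mul_comm, Complex.exp_pi_div_two_mul_I]

lemma twistFun_add_one (s : ℝ) : twistFun q (tval q (s + 1)) =
    Complex.I * ((tval q (s + 1) : ℂ) - qc q * tval q s) * twistFun q (tval q s) := by
  rw [tval_add_one, twistFun, twistFun, Complex.ofReal_re, Complex.ofReal_re, lam_tval, lam_tval,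
    show -((s + 1) ^ 2) / 2 = -s + -1 / 2 + -(s ^ 2) / 2 by ring, qpow_add, qpow_add,
    Complex.ofReal_add, mul_add, Complex.exp_add, Complex.ofReal_one, mul_one, exp_I_pi_div_two]
  ring

lemma twistFun_sub_one (s : ℝ) : twistFun q (tval q (s - 1)) =
    Complex.I * ((tval q (s - 1) : ℂ) - qc q * tval q s) * twistFun q (tval q s) := by
  rw [tval_sub_one, twistFun, twistFun, Complex.ofReal_re, Complex.ofReal_re, lam_tval, lam_tval,
    show -((s - 1) ^ 2) / 2 = s + -1 / 2 + -(s ^ 2) / 2 by ring, qpow_add, qpow_add,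
    Complex.ofReal_sub, mul_sub, Complex.exp_sub, Complex.ofReal_one, mul_one, exp_I_pi_div_two,
    Complex.div_I]
  ring

/-- The twist: the automorphism of the identity functor that multiplies the eigenvectors of
`-i B_t` with parameter `s` by `e^{iπs/2} q^{-s²/2}`. -/
def tw (X : StarRep (coideal q t)) : X ≅ X :=
  StarRep.mkIso (LinearEquiv.ofLinearMap (fcal (opA X) (twistFun q))
      (fcal (opA X) fun z => (twistFun q z)⁻¹)
      (fcal_mul (symm_opA X) fun z => mul_inv_cancel₀ (twistFun_ne_zero z))
      (fcal_mul (symm_opA X) fun z => inv_mul_cancel₀ (twistFun_ne_zero z)))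
    (comm_of_opB (fcal_comm (symm_opA X) (symm_opA X)
      (by rw [opA, LinearMap.comp_smul, LinearMap.smul_comp]) _).symm)

end twist

lemma tw_natural {X Y : StarRep (coideal q t)} (f : X ⟶ Y) :
    f ≫ (tw Y).hom = (tw X).hom ≫ f := by
  ext1
  refine (fcal_comm (symm_opA X) (symm_opA Y) ?_ _).symm
  rw [opA, opA, LinearMap.comp_smul, LinearMap.smul_comp, f.comm]

lemma tw_hom_apply {X : StarRep (coideal q t)} {x : X.carrier} {s : ℝ}
    (hx : opB X x = (Complex.I * tval q s) • x) :
    (tw X).hom.lin x = twistFun q (tval q s) • x :=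
  fcal_apply (symm_opA X) _ (opA_of_opB hx)

lemma tw_inv_apply {X : StarRep (coideal q t)} {x : X.carrier} {s : ℝ}
    (hx : opB X x = (Complex.I * tval q s) • x) :
    (tw X).inv.lin x = (twistFun q (tval q s))⁻¹ • x :=
  fcal_apply (symm_opA X) _ (opA_of_opB hx)

/-- The twist, restricted to the module category generated by `ε`. -/
def twE (X : RepEps q t) : X ≅ X := ObjectProperty.isoMk _ (tw X.obj)

lemma twE_natural {X Y : RepEps q t} (f : X ⟶ Y) : f ≫ (twE Y).hom = (twE X).hom ≫ f := by
  ext1; exact tw_natural f.hom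

/-- The sum of the eigenvalues of `B_t` on `x ⊗ V`. -/
lemma tval_add_tval (s : ℝ) : (tval q (s + 1) : ℂ) + tval q (s - 1) =
    (qc q + (qc q)⁻¹) * tval q s := by
  have h0 := qc_ne_zero q
  have h1 := qc_sub_ne' (q := q)
  have h2 := qpow_ne_zero (q := q) s
  have e1 := tval_add_one (q := q) s
  have e2 := tval_sub_one (q := q) s
  have e3 := tval_eq (q := q) s
  have e4 : ((qc q)⁻¹ - qc q) * tval q s = qpow q (-1 / 2) * (qpow q (-s) - qpow q s) := by
    rw [e3, mul_comm, mul_assoc, div_mul_cancel₀ _ h1]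
  linear_combination e1 + e2 - e4

lemma tval_mul_tval (s : ℝ) : (tval q (s + 1) : ℂ) * tval q (s - 1) =
    tval q s ^ 2 - (qc q)⁻¹ := by
  have h0 := qc_ne_zero q
  have e1 := tval_add_one (q := q) s
  have e2 := tval_sub_one (q := q) s
  have e3 := tval_add_tval (q := q) s
  have e4 : qpow q (-s) * qpow q (-1 / 2) * (qpow q s * qpow q (-1 / 2)) = (qc q)⁻¹ := by
    rw [mul_mul_mul_comm, ← qpow_add, ← qpow_add, neg_add_cancel, qpow_zero, one_mul,
      show (-1 / 2 : ℝ) + -1 / 2 = -1 by norm_num, qpow_neg, qpow_one]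
  rw [← e4]
  have e5 : qpow q (-s) * qpow q (-1 / 2) = (tval q (s + 1) : ℂ) - qc q * tval q s := e1.symm
  have e6 : qpow q s * qpow q (-1 / 2) = -((tval q (s - 1) : ℂ) - qc q * tval q s) := by
    rw [e2, neg_neg]
  rw [e5, e6]
  have e7 : (qc q)⁻¹ * qc q = 1 := inv_mul_cancel₀ h0
  linear_combination (qc q * tval q s) * e3 + tval q s ^ 2 * e7

lemma tval_ne (s : ℝ) : (tval q (s + 1) : ℂ) - tval q (s - 1) ≠ 0 := by
  intro h
  have h1 : tval q (s + 1) = tval q (s - 1) := by exact_mod_cast sub_eq_zero.1 h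
  have h2 := congrArg (lam q) h1
  rw [lam_tval, lam_tval] at h2
  linarith

/-- The characteristic equation of `B_t` on `x ⊗ V`. -/
lemma opB_opB_fund {X : StarRep (coideal q t)} {x : X.carrier} {b : ℂ} (hx : opB X x = b • x)
    (v : (fundRep q).carrier) :
    opB (X.tens (fundRep q)) (opB (X.tens (fundRep q)) (ptB X _ x v)) =
      ((qc q + (qc q)⁻¹) * b) • opB (X.tens (fundRep q)) (ptB X _ x v) -
        (b ^ 2 + (qc q)⁻¹) • ptB X _ x v := by
  have h0 := qc_ne_zero q
  have hq : qpow q (-1 / 2) * qpow q (-1 / 2) = (qc q)⁻¹ := by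
    rw [← qpow_add, show (-1 / 2 : ℝ) + -1 / 2 = -1 by norm_num, qpow_neg, qpow_one]
  have e7 : qc q * (qc q)⁻¹ = 1 := mul_inv_cancel₀ h0
  suffices h : (opB (X.tens (fundRep q)) ∘ₗ opB (X.tens (fundRep q))) ∘ₗ ptB X _ x =
      ((qc q + (qc q)⁻¹) * b) • opB (X.tens (fundRep q)) ∘ₗ ptB X _ x -
        (b ^ 2 + (qc q)⁻¹) • ptB X _ x from LinearMap.congr_fun h v
  apply fund_ext
  · simp only [LinearMap.comp_apply, LinearMap.sub_apply, LinearMap.smul_apply, opB_tens, hx,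
      fund_Ki0, fund_J0, fund_Ki1, fund_J1, map_smul, map_add, smul_add, smul_smul]
    match_scalars
    all_goals first | ring1 | linear_combination -hq - b ^ 2 * e7
  · simp only [LinearMap.comp_apply, LinearMap.sub_apply, LinearMap.smul_apply, opB_tens, hx,
      fund_Ki0, fund_J0, fund_Ki1, fund_J1, map_smul, map_add, smul_add, smul_smul]
    match_scalars
    all_goals first | ring1 | linear_combination -hq - b ^ 2 * e7

/-- The linear map `f ⊗ 1`. -/
def leftOp {X Y : StarRep (coideal q t)} (U : StarRep (Uq q)) (f : X.carrier →ₗ[ℂ] Y.carrier) :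
    (X.tens U).carrier →ₗ[ℂ] (Y.tens U).carrier := StarRep.boxMap f LinearMap.id

lemma leftOp_pt {X Y : StarRep (coideal q t)} (U : StarRep (Uq q))
    (f : X.carrier →ₗ[ℂ] Y.carrier) (x : X.carrier) (u : U.carrier) :
    leftOp U f (ptB X U x u) = ptB Y U (f x) u := rfl

/-- On `X ⊙ V`, the operator `τ_{X ⊙ V} (τ_X ⊗ 1)⁻¹` is `B_{X ⊙ V} - q B_X ⊗ 1`: both multiply the
two eigenvectors in `x ⊗ V` by the same numbers. -/
lemma tw_fund (X : StarRep (coideal q t)) :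
    (tw (X.tens (fundRep q))).hom.lin ∘ₗ leftOp (fundRep q) (tw X).inv.lin =
      opB (X.tens (fundRep q)) - qc q • leftOp (fundRep q) (opB X) := by
  have key : (ptB X (fundRep q)).compr₂
      ((tw (X.tens (fundRep q))).hom.lin ∘ₗ leftOp (fundRep q) (tw X).inv.lin) =
      (ptB X (fundRep q)).compr₂
        (opB (X.tens (fundRep q)) - qc q • leftOp (fundRep q) (opB X)) := by
    refine ext_eigen (symm_opA X) fun r x hx => LinearMap.ext fun v => ?_
    obtain ⟨s, rfl⟩ : ∃ s, tval q s = r := ⟨_, tval_lam r⟩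
    have hx' := opB_of_opA hx
    set B := opB (X.tens (fundRep q)) with hB
    set z := ptB X (fundRep q) x v with hz
    have h2 : B (B z) = ((Complex.I * tval q (s + 1)) + Complex.I * tval q (s - 1)) • B z -
        ((Complex.I * tval q (s + 1)) * (Complex.I * tval q (s - 1))) • z := by
      rw [hz, opB_opB_fund hx' v]
      congr 2
      · rw [← mul_add, tval_add_tval]; ring
      · rw [mul_mul_mul_comm, tval_mul_tval, mul_pow, Complex.I_sq, Complex.I_mul_I]; ring
    have hne := mul_ne_zero Complex.I_ne_zero (tval_ne (q := q) s)
    set a := Complex.I * (tval q (s + 1) : ℂ) with ha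
    set b := Complex.I * (tval q (s - 1) : ℂ) with hb
    rw [mul_sub, ← ha, ← hb] at hne
    -- the components of `x ⊗ v` in the two eigenspaces
    set z₁ := (a - b)⁻¹ • (B z - b • z) with hz₁
    set z₂ := (a - b)⁻¹ • (a • z - B z) with hz₂
    have hz12 : z = z₁ + z₂ := by
      rw [hz₁, hz₂, ← smul_add, sub_add_sub_comm, add_comm (B z), add_sub_add_right_eq_sub,
        ← sub_smul, smul_smul, inv_mul_cancel₀ hne, one_smul]
    have h3 : B z₁ = a • z₁ := by
      rw [hz₁, map_smul, map_sub, map_smul, h2]; module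
    have h4 : B z₂ = b • z₂ := by
      rw [hz₂, map_smul, map_sub, map_smul, h2]; module
    have hL : leftOp (fundRep q) (tw X).inv.lin z = (twistFun q (tval q s))⁻¹ • z := by
      rw [hz, leftOp_pt, tw_inv_apply hx', map_smul, LinearMap.smul_apply]
    have hR : leftOp (fundRep q) (opB X) z = (Complex.I * tval q s) • z := by
      rw [hz, leftOp_pt, hx', map_smul, LinearMap.smul_apply]
    change (tw _).hom.lin (leftOp (fundRep q) (tw X).inv.lin z) =
      B z - qc q • leftOp (fundRep q) (opB X) z
    clear_value z₁ z₂
    have hg := twistFun_ne_zero (q := q) (tval q s)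
    rw [hL, hR, map_smul, hz12, map_add, map_add, h3, h4, tw_hom_apply h3, tw_hom_apply h4,
      twistFun_add_one, twistFun_sub_one, smul_add, smul_smul, smul_smul, mul_comm _ (twistFun q _),
      mul_comm _ (twistFun q _), inv_mul_cancel_left₀ hg, inv_mul_cancel_left₀ hg, ha, hb]
    module
  exact ptB_ext fun x v => LinearMap.congr_fun (LinearMap.congr_fun key x) v

/-! ### The braiding with the fundamental representation -/

section braidFund

variable {U : StarRep (Uq q)}

lemma rc_one : rc q 1 = (qc q)⁻¹ - qc q := by
  rw [rc, Finset.prod_range_one, Nat.cast_zero, neg_zero, zpow_zero, zero_add, qInt_one, mul_one,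
    div_one]

lemma fund_F_pow (k : ℕ) (i : Fin 2) : (op (fundRep q) .F ^ (k + 2)) (fe q i) = 0 := by
  have h : op (fundRep q) .F (op (fundRep q) .F (fe q i)) = 0 := by
    fin_cases i
    · exact (congrArg _ fund_F0).trans (by rw [map_smul, fund_F1, smul_zero])
    · exact (congrArg _ fund_F1).trans (map_zero _)
  rw [pow_add, pow_two]
  exact (congrArg (op (fundRep q) .F ^ k) h).trans (map_zero _)

lemma fund_E_pow (k : ℕ) (i : Fin 2) : (op (fundRep q) .E ^ (k + 2)) (fe q i) = 0 := by
  have h : op (fundRep q) .E (op (fundRep q) .E (fe q i)) = 0 := by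
    fin_cases i
    · exact (congrArg _ fund_E0).trans (map_zero _)
    · exact (congrArg _ fund_E1).trans (by rw [map_smul, fund_E0, smul_zero])
  rw [pow_add, pow_two]
  exact (congrArg (op (fundRep q) .E ^ k) h).trans (map_zero _)

lemma braid_to_fund (hU : admissible q U) {m n : ℤ} {u : U.carrier} (hu : u ∈ wt U m) {i : Fin 2}
    (hi : fe q i ∈ wt (fundRep q) n) :
    braidLin U (fundRep q) (pt u (fe q i)) = qpow q (-((m : ℝ) * n) / 2) •
      (pt (fe q i) u + ((qc q)⁻¹ - qc q) • pt (op (fundRep q) .F (fe q i)) (op U .E u)) := by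
  rw [braidLin_pt hU (N := nilpotencyClass (op U .E) + 2) (by omega) hu hi,
    Finset.sum_range_succ', Finset.sum_range_succ', Finset.sum_eq_zero]
  · rw [rc_zero, zero_add, rc_one, zero_add, pow_one, pow_one, pow_zero, pow_zero, one_smul,
      add_comm]
    rfl
  · intro k _
    rw [fund_F_pow, pt_zero_left, smul_zero]

lemma braid_from_fund {m n : ℤ} {u : U.carrier} (hu : u ∈ wt U m) {i : Fin 2}
    (hi : fe q i ∈ wt (fundRep q) n) :
    braidLin (fundRep q) U (pt (fe q i) u) = qpow q (-((n : ℝ) * m) / 2) •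
      (pt u (fe q i) + ((qc q)⁻¹ - qc q) • pt (op U .F u) (op (fundRep q) .E (fe q i))) := by
  rw [braidLin_pt admissible_fundRep (N := nilpotencyClass (op (fundRep q) .E) + 2) (by omega)
      hi hu, Finset.sum_range_succ', Finset.sum_range_succ', Finset.sum_eq_zero]
  · rw [rc_zero, zero_add, rc_one, zero_add, pow_one, pow_one, pow_zero, pow_zero, one_smul,
      add_comm]
    rfl
  · intro k _
    rw [fund_E_pow, pt_zero_right, smul_zero]

lemma braid_to_fund0 (hU : admissible q U) {m : ℤ} {u : U.carrier} (hu : u ∈ wt U m) :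
    braidLin U (fundRep q) (pt u (fe q 0)) = qpow q (-(m : ℝ) / 2) • pt (fe q 0) u +
      (qpow q (-(m : ℝ) / 2) * ((qc q)⁻¹ - qc q) * qpow q (-1 / 2)) •
        pt (fe q 1) (op U .E u) := by
  rw [braid_to_fund hU hu wt_fe0, fund_F0, pt_smul_left, smul_add, smul_smul, smul_smul,
    Int.cast_one, mul_one, mul_assoc]

lemma braid_to_fund1 (hU : admissible q U) {m : ℤ} {u : U.carrier} (hu : u ∈ wt U m) :
    braidLin U (fundRep q) (pt u (fe q 1)) = qpow q ((m : ℝ) / 2) • pt (fe q 1) u := by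
  rw [braid_to_fund hU hu wt_fe1, fund_F1, pt_zero_left, smul_zero, add_zero]
  congr 2
  push_cast
  ring

lemma braid_from_fund0 {m : ℤ} {u : U.carrier} (hu : u ∈ wt U m) :
    braidLin (fundRep q) U (pt (fe q 0) u) = qpow q (-(m : ℝ) / 2) • pt u (fe q 0) := by
  rw [braid_from_fund hu wt_fe0, fund_E0, pt_zero_right, smul_zero, add_zero, Int.cast_one,
    one_mul]

lemma braid_from_fund1 {m : ℤ} {u : U.carrier} (hu : u ∈ wt U m) :
    braidLin (fundRep q) U (pt (fe q 1) u) = qpow q ((m : ℝ) / 2) • pt u (fe q 1) +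
      (qpow q ((m : ℝ) / 2) * ((qc q)⁻¹ - qc q) * qpow q (1 / 2)) •
        pt (op U .F u) (fe q 0) := by
  rw [braid_from_fund hu wt_fe1, fund_E1, pt_smul_right, smul_add, smul_smul, smul_smul,
    show -(((-1 : ℤ) : ℝ) * m) / 2 = (m : ℝ) / 2 by push_cast; ring, mul_assoc]

end braidFund

/-! ### The octagon equation -/

/-- The associator of the underlying vector spaces. -/
def assocB (X : StarRep (coideal q t)) (U W : StarRep (Uq q)) :
    ((X.tens U).tens W).carrier ≃ₗ[ℂ] (X.tens (U.tens W)).carrier := StarRep.boxAssoc X U W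

/-- The linear map `1 ⊗ f`. -/
def rightOp (X : StarRep (coideal q t)) {U U' : StarRep (Uq q)} (f : U.carrier →ₗ[ℂ] U'.carrier) :
    (X.tens U).carrier →ₗ[ℂ] (X.tens U').carrier := StarRep.boxMap LinearMap.id f

lemma rightOp_pt (X : StarRep (coideal q t)) {U U' : StarRep (Uq q)}
    (f : U.carrier →ₗ[ℂ] U'.carrier) (x : X.carrier) (u : U.carrier) :
    rightOp X f (ptB X U x u) = ptB X U' x (f u) := rfl

/-- The linear map `1 ⊗ ΣR`, for the other bracketing of the tensor products. -/
def swapL (X : StarRep (coideal q t)) (U W : StarRep (Uq q)) :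
    ((X.tens U).tens W).carrier →ₗ[ℂ] ((X.tens W).tens U).carrier :=
  (assocB X W U).symm.toLinearMap ∘ₗ rightOp X (braidLin U W) ∘ₗ (assocB X U W).toLinearMap

/-- The vector `(x ⊗ u) ⊗ w` as a linear function of `u ⊗ w`. -/
def ins (X : StarRep (coideal q t)) (U W : StarRep (Uq q)) (x : X.carrier) :
    (U.tens W).carrier →ₗ[ℂ] ((X.tens U).tens W).carrier :=
  (assocB X U W).symm.toLinearMap ∘ₗ ptB X (U.tens W) x

lemma ins_pt (X : StarRep (coideal q t)) (U W : StarRep (Uq q)) (x : X.carrier) (u : U.carrier)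
    (w : W.carrier) : ins X U W x (pt u w) = ptB (X.tens U) W (ptB X U x u) w := rfl

lemma ins_ext {X : StarRep (coideal q t)} {U W : StarRep (Uq q)} {M : Type*} [AddCommGroup M]
    [Module ℂ M] {f g : ((X.tens U).tens W).carrier →ₗ[ℂ] M}
    (h : ∀ x, f ∘ₗ ins X U W x = g ∘ₗ ins X U W x) : f = g :=
  TensorProduct.ext_threefold fun x u w => LinearMap.congr_fun (h x) (pt u w)

lemma swapL_ins (X : StarRep (coideal q t)) (U W : StarRep (Uq q)) (x : X.carrier)
    (z : (U.tens W).carrier) : swapL X U W (ins X U W x z) = ins X W U x (braidLin U W z) := by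
  change (assocB X W U).symm (rightOp X (braidLin U W) (assocB X U W ((assocB X U W).symm
    (ptB X (U.tens W) x z)))) = _
  rw [LinearEquiv.apply_symm_apply, rightOp_pt]
  rfl

/-- The operator `B_{X ⊙ V} - q B_X ⊗ 1` on the vectors `x ⊗ v`. -/
def fundBraid (X : StarRep (coideal q t)) :
    (X.tens (fundRep q)).carrier →ₗ[ℂ] (X.tens (fundRep q)).carrier :=
  opB (X.tens (fundRep q)) - qc q • leftOp (fundRep q) (opB X)

lemma fundBraid0 (X : StarRep (coideal q t)) (x : X.carrier) :
    fundBraid X (ptB X _ x (fe q 0)) = ((qc q)⁻¹ - qc q) • ptB X _ (opB X x) (fe q 0) +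
      qpow q (-1 / 2) • ptB X _ x (fe q 1) := by
  rw [fundBraid, LinearMap.sub_apply, LinearMap.smul_apply, opB_tens, leftOp_pt, fund_Ki0,
    fund_J0, map_smul, map_smul]
  module

lemma fundBraid1 (X : StarRep (coideal q t)) (x : X.carrier) :
    fundBraid X (ptB X _ x (fe q 1)) = -qpow q (-1 / 2) • ptB X _ x (fe q 0) := by
  rw [fundBraid, LinearMap.sub_apply, LinearMap.smul_apply, opB_tens, leftOp_pt, fund_Ki1,
    fund_J1, map_smul, map_smul]
  module

lemma leftOp_fundBraid0 (X : StarRep (coideal q t)) (U : StarRep (Uq q)) (x : X.carrier)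
    (u : U.carrier) : leftOp U (fundBraid X) (ins X (fundRep q) U x (pt (fe q 0) u)) =
      ((qc q)⁻¹ - qc q) • ins X (fundRep q) U (opB X x) (pt (fe q 0) u) +
        qpow q (-1 / 2) • ins X (fundRep q) U x (pt (fe q 1) u) := by
  rw [ins_pt, leftOp_pt, fundBraid0, map_add, map_smul, map_smul]
  rfl

lemma leftOp_fundBraid1 (X : StarRep (coideal q t)) (U : StarRep (Uq q)) (x : X.carrier)
    (u : U.carrier) : leftOp U (fundBraid X) (ins X (fundRep q) U x (pt (fe q 1) u)) =
      -qpow q (-1 / 2) • ins X (fundRep q) U x (pt (fe q 0) u) := by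
  rw [ins_pt, leftOp_pt, fundBraid1, map_smul]
  rfl

/-- The octagon equation for `(U, V)`, evaluated on the vectors `(x ⊗ u) ⊗ v`. -/
lemma octagon_fund_lin (X : StarRep (coideal q t)) {U : StarRep (Uq q)} (hU : admissible q U) :
    fundBraid (X.tens U) =
      swapL X (fundRep q) U ∘ₗ leftOp U (fundBraid X) ∘ₗ swapL X U (fundRep q) := by
  refine ins_ext fun x => ext_pt_wt hU admissible_fundRep fun m _ u hu v _ => ?_
  suffices h : fundBraid (X.tens U) ∘ₗ ins X U (fundRep q) x ∘ₗ ptL U (fundRep q) u =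
      (swapL X (fundRep q) U ∘ₗ leftOp U (fundBraid X) ∘ₗ swapL X U (fundRep q)) ∘ₗ
        ins X U (fundRep q) x ∘ₗ ptL U (fundRep q) u from LinearMap.congr_fun h v
  have hJ : opJ U u = op U .F u - (qc q ^ 2)⁻¹ • qc q ^ (-m) • op U .E u := by
    rw [opJ, LinearMap.sub_apply, LinearMap.smul_apply, LinearMap.comp_apply, wt_Ki hu, map_smul]
  have h0 := qc_ne_zero q
  have e1 : qpow q ((m : ℝ) / 2) * qpow q (-(m : ℝ) / 2) = 1 := by
    rw [← qpow_add, show (m : ℝ) / 2 + -(m : ℝ) / 2 = 0 by ring, qpow_zero]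
  have e2 : qpow q (-(m : ℝ) / 2) * qpow q (-(m : ℝ) / 2) = qc q ^ (-m) := by
    rw [← qpow_add, ← qpow_int]
    congr 1
    push_cast
    ring
  have e3 : qpow q (-1 / 2) * qpow q (-1 / 2) = (qc q)⁻¹ := by
    rw [← qpow_add, show (-1 / 2 : ℝ) + -1 / 2 = -1 by norm_num, qpow_neg, qpow_one]
  have e4 : qpow q (-((m + 2 : ℤ) : ℝ) / 2) = qpow q (-(m : ℝ) / 2) * (qc q)⁻¹ := by
    rw [qpow_shift (s := -(m : ℝ) / 2) (-1) (by push_cast; ring), zpow_neg_one]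
  have hE := wt_E hu
  apply fund_ext
  · simp only [LinearMap.comp_apply, ptL_apply]
    rw [swapL_ins, braid_to_fund0 hU hu]
    simp only [map_add, map_smul, leftOp_fundBraid0, leftOp_fundBraid1, swapL_ins,
      braid_from_fund0 hu, braid_from_fund0 hE, braid_from_fund1 hu]
    rw [e4, ins_pt, fundBraid0, opB_tens, wt_Ki hu, hJ]
    simp only [map_add, map_sub, map_smul, LinearMap.add_apply, LinearMap.sub_apply,
      LinearMap.smul_apply, ← ins_pt]
    have e5 := qpow_half' (q := q)
    have e6 : (qc q ^ 2)⁻¹ = (qc q)⁻¹ * (qc q)⁻¹ := by rw [pow_two, mul_inv]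
    rw [e6]
    generalize qpow q ((m : ℝ) / 2) = a at *
    generalize qpow q (-(m : ℝ) / 2) = b at *
    generalize qpow q (1 / 2) = c at *
    generalize qpow q (-1 / 2) = d at *
    generalize qc q ^ (-m) = k at *
    generalize (qc q)⁻¹ = q' at *
    generalize qc q = q₀ at *
    subst e2 e3
    match_scalars
    · ring
    · linear_combination -(d * d - q₀) * (c * d * e1 + e5)
    · ring
    · linear_combination -d * e1
  · simp only [LinearMap.comp_apply, ptL_apply]
    rw [swapL_ins, braid_to_fund1 hU hu]
    simp only [map_smul, leftOp_fundBraid1, swapL_ins, braid_from_fund0 hu]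
    rw [ins_pt, fundBraid1, smul_smul, smul_smul, mul_right_comm, e1, one_mul]
    rfl

lemma octagon_fund (X : RepEps q t) (U : RepUq q) : Octagon twE X U (fund q) := by
  rw [Octagon]
  ext1; ext1
  have h1 : (twistBraid twE (X ⊙ᵣ U) (fund q)).hom.hom.lin = fundBraid (X.obj.tens U.obj) :=
    tw_fund _
  have h2 : ((twistBraid twE X (fund q)).hom ⊵ᵣ U).hom.lin = leftOp U.obj (fundBraid X.obj) :=
    congrArg (leftOp U.obj) (tw_fund X.obj)
  refine h1.trans ((octagon_fund_lin X.obj U.property).trans ?_)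
  rw [← h2]
  rfl

/-- Linear maps on `X ⊙ W` agree if they agree on the images of all intertwiners from tensor powers
of the fundamental representation to `W`. -/
lemma ext_tpow {X : StarRep (coideal q t)} {W : RepUq q} {M : Type*} [AddCommGroup M] [Module ℂ M]
    {f g : (X.tens W.obj).carrier →ₗ[ℂ] M}
    (h : ∀ n (φ : tpow q n ⟶ W), f ∘ₗ rightOp X φ.hom.lin = g ∘ₗ rightOp X φ.hom.lin) :
    f = g := by
  refine ptB_ext fun x => ?_
  suffices h' : (⊤ : Submodule ℂ W.obj.carrier) ≤
      LinearMap.eqLocus (f ∘ₗ ptB X W.obj x) (g ∘ₗ ptB X W.obj x) from fun w => h' trivial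
  rw [← iSup_range_tpow W]
  refine iSup_le fun n => iSup_le fun φ => ?_
  rintro _ ⟨y, rfl⟩
  exact LinearMap.congr_fun (h n φ) (ptB X _ x y)

lemma octagon_tpow (X : RepEps q t) (U : RepUq q) (n : ℕ) : Octagon twE X U (tpow q n) := by
  induction n generalizing X with
  | zero => exact Octagon.unit twE_natural X U
  | succ n ih => exact Octagon.tensor twE_natural ih (fun X => octagon_fund X U) X

lemma octagon_twE (X : RepEps q t) (U W : RepUq q) : Octagon twE X U W := by
  rw [Octagon]
  ext1; ext1
  refine ext_tpow fun n φ => ?_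
  have := Octagon.comp twE_natural (octagon_tpow X U n) φ
  exact congrArg (fun f => f.hom.lin) this

/-- A ribbon braid on the module category generated by `ε`. -/
def twistRibbon (q : Set.Ioo (0 : ℝ) 1) (t : ℝ) : RibbonBraid (RepUq q) (RepEps q t) :=
  RibbonBraid.ofTwist twE_natural octagon_twE

lemma braidC_twistRibbon : braidC (twistRibbon q t) = fundBraid (epsRep q t) := tw_fund _

/-! ### The operator `C` -/

section operatorC

/-- The coordinates of vectors of the fundamental representation. -/
def fco (q : Set.Ioo (0 : ℝ) 1) (i : Fin 2) : (fundRep q).carrier →ₗ[ℂ] ℂ :=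
  (EuclideanSpace.proj i : EuclideanSpace ℂ (Fin 2) →L[ℂ] ℂ).toLinearMap

lemma fco_fe (i j : Fin 2) : fco q i (fe q j) = if i = j then 1 else 0 := by
  change (EuclideanSpace.single j (1 : ℂ)) i = _
  simp

/-- The basis vector of `ε`. -/
def epsVec (q : Set.Ioo (0 : ℝ) 1) (t : ℝ) : (epsRep q t).carrier := (1 : ℂ)

/-- The basis vectors `1 ⊗ e_i` of `ε ⊙ V`. -/
def ev (q : Set.Ioo (0 : ℝ) 1) (t : ℝ) (i : Fin 2) : ((epsRep q t).tens (fundRep q)).carrier :=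
  ptB (epsRep q t) (fundRep q) (epsVec q t) (fe q i)

/-- The coordinates of vectors of `ε ⊙ V`. -/
def eco (q : Set.Ioo (0 : ℝ) 1) (t : ℝ) (i : Fin 2) :
    ((epsRep q t).tens (fundRep q)).carrier →ₗ[ℂ] ℂ :=
  fco q i ∘ₗ (TensorProduct.lid ℂ (fundRep q).carrier).toLinearMap

lemma eco_ev (i j : Fin 2) : eco q t i (ev q t j) = if i = j then 1 else 0 := by
  rw [← fco_fe (q := q)]
  exact congrArg (fco q i) (one_smul ℂ _)

lemma ev_ext {M : Type*} [AddCommGroup M] [Module ℂ M]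
    {f g : ((epsRep q t).tens (fundRep q)).carrier →ₗ[ℂ] M}
    (h0 : f (ev q t 0) = g (ev q t 0)) (h1 : f (ev q t 1) = g (ev q t 1)) : f = g := by
  have h : f ∘ₗ ptB (epsRep q t) (fundRep q) (epsVec q t) = g ∘ₗ ptB (epsRep q t) (fundRep q) (epsVec q t) :=
    fund_ext h0 h1
  refine ptB_ext fun x v => ?_
  obtain ⟨c, rfl⟩ : ∃ c : ℂ, c • epsVec q t = x := ⟨x, mul_one (M := ℂ) x⟩
  rw [map_smul, LinearMap.smul_apply, map_smul, map_smul]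
  exact congrArg (c • ·) (LinearMap.congr_fun h v)

lemma ev_sum (z : ((epsRep q t).tens (fundRep q)).carrier) :
    z = eco q t 0 z • ev q t 0 + eco q t 1 z • ev q t 1 := by
  have h : LinearMap.id = (eco q t 0).smulRight (ev q t 0) + (eco q t 1).smulRight (ev q t 1) := by
    apply ev_ext <;> simp [eco_ev]
  exact LinearMap.congr_fun h z

lemma opB_eps : opB (epsRep q t) (epsVec q t) = (Complex.I * t) • epsVec q t := by
  refine (StarRep.ofChar_π ((counitStar (Uq q)).comp (coideal q t).subtype) _ _).trans ?_
  change Bialgebra.counitAlgHom ℂ (Uq q) (Bt q t) * _ = _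
  rw [Bt, map_add, map_sub, map_smul, map_smul, map_mul, counit_gen, counit_gen, counit_gen]
  simp [counitGen]
  rfl

lemma opB_ev0 : opB ((epsRep q t).tens (fundRep q)) (ev q t 0) =
    (Complex.I * t * (qc q)⁻¹) • ev q t 0 + qpow q (-1 / 2) • ev q t 1 := by
  rw [ev, opB_tens, opB_eps, fund_Ki0, fund_J0, map_smul, map_smul, map_smul, LinearMap.smul_apply,
    smul_smul, mul_comm (qc q)⁻¹]
  rfl

lemma opB_ev1 : opB ((epsRep q t).tens (fundRep q)) (ev q t 1) =
    (Complex.I * t * qc q) • ev q t 1 - qpow q (-1 / 2) • ev q t 0 := by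
  rw [ev, opB_tens, opB_eps, fund_Ki1, fund_J1, map_smul, map_smul, map_smul, LinearMap.smul_apply,
    smul_smul, mul_comm (qc q), neg_smul, ← sub_eq_add_neg]
  rfl

lemma fundBraid_ev0 : fundBraid (epsRep q t) (ev q t 0) =
    (((qc q)⁻¹ - qc q) * (Complex.I * t)) • ev q t 0 + qpow q (-1 / 2) • ev q t 1 := by
  rw [ev, fundBraid0, opB_eps, map_smul, LinearMap.smul_apply, smul_smul]
  rfl

lemma fundBraid_ev1 : fundBraid (epsRep q t) (ev q t 1) = -qpow q (-1 / 2) • ev q t 0 :=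
  fundBraid1 _ _

/-- The operator `C` of the ribbon braid `twistRibbon` has a nonzero matrix entry off the
diagonal. -/
lemma nonScalar_twistRibbon : NonScalar (twistRibbon q t) := by
  intro c hc
  rw [braidC_twistRibbon] at hc
  have h := congrArg (eco q t 1) (LinearMap.congr_fun hc (ev q t 0))
  change eco q t 1 (fundBraid (epsRep q t) (ev q t 0)) = eco q t 1 (c • ev q t 0) at h
  rw [fundBraid_ev0, map_add, map_smul, map_smul, map_smul, eco_ev, eco_ev] at h
  simp [-one_div] at h
  exact qpow_ne_zero _ h

variable (η : RibbonBraid (RepUq q) (RepEps q t))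

/-- The operator `C`, on the underlying space written as a tensor product. -/
def braidOp : ((epsRep q t).tens (fundRep q)).carrier →ₗ[ℂ]
    ((epsRep q t).tens (fundRep q)).carrier := braidC η

lemma braidOp_comm : braidOp η ∘ₗ opB ((epsRep q t).tens (fundRep q)) =
    opB ((epsRep q t).tens (fundRep q)) ∘ₗ braidOp η :=
  (η.η (eps q t) (fund q)).hom.hom.comm (btc q t)

/-- As an intertwiner, `C` commutes with `B_t`, so that its four matrix entries depend on two
numbers. -/
lemma exists_braidC_entries : ∃ a b d : ℂ, braidOp η (ev q t 0) = a • ev q t 0 + b • ev q t 1 ∧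
    braidOp η (ev q t 1) = -b • ev q t 0 + d • ev q t 1 ∧
    qpow q (-1 / 2) * (a - d) = b * (Complex.I * t) * ((qc q)⁻¹ - qc q) := by
  obtain ⟨a, b, h0⟩ : ∃ a b : ℂ, braidOp η (ev q t 0) = a • ev q t 0 + b • ev q t 1 :=
    ⟨_, _, ev_sum _⟩
  obtain ⟨c, d, h1⟩ : ∃ c d : ℂ, braidOp η (ev q t 1) = c • ev q t 0 + d • ev q t 1 :=
    ⟨_, _, ev_sum _⟩
  have h : braidOp η (opB ((epsRep q t).tens (fundRep q)) (ev q t 0)) =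
      opB ((epsRep q t).tens (fundRep q)) (braidOp η (ev q t 0)) :=
    LinearMap.congr_fun (braidOp_comm η) (ev q t 0)
  have h' : braidOp η ((Complex.I * t * (qc q)⁻¹) • ev q t 0 + qpow q (-1 / 2) • ev q t 1) =
      (Complex.I * t * (qc q)⁻¹) • (a • ev q t 0 + b • ev q t 1) +
        qpow q (-1 / 2) • (c • ev q t 0 + d • ev q t 1) := by
    rw [← h0, ← h1, ← map_smul, ← map_smul, ← map_add]
  rw [opB_ev0, h', h0, map_add, map_smul, map_smul, opB_ev0, opB_ev1] at h
  have e0 := congrArg (eco q t 0) h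
  have e1 := congrArg (eco q t 1) h
  simp only [map_add, map_sub, map_smul, eco_ev, smul_eq_mul] at e0 e1
  simp [-one_div] at e0 e1
  have hc : c = -b := by
    refine mul_left_cancel₀ (qpow_ne_zero (q := q) (-1 / 2)) ?_
    linear_combination e0
  exact ⟨a, b, d, h0, by rw [← hc, h1], by linear_combination -e1⟩

end operatorC

/-! ### The constraint from the invariant vector of `V ⊗ V` -/

section invariant

/-- The invariant vector `e_0 ⊗ e_1 - q e_1 ⊗ e_0` of `V ⊗ V`. -/
def invVec (q : Set.Ioo (0 : ℝ) 1) : ((fundRep q).tens (fundRep q)).carrier :=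
  pt (fe q 0) (fe q 1) - qc q • pt (fe q 1) (fe q 0)

lemma K_invVec : op ((fundRep q).tens (fundRep q)) .K (invVec q) = invVec q := by
  have h0 := qc_ne_zero q
  rw [invVec, map_sub, map_smul, tens_K, tens_K, fund_K0, fund_K1, pt_smul_left, pt_smul_right,
    pt_smul_left, pt_smul_right, smul_smul, smul_smul, mul_inv_cancel₀ h0, one_smul,
    one_smul]

lemma E_invVec : op ((fundRep q).tens (fundRep q)) .E (invVec q) = 0 := by
  rw [invVec, map_sub, map_smul, tens_E, tens_E, fund_K0, fund_K1, fund_E0, fund_E1, pt_zero_left,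
    pt_zero_right, pt_smul_left, pt_smul_left, pt_smul_right]
  module

lemma F_invVec : op ((fundRep q).tens (fundRep q)) .F (invVec q) = 0 := by
  rw [invVec, map_sub, map_smul, tens_F, tens_F, fund_Ki0, fund_Ki1, fund_F0, fund_F1,
    pt_zero_left, pt_zero_right, pt_smul_left, pt_smul_right, pt_smul_right]
  module

/-- The basis vector of the tensor unit. -/
def unitVec (q : Set.Ioo (0 : ℝ) 1) : (𝟙_ (RepUq q) : RepUq q).obj.carrier := (1 : ℂ)

lemma unit_ext {M : Type*} [AddCommGroup M] [Module ℂ M]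
    {f g : (𝟙_ (RepUq q) : RepUq q).obj.carrier →ₗ[ℂ] M} (h : f (unitVec q) = g (unitVec q)) :
    f = g := LinearMap.ext_ring (R := ℂ) h

lemma op_unitVec (g : Gen) :
    op (𝟙_ (RepUq q) : RepUq q).obj g (unitVec q) = counitGen g • unitVec q := by
  refine (StarRep.ofChar_π (counitStar (Uq q)) _ _).trans ?_
  change Bialgebra.counitAlgHom ℂ (Uq q) (gen q g) * _ = _
  rw [counit_gen]
  rfl

/-- The linear map that sends the basis vector of the tensor unit to `w`. -/
def unitMap {W : StarRep (Uq q)} (w : W.carrier) :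
    (𝟙_ (RepUq q) : RepUq q).obj.carrier →ₗ[ℂ] W.carrier :=
  (LinearMap.id : ℂ →ₗ[ℂ] ℂ).smulRight w

lemma unitMap_apply {W : StarRep (Uq q)} (w : W.carrier) : unitMap w (unitVec q) = w :=
  one_smul ℂ w

lemma unitMap_comm {W : StarRep (Uq q)} {w : W.carrier} {g : Gen}
    (h : op W g w = counitGen g • w) :
    unitMap w ∘ₗ op (𝟙_ (RepUq q) : RepUq q).obj g = op W g ∘ₗ unitMap w :=
  unit_ext (by
    rw [LinearMap.comp_apply, LinearMap.comp_apply, op_unitVec, map_smul, unitMap_apply, h])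

/-- The intertwiner `𝟙 ⟶ V ⊗ V` given by the invariant vector. -/
def invHom (q : Set.Ioo (0 : ℝ) 1) : 𝟙_ (RepUq q) ⟶ fund q ⊗ fund q :=
  ObjectProperty.homMk ⟨unitMap (invVec q), comm_of_KEF
    (unitMap_comm (K_invVec.trans (one_smul ℂ _).symm))
    (unitMap_comm (E_invVec.trans (zero_smul ℂ _).symm))
    (unitMap_comm (F_invVec.trans (zero_smul ℂ _).symm))⟩

variable (η : RibbonBraid (RepUq q) (RepEps q t))

/-- The ribbon and octagon equations for `V ⊗ V`, on the image of the invariant vector, where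
the ribbon braid is trivial. -/
lemma braid_invHom : eps q t ⊴ᵣ invHom q ≫ (αᵣ (eps q t) (fund q) (fund q)).hom ≫
    (η.η (eps q t) (fund q)).hom ⊵ᵣ fund q ≫ swapAct (eps q t) (fund q) (fund q) ≫
      (η.η (eps q t) (fund q)).hom ⊵ᵣ fund q ≫ swapAct (eps q t) (fund q) (fund q) =
    eps q t ⊴ᵣ invHom q ≫ (αᵣ (eps q t) (fund q) (fund q)).hom := by
  have h := η.naturality (𝟙 (eps q t)) (invHom q)
  rw [id_actionHom, η.unit, Category.id_comp, η.ribbon, η.octagon] at h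
  have h' := congrArg (· ≫ (αᵣ (eps q t) (fund q) (fund q)).hom) h
  simp only [Category.assoc, Iso.inv_hom_id, Category.comp_id] at h'
  simp only [swapAct, Category.assoc]
  exact h'

/-- The vectors `(1 ⊗ u) ⊗ v` of `(ε ⊙ V) ⊙ V`. -/
abbrev insV (q : Set.Ioo (0 : ℝ) 1) (t : ℝ) :
    ((fundRep q).tens (fundRep q)).carrier →ₗ[ℂ]
      (((epsRep q t).tens (fundRep q)).tens (fundRep q)).carrier :=
  ins (epsRep q t) (fundRep q) (fundRep q) (epsVec q t)

lemma braid_invVec : swapL (epsRep q t) (fundRep q) (fundRep q) (leftOp (fundRep q) (braidOp η)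
    (swapL (epsRep q t) (fundRep q) (fundRep q) (leftOp (fundRep q) (braidOp η)
      (insV q t (invVec q))))) = insV q t (invVec q) := by
  have h := LinearMap.congr_fun (congrArg (fun f => f.hom.lin) (braid_invHom η))
    (ptB (epsRep q t) (𝟙_ (RepUq q) : RepUq q).obj (epsVec q t) (unitVec q))
  have h1 : (eps q t ⊴ᵣ invHom q ≫ (αᵣ (eps q t) (fund q) (fund q)).hom).hom.lin
      (ptB (epsRep q t) (𝟙_ (RepUq q) : RepUq q).obj (epsVec q t) (unitVec q)) = insV q t (invVec q) :=
    congrArg (insV q t) (unitMap_apply (invVec q))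
  have h2 := congrArg (fun z => swapL (epsRep q t) (fundRep q) (fundRep q)
    (leftOp (fundRep q) (braidOp η) (swapL (epsRep q t) (fundRep q) (fundRep q)
      (leftOp (fundRep q) (braidOp η) z)))) h1
  exact h2.symm.trans (h.trans h1)

/-- The coordinates of vectors of `(ε ⊙ V) ⊙ V`. -/
def eco2 (q : Set.Ioo (0 : ℝ) 1) (t : ℝ) (i j : Fin 2) :
    (((epsRep q t).tens (fundRep q)).tens (fundRep q)).carrier →ₗ[ℂ] ℂ :=
  LinearMap.mul' ℂ ℂ ∘ₗ TensorProduct.map (eco q t i) (fco q j)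

lemma eco2_ins (i j k l : Fin 2) : eco2 q t i j (insV q t (pt (fe q k) (fe q l))) =
    (if i = k then 1 else 0) * if j = l then 1 else 0 := by
  rw [← eco_ev (q := q) (t := t), ← fco_fe (q := q)]
  rfl

variable {η}

lemma leftOp_ev0 {a b : ℂ} (h : braidOp η (ev q t 0) = a • ev q t 0 + b • ev q t 1)
    (v : (fundRep q).carrier) : leftOp (fundRep q) (braidOp η) (insV q t (pt (fe q 0) v)) =
      insV q t (a • pt (fe q 0) v + b • pt (fe q 1) v) := by
  have h1 : leftOp (fundRep q) (braidOp η) (insV q t (pt (fe q 0) v)) =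
    ptB _ _ (braidOp η (ev q t 0)) v := rfl
  rw [h1, h, map_add, map_smul, map_smul, map_add, map_smul, map_smul]
  rfl

lemma leftOp_ev1 {a b : ℂ} (h : braidOp η (ev q t 1) = a • ev q t 0 + b • ev q t 1)
    (v : (fundRep q).carrier) : leftOp (fundRep q) (braidOp η) (insV q t (pt (fe q 1) v)) =
      insV q t (a • pt (fe q 0) v + b • pt (fe q 1) v) := by
  have h1 : leftOp (fundRep q) (braidOp η) (insV q t (pt (fe q 1) v)) =
    ptB _ _ (braidOp η (ev q t 1)) v := rfl
  rw [h1, h, map_add, map_smul, map_smul, map_add, map_smul, map_smul]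
  rfl

lemma braid_fe00 : braidLin (fundRep q) (fundRep q) (pt (fe q 0) (fe q 0)) =
    qpow q (-1 / 2) • pt (fe q 0) (fe q 0) := by
  have := braid_from_fund0 (wt_fe0 (q := q))
  rwa [Int.cast_one] at this

lemma braid_fe01 : braidLin (fundRep q) (fundRep q) (pt (fe q 0) (fe q 1)) =
    qpow q (1 / 2) • pt (fe q 1) (fe q 0) := by
  have := braid_from_fund0 (wt_fe1 (q := q))
  rwa [Int.cast_neg, Int.cast_one, neg_neg] at this

lemma braid_fe11 : braidLin (fundRep q) (fundRep q) (pt (fe q 1) (fe q 1)) =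
    qpow q (-1 / 2) • pt (fe q 1) (fe q 1) := by
  have := braid_to_fund1 admissible_fundRep (wt_fe1 (q := q))
  rwa [Int.cast_neg, Int.cast_one] at this

lemma braid_fe10 : braidLin (fundRep q) (fundRep q) (pt (fe q 1) (fe q 0)) =
    qpow q (1 / 2) • (pt (fe q 0) (fe q 1) + ((qc q)⁻¹ - qc q) • pt (fe q 1) (fe q 0)) := by
  have := braid_to_fund0 admissible_fundRep (wt_fe1 (q := q))
  rw [Int.cast_neg, Int.cast_one, neg_neg, fund_E1, pt_smul_right, smul_smul] at this
  rw [this, smul_add, smul_smul]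
  congr 2
  linear_combination qpow q (1 / 2) * ((qc q)⁻¹ - qc q) * qpow_half (q := q)

lemma sq_qpow_half : qpow q (1 / 2) * qpow q (1 / 2) = qc q := by
  rw [← qpow_add, show (1 / 2 : ℝ) + 1 / 2 = 1 by norm_num, qpow_one]

lemma qc_mul_qpow : qc q * qpow q (-1 / 2) = qpow q (1 / 2) := by
  rw [← qpow_one, ← qpow_add]
  norm_num

/-- If `C` is not scalar, then the invariant vector determines `C` up to a sign. -/
lemma sign_of_entries {a b d : ℂ} (h0 : braidOp η (ev q t 0) = a • ev q t 0 + b • ev q t 1)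
    (h1 : braidOp η (ev q t 1) = -b • ev q t 0 + d • ev q t 1) (hb : b ≠ 0) :
    d = 0 ∧ qc q * b ^ 2 = 1 := by
  have h := braid_invVec η
  have hq := qc_ne_zero q
  have hD := qc_sub_ne' (q := q)
  have hk := qpow_ne_zero (q := q) (1 / 2)
  have e1 := sq_qpow_half (q := q)
  have e2 := qc_mul_qpow (q := q)
  have e3 := qpow_half' (q := q)
  simp only [invVec, map_sub, map_add, map_smul, leftOp_ev0 h0, leftOp_ev1 h1, swapL_ins,
    braid_fe00, braid_fe01, braid_fe10, braid_fe11] at h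
  -- compare the coefficients of `e_0 ⊗ e_0` and of `e_0 ⊗ e_1`
  have c00 := congrArg (eco2 q t 0 0) h
  have c01 := congrArg (eco2 q t 0 1) h
  simp only [map_sub, map_add, map_smul, eco2_ins, smul_eq_mul] at c00 c01
  simp [-one_div] at c00 c01
  generalize qpow q (1 / 2) = k at *
  generalize qpow q (-1 / 2) = l at *
  have hd : d = 0 := by
    have h2 : qc q * ((qc q)⁻¹ - qc q) * b * d = 0 := by
      linear_combination c00 - qc q * ((qc q)⁻¹ - qc q) * b * d * e3 - a * b * l * e2
    exact (mul_eq_zero.1 h2).resolve_left (mul_ne_zero (mul_ne_zero hq hD) hb)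
  subst hd
  exact ⟨rfl, by linear_combination c01 - qc q * b ^ 2 * e3⟩

/-- If `C` is not scalar, then it is the operator `B_{ε ⊙ V} - q B_ε ⊗ 1`, up to a sign. -/
theorem braidOp_eq (hη : NonScalar η) : ∃ s : ℂ, (s = 1 ∨ s = -1) ∧
    braidOp η = s • fundBraid (epsRep q t) := by
  obtain ⟨a, b, d, h0, h1, h2⟩ := exists_braidC_entries η
  have hl := qpow_ne_zero (q := q) (-1 / 2)
  have hb : b ≠ 0 := by
    rintro rfl
    have had : a = d := by
      rw [zero_mul, zero_mul] at h2
      exact sub_eq_zero.1 ((mul_eq_zero.1 h2).resolve_left hl)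
    refine hη a (ev_ext (h0.trans ?_) (h1.trans ?_))
    · rw [zero_smul, add_zero]; rfl
    · rw [neg_zero, zero_smul, zero_add, ← had]; rfl
  obtain ⟨rfl, h3⟩ := sign_of_entries h0 h1 hb
  set s := b * qpow q (1 / 2) with hs
  have hbs : b = s * qpow q (-1 / 2) := by
    rw [hs, mul_assoc, qpow_half, mul_one]
  refine ⟨s, mul_self_eq_one_iff.1 ?_, ev_ext ?_ ?_⟩
  · linear_combination h3 + b ^ 2 * sq_qpow_half (q := q)
  · refine h0.trans ?_
    rw [LinearMap.smul_apply, fundBraid_ev0, smul_add, smul_smul, smul_smul, ← hbs]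
    congr 2
    refine mul_left_cancel₀ hl ?_
    linear_combination h2 + Complex.I * t * ((qc q)⁻¹ - qc q) * hbs
  · refine h1.trans ?_
    rw [LinearMap.smul_apply, fundBraid_ev1, smul_smul, mul_neg, ← hbs, zero_smul, add_zero]

end invariant

/-! ### The parity automorphism of the identity functor -/

section parity

open Classical in
/-- The function with value `(-1)^m` at `q^m`. -/
def parFun (q : Set.Ioo (0 : ℝ) 1) (z : ℂ) : ℂ := if ∃ m : ℤ, Even m ∧ z = qc q ^ m then 1 else -1

lemma parFun_zpow (m : ℤ) : parFun q (qc q ^ m) = (-1) ^ m := by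
  rw [parFun]
  split_ifs with h
  · obtain ⟨n, hn, hmn⟩ := h
    rw [qc_zpow_inj hmn, hn.neg_one_zpow]
  · rw [Odd.neg_one_zpow (Int.not_even_iff_odd.1 fun hm => h ⟨m, hm, rfl⟩)]

lemma parFun_mul_self (z : ℂ) : parFun q z * parFun q z = 1 := by
  rw [parFun]
  split_ifs <;> norm_num

/-- The parity operator, which multiplies vectors of weight `m` by `(-1)^m`. -/
def par (U : StarRep (Uq q)) : U.carrier →ₗ[ℂ] U.carrier := fcal (op U .K) (parFun q)

variable {U W : StarRep (Uq q)}

lemma par_apply {m : ℤ} {x : U.carrier} (hx : x ∈ wt U m) : par U x = (-1 : ℂ) ^ m • x := by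
  rw [par, fcal_apply (symm_K U) _ (wt_K hx), parFun_zpow]

lemma par_par : par U ∘ₗ par U = LinearMap.id := fcal_mul (symm_K U) parFun_mul_self

lemma adjoint_par : LinearMap.adjoint (par U) = par U := by
  have h : ∀ z, (starRingEnd ℂ) (parFun q z) = parFun q z := fun z => by
    rw [parFun]; split_ifs <;> simp
  rw [par, fcal, map_sum]
  refine Finset.sum_congr rfl fun μ _ => ?_
  rw [map_smulₛₗ, h]
  congr 1
  exact (LinearMap.eq_adjoint_iff _ _).2
    (Submodule.starProjection_isSymmetric (K := Module.End.eigenspace (op U .K) μ)) |>.symm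

lemma par_comm (hU : admissible q U) (a : Uq q) : par U ∘ₗ U.π a = U.π a ∘ₗ par U := by
  have h2 : ∀ m : ℤ, (-1 : ℂ) ^ (m + 2) = (-1) ^ m := fun m => by
    rw [zpow_add₀ (by norm_num)]; norm_num
  have h3 : ∀ m : ℤ, (-1 : ℂ) ^ (m - 2) = (-1) ^ m := fun m => by
    rw [zpow_sub₀ (by norm_num)]; norm_num
  refine comm_of_KEF (ext_wt hU fun m x hx => ?_) (ext_wt hU fun m x hx => ?_)
    (ext_wt hU fun m x hx => ?_) a
  · rw [LinearMap.comp_apply, LinearMap.comp_apply, par_apply hx, wt_K hx, map_smul, map_smul,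
      par_apply hx, wt_K hx, smul_comm]
  · rw [LinearMap.comp_apply, LinearMap.comp_apply, par_apply hx, par_apply (wt_E hx), h2, map_smul]
  · rw [LinearMap.comp_apply, LinearMap.comp_apply, par_apply hx, par_apply (wt_F hx), h3, map_smul]

lemma par_tens (hU : admissible q U) (hW : admissible q W) :
    par (U.tens W) = tmap (par U) (par W) := by
  refine ext_pt_wt hU hW fun m n u hu w hw => ?_
  rw [par_apply (wt_pt hu hw), tmap_pt, par_apply hu, par_apply hw, pt_smul_left, pt_smul_right,
    smul_smul, zpow_add₀ (by norm_num)]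

lemma par_unit : par (𝟙_ (RepUq q) : RepUq q).obj = LinearMap.id := by
  refine unit_ext ?_
  rw [par_apply (m := 0), zpow_zero, one_smul, LinearMap.id_apply]
  rw [mem_wt, zpow_zero]
  exact op_unitVec .K

lemma par_fund : par (fundRep q) = -LinearMap.id := by
  apply fund_ext
  · rw [par_apply wt_fe0]; simp
  · rw [par_apply wt_fe1]; simp

/-- Parity, as an automorphism of the identity functor. -/
def parity (q : Set.Ioo (0 : ℝ) 1) : 𝟭 (RepUq q) ≅ 𝟭 (RepUq q) :=
  NatIso.ofComponents (fun U => ObjectProperty.isoMk _ (StarRep.mkIso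
      (LinearEquiv.ofLinearMap (par U.obj) (par U.obj) par_par par_par) (par_comm U.property)))
    (fun {U W} f => by
      ext1; ext1
      exact (fcal_comm (symm_K U.obj) (symm_K W.obj) (f.hom.comm _) _).symm)

instance : NatTrans.IsMonoidal (parity q).hom where
  unit := by
    ext1; ext1
    exact congrArg (· ∘ₗ LinearMap.id) par_unit
  tensor U W := by
    ext1; ext1
    exact congrArg (· ∘ₗ LinearMap.id) (par_tens U.property W.property)

lemma parity_unitary (U : RepUq q) : IsUnitary ((parity q).app U) := by
  rw [IsUnitary]
  ext1; ext1
  exact adjoint_par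

end parity

/-! ### Uniqueness -/

section uniqueness

variable {η η' : RibbonBraid (RepUq q) (RepEps q t)} {F : 𝟭 (RepUq q) ≅ 𝟭 (RepUq q)}

lemma agree_tpow [NatTrans.IsMonoidal F.hom] (h : Agree η η' F (eps q t) (fund q)) (n : ℕ) :
    Agree η η' F (eps q t) (tpow q n) := by
  induction n with
  | zero => exact Agree.unit _
  | succ n ih => exact Agree.tensor ih (Agree.act h _)

lemma agree_eps [NatTrans.IsMonoidal F.hom] (h : Agree η η' F (eps q t) (fund q)) (U : RepUq q) :
    Agree η η' F (eps q t) U := by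
  rw [Agree]
  ext1; ext1
  refine ext_tpow (X := epsRep q t) fun n φ => ?_
  exact congrArg (fun f => f.hom.lin) (Agree.comp_right (agree_tpow h n) φ)

lemma Agree.of_retract {X Y : RepEps q t} {U : RepUq q} (h : Agree η η' F Y U) (f : X ⟶ Y)
    (g : Y ⟶ X) (hfg : f ≫ g = 𝟙 X) : Agree η η' F X U := by
  have h1 := congrArg (· ≫ g ⊵ᵣ U) (h.comp_left f)
  rw [Agree]
  simpa only [Category.assoc, ← comp_actionHomLeft, hfg, id_actionHomLeft, Category.comp_id] using h1

/-- Ribbon braids that agree on `ε ⊙ V` agree everywhere: the octagon equation carries the identity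
along the action, and naturality carries it to direct sums and subobjects. -/
lemma agree_of_fund [NatTrans.IsMonoidal F.hom] (h : Agree η η' F (eps q t) (fund q))
    (X : RepEps q t) (U : RepUq q) : Agree η η' F X U := by
  obtain ⟨X, hX⟩ := X
  induction hX generalizing U with
  | base => exact agree_eps h U
  | iso e hZ ih =>
    exact (ih U).of_retract (ObjectProperty.homMk e.hom) (ObjectProperty.homMk e.inv)
      (by ext1; exact e.hom_inv_id)
  | sub v hv hZ ih =>
    exact (ih U).of_retract (ObjectProperty.homMk v)
      (ObjectProperty.homMk (StarCategory.dag v)) (by ext1; exact hv)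
  | @sum Y Z W u v hu hv huv hY hZ ihY ihZ =>
    set W' : RepEps q t := ⟨W, .sum u v hu hv huv hY hZ⟩
    have h1 := (ihY U).comp_left (X := W') (ObjectProperty.homMk (StarCategory.dag u))
    have h2 := (ihZ U).comp_left (X := W') (ObjectProperty.homMk (StarCategory.dag v))
    rw [Agree]
    ext1; ext1
    set f := (η'.η W' U).hom.hom.lin
    set g := (W' ⊴ᵣ F.hom.app U ≫ (η.η W' U).hom).hom.lin
    have h1' : leftOp U.obj (StarCategory.dag u).lin ∘ₗ f =
        leftOp U.obj (StarCategory.dag u).lin ∘ₗ g := congrArg (fun f => f.hom.lin) h1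
    have h2' : leftOp U.obj (StarCategory.dag v).lin ∘ₗ f =
        leftOp U.obj (StarCategory.dag v).lin ∘ₗ g := congrArg (fun f => f.hom.lin) h2
    have h3 : leftOp U.obj u.lin ∘ₗ leftOp U.obj (StarCategory.dag u).lin +
        leftOp U.obj v.lin ∘ₗ leftOp U.obj (StarCategory.dag v).lin = LinearMap.id := by
      refine ptB_ext fun x y => ?_
      have hx : u.lin ((StarCategory.dag u).lin x) + v.lin ((StarCategory.dag v).lin x) = x :=
        LinearMap.congr_fun (congrArg StarRep.Hom.lin huv) x
      simp only [LinearMap.add_apply, LinearMap.comp_apply, leftOp_pt]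
      rw [← LinearMap.add_apply, ← map_add, hx]
      rfl
    calc f = LinearMap.id ∘ₗ f := rfl
      _ = LinearMap.id ∘ₗ g := by
        rw [← h3, LinearMap.add_comp, LinearMap.add_comp, LinearMap.comp_assoc,
          LinearMap.comp_assoc, LinearMap.comp_assoc, LinearMap.comp_assoc, h1', h2']
      _ = g := rfl
  | act W hY ih => exact Agree.act (ih U) W

/-- Two ribbon braids for which `C` is not scalar are equivalent. -/
theorem exists_equivalence (hη : NonScalar η) (hη' : NonScalar η') :
    ∃ F : 𝟭 (RepUq q) ≅ 𝟭 (RepUq q),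
      IsBraidedEquivalence η η' F (𝟭 (RepEps q t)) (fun X U => Iso.refl (X ⊙ᵣ U)) := by
  obtain ⟨s, hs, h⟩ := braidOp_eq hη
  obtain ⟨s', hs', h'⟩ := braidOp_eq hη'
  have hss : braidOp η' = braidOp η ∨ braidOp η' = -braidOp η := by
    rw [h, h']
    rcases hs with rfl | rfl <;> rcases hs' with rfl | rfl <;> simp
  rcases hss with h1 | h1
  · have : NatTrans.IsMonoidal (Iso.refl (𝟭 (RepUq q))).hom :=
      inferInstanceAs (NatTrans.IsMonoidal (𝟙 (𝟭 (RepUq q))))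
    refine ⟨Iso.refl _, isBraidedEquivalence_of_agree this (fun U => StarCategory.dag_id _)
      (agree_of_fund ?_)⟩
    rw [Agree]
    ext1; ext1
    change braidOp η' = braidOp η ∘ₗ rightOp (epsRep q t) LinearMap.id
    rw [h1]
    exact ev_ext rfl rfl
  · -- opposite signs are exchanged by parity, which acts as `-1` on `V`
    refine ⟨parity q, isBraidedEquivalence_of_agree inferInstance parity_unitary
      (agree_of_fund ?_)⟩
    rw [Agree]
    ext1; ext1
    change braidOp η' = braidOp η ∘ₗ rightOp (epsRep q t) (par (fundRep q))
    rw [h1, par_fund]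
    refine ptB_ext fun x v => ?_
    rw [LinearMap.comp_apply, rightOp_pt, LinearMap.neg_apply, LinearMap.neg_apply,
      LinearMap.id_apply, map_neg, map_neg]

end uniqueness

/-! ### Singular values -/

section singular

/-- The singular values of an operator on a two-dimensional Hilbert space are determined by its
Hilbert-Schmidt norm and its determinant. -/
lemma singularValues_of_two {E : Type*} [NormedAddCommGroup E] [InnerProductSpace ℂ E]
    [FiniteDimensional ℂ E] (T : E →ₗ[ℂ] E) (b : OrthonormalBasis (Fin 2) ℂ E) {x y : ℝ}
    (hx : 0 ≤ x) (hy : 0 ≤ y) (hs : ‖T (b 0)‖ ^ 2 + ‖T (b 1)‖ ^ 2 = x ^ 2 + y ^ 2)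
    (hd : ‖LinearMap.det T‖ = x * y) :
    (Multiset.range (Module.finrank ℂ E)).map T.singularValues = {x, y} := by
  have hn : Module.finrank ℂ E = 2 := by
    rw [Module.finrank_eq_card_basis b.toBasis, Fintype.card_fin]
  have h1 : T.singularValues 0 * T.singularValues 1 = x * y := by
    rw [← hd, ← T.normDet_eq_norm_det, T.normDet_eq_prod_singularValues, hn,
      Finset.prod_range_succ, Finset.prod_range_one]
  have h2 : T.singularValues 0 ^ 2 + T.singularValues 1 ^ 2 = x ^ 2 + y ^ 2 := by
    have h3 := T.isSymmetric_adjoint_comp_self.trace_eq_sum_eigenvalues hn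
    rw [LinearMap.trace_eq_sum_inner _ b, Fin.sum_univ_two, Fin.sum_univ_two,
      LinearMap.comp_apply, LinearMap.comp_apply, LinearMap.adjoint_inner_right,
      LinearMap.adjoint_inner_right, inner_self_eq_norm_sq_to_K, inner_self_eq_norm_sq_to_K,
      ← T.sq_singularValues_fin, ← T.sq_singularValues_fin] at h3
    rw [← hs]
    exact_mod_cast h3.symm
  have p0 := T.singularValues_nonneg 0
  have p1 := T.singularValues_nonneg 1
  generalize hu : T.singularValues 0 = u at *
  generalize hv : T.singularValues 1 = v at *
  have h3 : u + v = x + y := by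
    rw [← sq_eq_sq₀ (add_nonneg p0 p1) (add_nonneg hx hy)]
    linear_combination h2 + 2 * h1
  have h4 : (u - x) * (u - y) = 0 := by linear_combination u * h3 - h1
  have h5 : (Multiset.range 2).map T.singularValues = {v, u} := by
    rw [← hu, ← hv, Multiset.range_succ, Multiset.range_succ, Multiset.range_zero]; simp
  rw [hn, h5]
  rcases mul_eq_zero.1 h4 with h | h
  · rw [sub_eq_zero.1 h, show v = y by linarith [sub_eq_zero.1 h], Multiset.pair_comm]
  · rw [sub_eq_zero.1 h, show v = x by linarith [sub_eq_zero.1 h]]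

/-- The orthonormal basis of the vectors `1 ⊗ e_i` of `ε ⊙ V`. -/
def evBasis (q : Set.Ioo (0 : ℝ) 1) (t : ℝ) :
    OrthonormalBasis (Fin 2) ℂ ((epsRep q t).tens (fundRep q)).carrier :=
  (EuclideanSpace.basisFun (Fin 2) ℂ).map
    (TensorProduct.lidIsometry ℂ (EuclideanSpace ℂ (Fin 2))).symm

lemma evBasis_apply (i : Fin 2) : evBasis q t i = ev q t i := by
  refine (OrthonormalBasis.map_apply _ _ _).trans ?_
  rw [EuclideanSpace.basisFun_apply]
  rfl

lemma norm_sq_ev (a b : ℂ) : ‖a • ev q t 0 + b • ev q t 1‖ ^ 2 = ‖a‖ ^ 2 + ‖b‖ ^ 2 := by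
  have h := (evBasis q t).sum_sq_norm_inner_right (a • ev q t 0 + b • ev q t 1)
  have ho := (evBasis q t).orthonormal
  rw [← h, Fin.sum_univ_two, ← evBasis_apply, ← evBasis_apply, inner_add_right, inner_add_right]
  simp only [inner_smul_right, orthonormal_iff_ite.1 ho]
  simp

lemma norm_qpow (s : ℝ) : ‖qpow q s‖ = (q : ℝ) ^ s := by
  rw [qpow, Complex.norm_real, Real.norm_of_nonneg (Real.rpow_nonneg q.2.1.le s)]

lemma det_fundBraid : LinearMap.det (fundBraid (epsRep q t)) =
    qpow q (-1 / 2) * qpow q (-1 / 2) := by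
  have h00 : ∀ i j, LinearMap.toMatrix (evBasis q t).toBasis (evBasis q t).toBasis
      (fundBraid (epsRep q t)) i j = eco q t i (fundBraid (epsRep q t) (ev q t j)) := by
    intro i j
    rw [LinearMap.toMatrix_apply, OrthonormalBasis.coe_toBasis, evBasis_apply]
    generalize fundBraid (epsRep q t) (ev q t j) = z
    have h : (evBasis q t).toBasis.coord i = eco q t i := ev_ext (by
      rw [eco_ev, ← evBasis_apply, ← OrthonormalBasis.coe_toBasis, Module.Basis.coord_apply,
        Module.Basis.repr_self, Finsupp.single_apply]; exact if_congr eq_comm rfl rfl) (by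
      rw [eco_ev, ← evBasis_apply, ← OrthonormalBasis.coe_toBasis, Module.Basis.coord_apply,
        Module.Basis.repr_self, Finsupp.single_apply]; exact if_congr eq_comm rfl rfl)
    exact LinearMap.congr_fun h z
  rw [← LinearMap.det_toMatrix (evBasis q t).toBasis, Matrix.det_fin_two, h00, h00, h00, h00,
    fundBraid_ev0, fundBraid_ev1]
  simp [eco_ev, -one_div]

/-- The singular values of `C`. -/
theorem singularValues_braidC {η : RibbonBraid (RepUq q) (RepEps q t)} (hη : NonScalar η) :
    (Multiset.range (Module.finrank ℂ (eps q t ⊙ᵣ fund q).obj.carrier)).map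
        (braidC η).singularValues =
      {(q : ℝ) ^ (lam q t - 1 / 2), (q : ℝ) ^ (-lam q t - 1 / 2)} := by
  obtain ⟨s, hs, h⟩ := braidOp_eq hη
  have hs1 : ‖s‖ = 1 := by rcases hs with rfl | rfl <;> simp
  have hq := q.2.1
  have hD : ((q : ℝ)⁻¹ - q) ≠ 0 := (sub_pos.2 (q.2.2.trans ((one_lt_inv₀ hq).2 q.2.2))).ne'
  have e1 : (q : ℝ) ^ (lam q t) * (q : ℝ) ^ (-lam q t) = 1 := by
    rw [← Real.rpow_add hq, add_neg_cancel, Real.rpow_zero]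
  have ht : ((q : ℝ)⁻¹ - q) * t =
      (q : ℝ) ^ (-1 / 2 : ℝ) * ((q : ℝ) ^ (-lam q t) - (q : ℝ) ^ lam q t) := by
    conv_lhs => rw [lam_spec q t]
    rw [show (-(1 / 2) : ℝ) = -1 / 2 by norm_num, mul_left_comm, mul_div_cancel₀ _ hD]
  refine singularValues_of_two (braidOp η) (evBasis q t) (Real.rpow_nonneg hq.le _)
    (Real.rpow_nonneg hq.le _) ?_ ?_
  · have h0 : ‖fundBraid (epsRep q t) (ev q t 0)‖ ^ 2 =
        (((q : ℝ)⁻¹ - q) * t) ^ 2 + ((q : ℝ) ^ (-1 / 2 : ℝ)) ^ 2 := by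
      rw [fundBraid_ev0, norm_sq_ev, norm_qpow]
      have : ((qc q)⁻¹ - qc q) * (Complex.I * t) = Complex.I * ((((q : ℝ)⁻¹ - q) * t : ℝ) : ℂ) := by
        rw [qc]; push_cast; ring
      rw [this, norm_mul, Complex.norm_I, one_mul, Complex.norm_real, Real.norm_eq_abs, sq_abs]
    have h1 : ‖fundBraid (epsRep q t) (ev q t 1)‖ ^ 2 = ((q : ℝ) ^ (-1 / 2 : ℝ)) ^ 2 := by
      have := norm_sq_ev (q := q) (t := t) (-qpow q (-1 / 2)) 0
      rw [zero_smul, add_zero, norm_zero, norm_neg, norm_qpow] at this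
      rw [fundBraid_ev1, this]
      ring
    rw [evBasis_apply, evBasis_apply, h, LinearMap.smul_apply, LinearMap.smul_apply, norm_smul,
      norm_smul, hs1, one_mul, one_mul, h0, h1, ht, sub_eq_add_neg (lam q t),
      sub_eq_add_neg (-lam q t), Real.rpow_add hq, Real.rpow_add hq,
      show (-(1 / 2) : ℝ) = -1 / 2 by norm_num]
    linear_combination -2 * ((q : ℝ) ^ (-1 / 2 : ℝ)) ^ 2 * e1
  · have hn : Module.finrank ℂ ((epsRep q t).tens (fundRep q)).carrier = 2 := by
      rw [Module.finrank_eq_card_basis (evBasis q t).toBasis, Fintype.card_fin]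
    rw [h, LinearMap.det_smul, norm_mul, norm_pow, hs1, one_pow, one_mul, det_fundBraid, norm_mul,
      norm_qpow, sub_eq_add_neg (lam q t),
      sub_eq_add_neg (-lam q t), Real.rpow_add hq, Real.rpow_add hq,
      show (-(1 / 2) : ℝ) = -1 / 2 by norm_num]
    linear_combination -((q : ℝ) ^ (-1 / 2 : ℝ)) ^ 2 * e1

end singular

end QSU2

end

open CategoryTheory MonoidalCategory MonoidalRightAction QSU2 in
theorem mainTheorem7 (q : Set.Ioo (0 : ℝ) 1) (t : ℝ) :
    -- existence
    (∃ η : RibbonBraid (RepUq q) (RepEps q t), NonScalar η) ∧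
    -- uniqueness up to equivalence
    (∀ η η' : RibbonBraid (RepUq q) (RepEps q t), NonScalar η → NonScalar η' →
      ∃ F : 𝟭 (RepUq q) ≅ 𝟭 (RepUq q),
        IsBraidedEquivalence η η' F (𝟭 (RepEps q t)) (fun X U => Iso.refl (X ⊙ᵣ U))) ∧
    -- the singular values of `C`
    (∀ η : RibbonBraid (RepUq q) (RepEps q t), NonScalar η →
      (Multiset.range (Module.finrank ℂ (eps q t ⊙ᵣ fund q).obj.carrier)).map
          (braidC η).singularValues =
        {(q : ℝ) ^ (lam q t - 1 / 2), (q : ℝ) ^ (-lam q t - 1 / 2)}) :=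
  ⟨⟨twistRibbon q t, nonScalar_twistRibbon⟩, fun _ _ => exists_equivalence,
    fun _ => singularValues_braidC⟩
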